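/- **Setting.** Let $R$ be a finite simply connected patch of the $\{5,4\}$ tiling of the hyperbolic plane, i.e. a set of pentagons obtained from one pentagon by successively attaching a new pentagon along exactly one edge, or along exactly two consecutive edges whose common vertex is thereby completely surrounded by its four pentagons. Put on each pentagon $t\in R$ the logical basis states of the five-qubit code, $|\bar b\rangle_5=\sum_{x\in\{0,1\}^5}T_b(x)|x\rangle$ with $T_b(x)=\frac14(-1)^{b+\sum_k x_kx_{k+1}}$ (indices mod $5$) if $\sum_k x_k\equiv b \pmod 2$ and $T_b(x)=0$ otherwise. These are the Majorana dimer states with dimers $1\to6,\ 3\to8,\ 5\to10$ of parity $(-1)^b$ and $2\to7,\ 4\to9$ of parity $+1$. Contract the pairs of legs that share an edge, with a factor $\sqrt2$ for each contraction; this gives the HaPPY code $V$, which sends a bulk basis state $|b\rangle$, $b\in\{0,1\}^R$, to a state $V|b\rangle$ of the $N$ qubits on the open boundary edges. Number these $1,\dots,N$ counterclockwise, starting anywhere, let $A$ be the set of the first $m$ of them and $A^c$ the set of the others, and let $\gamma_{2k-1}=Z_1\cdots Z_{k-1}X_k$, $\gamma_{2k}=Z_1\cdots Z_{k-1}Y_k$.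 A state $\psi$ has a dimer from mode $\mu$ to mode $\nu$ with parity $p=\pm1$ if $(\gamma_\mu+\mathrm i p\gamma_\nu)\psi=0$; then $-\mathrm i\gamma_\mu\gamma_\nu$, the parity operator of the dimer, has the value $p$ on $\psi$. Let $a\subseteq R$ be an entanglement wedge of $A$, i.e. suppose that complementary recovery holds: there is an injective unital $*$-homomorphism $\iota:B(\mathcal H^{\rm bulk}_a)\to B(\mathcal H_A)$ with $(\iota(O)\otimes 1)V=V(O\otimes1)$ for all $O$, and likewise for $a^c=R\setminus a$ and $A^c$. **Statement.** All states $V|b\rangle$ are Majorana dimer states, with $N$ mutually exclusive dimers whose end points do not depend on $b$; let $p_\delta(b)$ be the parity of the dimer $\delta$ in $V|b\rangle$. Call $\delta$ an RT dimer if it connects $A$ with $A^c$ (so that it crosses the RT surface, which separates $a$ from $a^c$). Then: 1. There is a set of *logical dimers* for $(A,a)$: a set $D_l$ of dimers that begin and end in $A$, with a bijection $D_l\to a$, such that for all $b,b'$ one has $b|_a=b'|_a$ if and only if $p_\delta(b)=p_\delta(b')$ for all $\delta\in D_l$. Likewise there is a set of logical dimers for $(A^c,a^c)$. The number of RT dimers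 is even, so they can be grouped into pairs. 2. For every choice of logical dimers and bijections for $(A,a)$ and for $(A^c,a^c)$, and every grouping of the RT dimers into pairs, let $\mathcal H_a$, $\mathcal H_{\chi_a}$, $\mathcal H_{a,\gamma}$ be tensor products of copies of $\mathbb C^2$, one for each logical dimer, for each auxiliary dimer (beginning and ending in $A$ and not logical), and for each pair of RT dimers, respectively; define $\mathcal H_{a^c}$, $\mathcal H_{\chi_{a^c}}$, $\mathcal H_{a^c,\gamma}$ likewise for $A^c$. Then there are unitaries $$U_A:\mathcal H_A\to\mathcal H_a\otimes\mathcal H_{\chi_a}\otimes\mathcal H_{a,\gamma},\qquad U_{A^c}:\mathcal H_{A^c}\to\mathcal H_{a^c}\otimes\mathcal H_{\chi_{a^c}}\otimes\mathcal H_{a^c,\gamma},$$ such that, writing $U_AU_{A^c}$ for $U_A\otimes U_{A^c}$, $$U_AU_{A^c}\,\bigl(B(\mathcal H_A)\otimes 1_{A^c}\bigr)\,(U_AU_{A^c})^\dagger=B(\mathcal H_a)\otimes B(\mathcal H_{\chi_a})\otimes B(\mathcal H_{a,\gamma})\otimes 1_{A^c}.$$ Each of $B(\mathcal H_a)$, $B(\mathcal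 H_{\chi_a})$, $B(\mathcal H_{a,\gamma})$ is the tensor product of the algebras $B(\mathbb C^2)$ of its qubits, and these qubits come from the dimers as follows. * For every $b$, with $i=b|_a$ and $j=b|_{a^c}$ (written on the logical qubits by the bijections), $$U_AU_{A^c}V|b\rangle=|i\rangle_a|0\cdots0\rangle_{\chi_a}\,|j\rangle_{a^c}|0\cdots0\rangle_{\chi_{a^c}}\,|\chi_\gamma\rangle,$$ where $|\chi_\gamma\rangle$ is the product, over the pairs of RT dimers, of the Bell pairs $(|00\rangle+|11\rangle)/\sqrt2$ of the two qubits of the pair in $\mathcal H_{a,\gamma}\otimes\mathcal H_{a^c,\gamma}$. * For every $b$, $U_AU_{A^c}$ maps the space $E_b$ of vectors on which the parity operator of each $\delta\in D_l$ has the value $p_\delta(b)$ onto the space of vectors that are in the state $|b|_a\rangle$ on $\mathcal H_a$. On $E_b$ it turns the parity operator of each auxiliary dimer $\delta$ in $A$ into $p_\delta(b)Z$ on the qubit of $\delta$. On $E_b$ it turns, for each pair of RT dimers with end points $\mu,\nu$ in $A$, the operator $-\mathrm i\gamma_\mu\gamma_\nu$ into $\pm Z$ on the qubit of the pair in $\mathcal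 H_{a,\gamma}$, with a sign that depends only on $b$ and the pair. The same holds with $A^c$ in place of $A$. -/

import Mathlib

open scoped Classical Kronecker Matrix

noncomputable section

namespace Happy

/-! ### Qubits

A register of qubits labelled by a finite type `ι` has the computational basis `ι → Bool`
(`false` for `|0⟩`, `true` for `|1⟩`); its state vectors are functions `(ι → Bool) → ℂ` and its
operator algebra is `Matrix (ι → Bool) (ι → Bool) ℂ`. -/

/-- The sign `(-1)^b`. -/
def sgn (b : Bool) : ℂ := if b then -1 else 1

def pauliX : Matrix Bool Bool ℂ := Matrix.of fun s t => if s = t then 0 else 1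

def pauliY : Matrix Bool Bool ℂ :=
  Matrix.of fun s t => if s = t then 0 else if s then Complex.I else -Complex.I

def pauliZ : Matrix Bool Bool ℂ := Matrix.diagonal sgn

/-- The product operator `⨂ q, x q` on the register `ι`. -/
def tensorOp {ι : Type*} [Fintype ι] (x : ι → Matrix Bool Bool ℂ) :
    Matrix (ι → Bool) (ι → Bool) ℂ :=
  Matrix.of fun s t => ∏ q, x q (s q) (t q)

/-- The operator `O ⊗ 1` on the register `ι`, for `O` acting on the qubits in `S`. -/
def extendOp {ι : Type*} (S : Finset ι) (O : Matrix (S → Bool) (S → Bool) ℂ) :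
    Matrix (ι → Bool) (ι → Bool) ℂ :=
  Matrix.of fun s t =>
    if ∀ q, q ∉ S → s q = t q then O (fun q => s q) (fun q => t q) else 0

/-- The basis vector `|i⟩` as a function of the configuration `s`. -/
def basisKet {ι : Type*} (i s : ι → Bool) : ℂ := if s = i then 1 else 0

/-- The amplitudes of the Bell pair `(|00⟩ + |11⟩) / √2`. -/
def bell (s t : Bool) : ℂ := if s = t then ((1 / Real.sqrt 2 : ℝ) : ℂ) else 0

/-! ### Majorana operators and dimers -/

/-- A Majorana mode: `(k, false)` and `(k, true)` are the two modes on the `k`-th qubit. -/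
abbrev Mode (N : ℕ) := Fin N × Bool

/-- The Jordan–Wigner Majorana operators `Z ⋯ Z X` (mode `(k, false)`) and `Z ⋯ Z Y`
(mode `(k, true)`), with the `X` or `Y` on the `k`-th qubit. -/
def majorana {N : ℕ} (μ : Mode N) : Matrix (Fin N → Bool) (Fin N → Bool) ℂ :=
  tensorOp fun j =>
    if j < μ.1 then pauliZ else if j = μ.1 then (if μ.2 then pauliY else pauliX) else 1

/-- The parity operator `-i γ_μ γ_ν` of a pair of modes. -/
def pairParity {N : ℕ} (μ ν : Mode N) : Matrix (Fin N → Bool) (Fin N → Bool) ℂ :=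
  (-Complex.I) • (majorana μ * majorana ν)

/-- `(γ_μ + i p γ_ν) ψ = 0`: the state `ψ` has a dimer from `μ` to `ν` with parity `p = sgn b`. -/
def HasDimer {N : ℕ} (ψ : (Fin N → Bool) → ℂ) (μ ν : Mode N) (b : Bool) : Prop :=
  (majorana μ + (Complex.I * sgn b) • majorana ν) *ᵥ ψ = 0

/-! ### The `{5,4}` tiling

The darts (oriented edges, each belonging to the pentagon on its left) of the `{5,4}` tiling of the
hyperbolic plane are the elements of the rotation group of the tiling,
`⟨r, s | r⁵ = s² = (r s)⁴ = 1⟩`, which acts simply transitively on them: `g * r` is the next dart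
counterclockwise in the pentagon of `g`, and `g * s` is the same edge seen from the adjacent
pentagon; four pentagons meet at each vertex. -/

inductive Gen
  | rot
  | flip

def tilingRels : Set (FreeGroup Gen) :=
  {FreeGroup.of Gen.rot ^ 5, FreeGroup.of Gen.flip ^ 2,
    (FreeGroup.of Gen.rot * FreeGroup.of Gen.flip) ^ 4}

abbrev Dart := PresentedGroup tilingRels

def r : Dart := PresentedGroup.of Gen.rot

def s : Dart := PresentedGroup.of Gen.flip

/-- The pentagons of the tiling, as orbits of darts under `g ↦ g * r`. -/
abbrev Tile := Dart ⧸ Subgroup.zpowers r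

/-- The pentagon to which a dart belongs. -/
def tile (g : Dart) : Tile := QuotientGroup.mk g

/-- The finite simply connected patches of the tiling: start with one pentagon and keep attaching
pentagons, along exactly one edge, or along exactly two consecutive edges whose common vertex is
thereby surrounded by its four pentagons. -/
inductive IsPatch : Finset Tile → Prop
  | single (t : Tile) : IsPatch {t}
  | edge (R : Finset Tile) (g : Dart) (hR : IsPatch R) (hg : tile g ∉ R)
      (hb : ∀ k : Fin 5, tile (g * r ^ (k : ℕ) * s) ∈ R ↔ k = 0) : IsPatch (insert (tile g) R)
  | corner (R : Finset Tile) (g : Dart) (hR : IsPatch R) (hg : tile g ∉ R)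
      (hb : ∀ k : Fin 5, tile (g * r ^ (k : ℕ) * s) ∈ R ↔ k = 0 ∨ k = 1)
      (hv : tile (g * r * s * r * s) ∈ R) : IsPatch (insert (tile g) R)

/-- The legs of the pentagons of `R`, five for each pentagon. -/
abbrev Leg (R : Finset Tile) := R × Fin 5

/-- The dart of a leg; the legs of a pentagon are counted counterclockwise. -/
def Leg.dart {R : Finset Tile} (l : Leg R) : Dart := Quotient.out l.1.1 * r ^ (l.2 : ℕ)

/-- A leg is open if the pentagon on its other side is not in `R`. -/
def Leg.IsOpen {R : Finset Tile} (l : Leg R) : Prop := tile (l.dart * s) ∉ R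

/-- `h` is the next dart after the boundary dart `g` on the counterclockwise boundary of `R`: from
`g * r`, turn around the end vertex of `g` through the pentagons of `R` until an edge of the
boundary is reached. -/
def NextOnBoundary (R : Finset Tile) (g h : Dart) : Prop :=
  ∃ j : ℕ, h = g * r * (s * r) ^ j ∧ tile (h * s) ∉ R ∧
    ∀ i < j, tile (g * r * (s * r) ^ i * s) ∈ R

/-! ### The HaPPY code -/

/-- The logical basis states `|0̄⟩` (`b = false`) and `|1̄⟩` (`b = true`) of the five-qubit code:
`T_b(x) = (-1)^{b + ∑ x_k x_{k+1}} / 4` if `∑ x_k ≡ b` modulo 2, and `0` otherwise.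
Numbering the modes of the five edges from 1 to 10, these are the Majorana dimer states with
dimers `1 → 6`, `3 → 8`, `5 → 10` of parity `(-1)^b` and `2 → 7`, `4 → 9` of parity `1`.
`T_b` is invariant under rotations of the pentagon. -/
def pentagon (b : Bool) (x : Fin 5 → Bool) : ℂ :=
  if (∑ k, (x k).toNat) % 2 = b.toNat then
    (-1) ^ (b.toNat + ∑ k, (x k).toNat * (x (k + 1)).toNat) / 4
  else 0

/-- The bulk-to-boundary map `V` of the network on `R`: the column of `V` at the bulk basis state
`b` is the state `V |b⟩` obtained from the pentagon states `|b̄ₜ⟩` by contracting each pair of legs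
that share an edge, with the normalization `√2` for each of these bonds.
The `k`-th boundary qubit is the open leg `leg k`. -/
def network (R : Finset Tile) {N : ℕ} (leg : Fin N ≃ {l : Leg R // l.IsOpen}) :
    Matrix (Fin N → Bool) (R → Bool) ℂ :=
  Matrix.of fun x b =>
    ((Real.sqrt 2 ^ (Fintype.card {l : Leg R // ¬ l.IsOpen} / 2) : ℝ) : ℂ) *
      ∑ c : Leg R → Bool,
        if (∀ l l' : Leg R, l'.dart = l.dart * s → c l' = c l) ∧ (∀ k, c (leg k).1 = x k) then
          ∏ t : R, pentagon (b t) (fun k => c (t, k))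
        else 0

/-- The operators on the bulk qubits in `a` are recoverable from the boundary region `A`. -/
def Recoverable {N : ℕ} {B : Type*} [Fintype B] (V : Matrix (Fin N → Bool) (B → Bool) ℂ)
    (A : Finset (Fin N)) (a : Finset B) : Prop :=
  ∃ ι : Matrix (a → Bool) (a → Bool) ℂ →⋆ₐ[ℂ] Matrix (A → Bool) (A → Bool) ℂ,
    Function.Injective ι ∧ ∀ O, extendOp A (ι O) * V = V * extendOp a O

/-- Complementary recovery: `a` is an entanglement wedge of `A`. -/
def IsEntanglementWedge {N : ℕ} {B : Type*} [Fintype B] (V : Matrix (Fin N → Bool) (B → Bool) ℂ)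
    (A : Finset (Fin N)) (a : Finset B) : Prop :=
  Recoverable V A a ∧ Recoverable V Aᶜ aᶜ

/-! ### Logical, auxiliary and RT dimers

The dimers of a state on `N` qubits are labelled by `Fin N`; `d.ends (k, false)` and
`d.ends (k, true)` are the two modes of the `k`-th dimer, and `d.parity b k` is its parity
in the code state `V |b⟩`. -/

structure DimerDiagram (N : ℕ) (B : Type*) where
  ends : Fin N × Bool ≃ Mode N
  parity : (B → Bool) → Fin N → Bool

namespace DimerDiagram

variable {N : ℕ} {B : Type*} (d : DimerDiagram N B)

/-- Every code basis state `V |b⟩` is the Majorana dimer state described by the diagram. -/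
def Describes (V : Matrix (Fin N → Bool) (B → Bool) ℂ) : Prop :=
  ∀ b k, HasDimer (fun x => V x b) (d.ends (k, false)) (d.ends (k, true)) (d.parity b k)

/-- The parity operator of the `k`-th dimer. -/
def parityOp (k : Fin N) : Matrix (Fin N → Bool) (Fin N → Bool) ℂ :=
  pairParity (d.ends (k, false)) (d.ends (k, true))

/-- The dimers that begin and end in `A`. -/
def inside (A : Finset (Fin N)) : Finset (Fin N) :=
  Finset.univ.filter fun k => (d.ends (k, false)).1 ∈ A ∧ (d.ends (k, true)).1 ∈ A

/-- The RT dimers: those that connect `A` with its complement, so that they cross the RT surface,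
the cut that separates the wedge of `A` from the complementary wedge. -/
def crossing (A : Finset (Fin N)) : Finset (Fin N) :=
  Finset.univ.filter fun k => ¬ ((d.ends (k, false)).1 ∈ A ↔ (d.ends (k, true)).1 ∈ A)

/-- The end in `A` of a dimer that crosses the RT surface. -/
def endIn (A : Finset (Fin N)) (k : Fin N) : Mode N :=
  if (d.ends (k, false)).1 ∈ A then d.ends (k, false) else d.ends (k, true)

/-- `L` is a set of logical dimers for `a`: dimers that begin and end in `A`, one for each bulk
qubit of `a` (via `lam`), whose parities are in one-to-one correspondence with the basis states of
the bulk qubits of `a`, whatever the state of the other bulk qubits. -/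
def IsLogical (A : Finset (Fin N)) (a : Finset B) (L : Finset (Fin N)) (lam : L → a) : Prop :=
  L ⊆ d.inside A ∧ Function.Bijective lam ∧
    ∀ b b' : B → Bool, (∀ t ∈ a, b t = b' t) ↔ ∀ k ∈ L, d.parity b k = d.parity b' k

/-- The auxiliary dimers: those that begin and end in `A` and are not logical. -/
def aux (A L : Finset (Fin N)) : Finset (Fin N) := d.inside A \ L

/-- `g` groups the RT dimers into pairs `{g (e, false), g (e, true)}`, for `e : Fin n`. -/
def IsPairing (A : Finset (Fin N)) {n : ℕ} (g : Fin n × Bool → Fin N) : Prop :=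
  Function.Injective g ∧ Set.range g = (d.crossing A : Set (Fin N))

/-- The basis of `H_a ⊗ H_χ ⊗ H_γ`: one qubit for each logical dimer, one for each auxiliary dimer
and one for each pair of RT dimers. -/
abbrev Reg (A L : Finset (Fin N)) (n : ℕ) :=
  (L → Bool) × (d.aux A L → Bool) × (Fin n → Bool)

/-- The qubits of the register `Reg` (reached through `pr : Q → Reg`) are formed from the dimers of
the region `A` by the map `W`:
the joint eigenspace of the parity operators of the logical dimers, with the eigenvalues that they
have in the code states `V |b⟩`, is mapped onto the vectors that are in the state `b` on the logical
qubits; on it, the parity operator of an auxiliary dimer becomes, up to the sign it has in `V |b⟩`,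
the Pauli operator `Z` of its qubit, and the parity operator of the two ends in `A` of a pair of RT
dimers becomes, up to a sign, the Pauli operator `Z` of the qubit of that pair. -/
def FormedFrom {Q : Type*} (A : Finset (Fin N)) (a : Finset B) (L : Finset (Fin N)) (lam : L → a)
    {n : ℕ} (g : Fin n × Bool → Fin N) (W : Matrix Q (Fin N → Bool) ℂ) (pr : Q → d.Reg A L n) :
    Prop :=
  ∀ b : B → Bool,
    (∀ v : (Fin N → Bool) → ℂ, (∀ k ∈ L, d.parityOp k *ᵥ v = sgn (d.parity b k) • v) ↔
      ∀ q, (W *ᵥ v) q ≠ 0 → (pr q).1 = fun k => b (lam k)) ∧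
    ∃ ε : Fin n → Bool,
      ∀ v : (Fin N → Bool) → ℂ, (∀ k ∈ L, d.parityOp k *ᵥ v = sgn (d.parity b k) • v) →
        (∀ (k : d.aux A L) (q : Q), sgn ((pr q).2.1 k) * (W *ᵥ v) q =
          sgn (d.parity b k) * (W *ᵥ (d.parityOp k *ᵥ v)) q) ∧
        (∀ (e : Fin n) (q : Q), sgn ((pr q).2.2 e) * (W *ᵥ v) q =
          sgn (ε e) * (W *ᵥ (pairParity (d.endIn A (g (e, false))) (d.endIn A (g (e, true))) *ᵥ v)) q)

end DimerDiagram

/-- A unitary map between two registers. -/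
def IsUnitary {P Q : Type*} [Fintype P] [Fintype Q] (U : Matrix Q P ℂ) : Prop :=
  U * Uᴴ = 1 ∧ Uᴴ * U = 1

/-- The product `U_A ⊗ U_{Aᶜ}` of two local maps. -/
def localProduct {N : ℕ} {Q Q' : Type*} (A : Finset (Fin N)) (U : Matrix Q (A → Bool) ℂ)
    (U' : Matrix Q' ((Aᶜ : Finset (Fin N)) → Bool) ℂ) : Matrix (Q × Q') (Fin N → Bool) ℂ :=
  Matrix.of fun q x => U q.1 (fun k => x k) * U' q.2 (fun k => x k)

end Happy

end

noncomputable section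

namespace Happy

set_option linter.unusedSectionVars false

/-! A code state is described by its dimers, and only their signs depend on the bulk bits. The patch
is built pentagon by pentagon. For a family `ψ b` the vectors `γ_μ ψ b` are matched in pairs by
`PhaseRel`: equality up to a phase `∓i` whose sign is an affine function of `b` over the field with
two elements. Cyclic renumbering of the sites, tensor products and contraction of two neighbouring
sites preserve such a matching; a contraction joins the dimers that end on the two sites
(`DimerList.rotate`, `DimerList.tensor`, `DimerList.contract`). A pentagon attached along an edge or
around a corner meets consecutive sites of the boundary cycle, so these moves suffice. Since a
pentagon is proportional to an isometry from one leg, or from two neighbouring legs, to the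
remaining ones, the norm stays 1 (`IsPatch.exists_dimerBoundary`).

For the factorization a state is read as a matrix between `A` and its complement. As `A` is an
initial segment, the parity operator of two modes on one side acts on that side alone. The dimers
inside a region, together with the pairs of ends of RT dimers, use up all modes of the region, so
their parities form a complete set of commuting involutions whose joint eigenspaces are lines
(`ParitySystem`). In a code state the inner parities are fixed, the parities of a pair of RT ends
agree on both sides up to sign, and an RT dimer provides an operator that flips such a parity on one
side and is undone by a unitary on the other. Hence all Schmidt coefficients coincide: the state is
`2^{-n/2} ∑ s, g s ⊗ f s` (`DimerDiagram.isEntangled`, `IsEntangled.schmidt`).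

Complementary recovery supplies operators on `A` and on its complement that change the bulk bits.
Those on the complement commute with the parities inside `A`, so these parities depend only on the
bits in `a`. Conversely, two code states with the same parities inside `A` have a common vector in
their supports on `A`, so an operator on `A` could not tell them apart; recovery thus forces the
parities to determine the bits in `a`. Linear algebra over the field with two elements then selects
the logical dimers (`exists_separating_subset`). Carrying a single Schmidt decomposition along with
the recovery operators writes every code state as `2^{-n/2} ∑ s, u i s ⊗ u' k s`
(`exists_code_vectors`): the dependence on `i` and `k` is local, and the Bell pairs are the same for
all `b`. Joint eigenvectors for the other values of the auxiliary parities complete these vectors to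
the bases that define the two unitaries (`exists_frame`, `DimerDiagram.exists_frames`). -/

/-! ### Perfect matchings of a multiset -/

/-- The multiset is partitioned into pairs whose members are related. -/
inductive Matched {M : Type*} (Rl : M → M → Prop) : Multiset M → Prop
  | zero : Matched Rl 0
  | cons {x y : M} {s : Multiset M} (h : Rl x y) (hs : Matched Rl s) :
      Matched Rl (x ::ₘ y ::ₘ s)

namespace Matched

variable {M M' : Type*} {Rl : M → M → Prop}

theorem map {Rl' : M' → M' → Prop} (φ : M → M') {s : Multiset M} (h : Matched Rl s)
    (hφ : ∀ x ∈ s, ∀ y ∈ s, Rl x y → Rl' (φ x) (φ y)) : Matched Rl' (s.map φ) := by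
  induction h with
  | zero => simpa using Matched.zero
  | cons h hs ih =>
    rw [Multiset.map_cons, Multiset.map_cons]
    refine .cons (hφ _ (by simp) _ (by simp) h) (ih fun x hx y hy => hφ x ?_ y ?_) <;>
      simp [hx, hy]

theorem mono {Rl' : M → M → Prop} {s : Multiset M} (h : Matched Rl s)
    (hφ : ∀ x ∈ s, ∀ y ∈ s, Rl x y → Rl' x y) : Matched Rl' s := by
  simpa using h.map id hφ

theorem add {s t : Multiset M} (hs : Matched Rl s) (ht : Matched Rl t) : Matched Rl (s + t) := by
  induction hs with
  | zero => simpa using ht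
  | cons h _ ih => rw [Multiset.cons_add, Multiset.cons_add]; exact .cons h ih

theorem exists_partner (hsymm : ∀ x y, Rl x y → Rl y x) {u : Multiset M} (h : Matched Rl u) :
    ∀ {a : M} {s : Multiset M}, u = a ::ₘ s → ∃ y t, s = y ::ₘ t ∧ Rl a y ∧ Matched Rl t := by
  induction h with
  | zero => intro a s h; simp at h
  | @cons x y s' h hs ih =>
    intro a s hu
    by_cases hx : a = x
    · subst hx
      exact ⟨y, s', by simpa using hu.symm, h, hs⟩
    by_cases hy : a = y
    · subst hy
      rw [Multiset.cons_swap] at hu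
      exact ⟨x, s', by simpa using hu.symm, hsymm _ _ h, hs⟩
    have ha : a ∈ s' := by
      have : a ∈ x ::ₘ y ::ₘ s' := hu ▸ Multiset.mem_cons_self a s
      simpa [hx, hy] using this
    obtain ⟨s'', rfl⟩ := Multiset.exists_cons_of_mem ha
    obtain ⟨z, t, rfl, hz, ht⟩ := ih rfl
    refine ⟨z, x ::ₘ y ::ₘ t, ?_, hz, .cons h ht⟩
    rw [Multiset.cons_swap y a, Multiset.cons_swap x a, Multiset.cons_inj_right] at hu
    rw [← hu, Multiset.cons_swap y z, Multiset.cons_swap x z]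

/-- This is what a contracted bond does to dimers. If `a` and `b` are partners, their dimer closes
into a loop and disappears; otherwise the partners of `a` and `b` become partners of each other, and
`hj` composes the relations through the bond. -/
theorem merge (hsymm : ∀ x y, Rl x y → Rl y x) {a b : M} {s : Multiset M}
    (h : Matched Rl (a ::ₘ b ::ₘ s)) (hj : ∀ x y, Rl x a → Rl b y → Rl x y) : Matched Rl s := by
  obtain ⟨y, t, hst, hy, ht⟩ := h.exists_partner hsymm rfl
  by_cases hyb : b = y
  · subst hyb
    rw [Multiset.cons_inj_right] at hst
    rwa [hst]
  have hb : b ∈ t := by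
    have : b ∈ y ::ₘ t := hst ▸ Multiset.mem_cons_self b s
    simpa [hyb] using this
  obtain ⟨t', rfl⟩ := Multiset.exists_cons_of_mem hb
  obtain ⟨z, t'', rfl, hz, ht''⟩ := ht.exists_partner hsymm rfl
  rw [Multiset.cons_swap, Multiset.cons_inj_right] at hst
  rw [hst]
  exact .cons (hj _ _ (hsymm _ _ hy) hz) ht''

theorem exists_list {s : Multiset M} (h : Matched Rl s) :
    ∃ L : List (M × M), (↑(L.flatMap fun p => [p.1, p.2]) : Multiset M) = s ∧
      ∀ p ∈ L, Rl p.1 p.2 := by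
  induction h with
  | zero => exact ⟨[], by simp, by simp⟩
  | @cons x y s h _ ih =>
    obtain ⟨L, hL, hr⟩ := ih
    refine ⟨(x, y) :: L, ?_, ?_⟩
    · simp [← hL]
    · rintro p (_ | ⟨_, hp⟩)
      · exact h
      · exact hr p hp

theorem exists_equiv {N : ℕ} {Rl : Fin N × Bool → Fin N × Bool → Prop}
    (h : Matched Rl (Finset.univ : Finset (Fin N × Bool)).val) :
    ∃ e : Fin N × Bool ≃ Fin N × Bool, ∀ k, Rl (e (k, false)) (e (k, true)) := by
  obtain ⟨L, hL, hr⟩ := h.exists_list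
  have hlen : L.length = N := by
    have := congrArg Multiset.card hL
    simp [List.length_flatMap] at this
    omega
  -- The list exhausts the `2N` modes, so it has `N` pairs and can be indexed by `Fin N`; a
  -- surjection of a finite set to itself is bijective.
  let e : Fin N × Bool → Fin N × Bool :=
    fun k => if k.2 then (L.get (k.1.cast hlen.symm)).2 else (L.get (k.1.cast hlen.symm)).1
  have hs : Function.Surjective e := by
    intro μ
    have hμ : μ ∈ (↑(L.flatMap fun p => [p.1, p.2]) : Multiset _) := by rw [hL]; simp
    simp only [Multiset.mem_coe, List.mem_flatMap] at hμ
    obtain ⟨p, hp, hμ⟩ := hμ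
    obtain ⟨k, rfl⟩ := List.get_of_mem hp
    simp only [List.mem_cons, List.not_mem_nil, or_false] at hμ
    rcases hμ with rfl | rfl
    · exact ⟨(k.cast hlen, false), by simp [e]⟩
    · exact ⟨(k.cast hlen, true), by simp [e]⟩
  refine ⟨Equiv.ofBijective e ⟨Finite.injective_iff_surjective.2 hs, hs⟩, fun k => ?_⟩
  simpa [e] using hr _ (List.get_mem L (k.cast hlen.symm))

end Matched

/-! ### Affine bits and phase relations -/

theorem sgn_xor (a b : Bool) : sgn (xor a b) = sgn a * sgn b := by
  cases a <;> cases b <;> simp [sgn]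

theorem sgn_mul_self (a : Bool) : sgn a * sgn a = 1 := by
  cases a <;> simp [sgn]

theorem sgn_not (a : Bool) : sgn (!a) = -sgn a := by
  cases a <;> simp [sgn]

theorem sgn_injective : Function.Injective sgn := by
  intro a b h
  cases a <;> cases b <;> simp [sgn] at h ⊢ <;> norm_num [Complex.ext_iff] at h

theorem star_sgn (a : Bool) : star (sgn a) = sgn a := by
  cases a <;> simp [sgn]

/-- A Boolean function that is affine over the field with two elements. -/
def AffineBit {T : Type*} (f : (T → Bool) → Bool) : Prop :=
  ∀ b b', f (fun t => xor (b t) (b' t)) = xor (xor (f b) (f b')) (f fun _ => false)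

namespace AffineBit

variable {T : Type*} {f g : (T → Bool) → Bool}

theorem const (c : Bool) : AffineBit fun _ : T → Bool => c := by
  intro b b'; simp

theorem eval (t : T) : AffineBit fun b : T → Bool => b t := by
  intro b b'; simp

theorem xor (hf : AffineBit f) (hg : AffineBit g) : AffineBit fun b => xor (f b) (g b) := by
  intro b b'
  simp only [hf b b', hg b b']
  generalize f b = x1; generalize f b' = x2; generalize f _ = x3
  generalize g b = x4; generalize g b' = x5; generalize g _ = x6
  revert x1 x2 x3 x4 x5 x6; decide

theorem not (hf : AffineBit f) : AffineBit fun b => !f b := by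
  have := hf.xor (const (T := T) true)
  simpa using this

end AffineBit

section PhaseRel

variable {T M M' E E' : Type*} [AddCommGroup E] [Module ℂ E] [AddCommGroup E'] [Module ℂ E']

/-- Two families of vectors differ by the phase `∓i`, with a sign affine in the bulk bits. -/
def PhaseRel (w : M → (T → Bool) → E) (x y : M) : Prop :=
  ∃ f, AffineBit f ∧ ∀ b, w x b = (-Complex.I * sgn (f b)) • w y b

variable {w : M → (T → Bool) → E}

/-- Reversing a dimer reverses its parity, and the complement of an affine bit is affine. -/
theorem PhaseRel.symm (x y : M) (h : PhaseRel w x y) : PhaseRel w y x := by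
  obtain ⟨f, hf, h⟩ := h
  refine ⟨fun b => !f b, hf.not, fun b => ?_⟩
  rw [h b, smul_smul, sgn_not]
  have : -Complex.I * -sgn (f b) * (-Complex.I * sgn (f b)) = 1 := by
    linear_combination (-Complex.I ^ 2) * sgn_mul_self (f b) - Complex.I_sq
  rw [this, one_smul]

/-- A bond contributes `i` where a dimer contributes `-i`; since `(-i) * i * (-i) = -i`, two dimers
joined through a bond are again a dimer. -/
theorem PhaseRel.trans {a b : M} (c : Bool) (hab : ∀ β, w a β = (Complex.I * sgn c) • w b β)
    (x y : M) (hx : PhaseRel w x a) (hy : PhaseRel w b y) : PhaseRel w x y := by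
  obtain ⟨f, hf, hx⟩ := hx
  obtain ⟨g, hg, hy⟩ := hy
  refine ⟨fun β => xor (xor (f β) c) (g β), (hf.xor (.const c)).xor hg, fun β => ?_⟩
  rw [hx, hab, hy, smul_smul, smul_smul, sgn_xor, sgn_xor]
  congr 1
  linear_combination Complex.I * sgn (f β) * sgn c * sgn (g β) * Complex.I_sq

/-- Each move on states sends `γ_μ ψ`, up to an affine sign, to the image of the old vector under a
homogeneous map that does not depend on `μ`. That is enough to keep the dimer relations. -/
theorem PhaseRel.transport {w' : M' → (T → Bool) → E'} (S : (T → Bool) → E → E')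
    (hS : ∀ b (c : ℂ) v, S b (c • v) = c • S b v) {x y : M} {x' y' : M'}
    {fx fy : (T → Bool) → Bool}
    (hfx : AffineBit fx) (hfy : AffineBit fy) (hx : ∀ b, w' x' b = sgn (fx b) • S b (w x b))
    (hy : ∀ b, w' y' b = sgn (fy b) • S b (w y b)) (h : PhaseRel w x y) :
    PhaseRel w' x' y' := by
  obtain ⟨g, hg, h⟩ := h
  refine ⟨fun b => xor (xor (fx b) (g b)) (fy b), (hfx.xor hg).xor hfy, fun b => ?_⟩
  rw [hx, hy, h, hS, smul_smul, smul_smul, sgn_xor, sgn_xor]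
  congr 1
  linear_combination sgn (fx b) * Complex.I * sgn (g b) * sgn_mul_self (fy b)

end PhaseRel

/-! ### Dimer states along a list of sites -/

section DimerList

variable {D T : Type*}

/-- The product of the signs of the bits at the sites of a list. -/
def signProd (l : List D) (x : D → Bool) : ℂ := (l.map fun d => sgn (x d)).prod

/-- The Jordan–Wigner sign of a site: the product of the signs of the sites before it. -/
def jwSign : List D → D → (D → Bool) → ℂ
  | [], _, _ => 1
  | e :: l, d, x => if e = d then 1 else sgn (x e) * jwSign l d x

def flipAt (d : D) (x : D → Bool) : D → Bool := Function.update x d (!x d)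

/-- The matrix entry of `X` (`t = false`) or `Y` (`t = true`) in the row `c`. -/
def entryXY (t c : Bool) : ℂ := if t then (if c then Complex.I else -Complex.I) else 1

/-- The action of the Majorana operators of a list of sites. -/
def listMajorana (l : List D) (μ : D × Bool) (ψ : (D → Bool) → ℂ) (x : D → Bool) : ℂ :=
  jwSign l μ.1 x * entryXY μ.2 (x μ.1) * ψ (flipAt μ.1 x)

def modes (s : Multiset D) : Multiset (D × Bool) :=
  s.bind fun d => (d, false) ::ₘ (d, true) ::ₘ 0

theorem modes_cons (d : D) (s : Multiset D) :
    modes (d ::ₘ s) = (d, false) ::ₘ (d, true) ::ₘ modes s := by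
  rw [modes, Multiset.cons_bind, Multiset.cons_add, Multiset.cons_add, zero_add]; rfl

theorem modes_add (s t : Multiset D) : modes (s + t) = modes s + modes t :=
  Multiset.add_bind _ _ _

theorem mem_modes {s : Multiset D} {μ : D × Bool} : μ ∈ modes s ↔ μ.1 ∈ s := by
  obtain ⟨d, t⟩ := μ
  simp only [modes, Multiset.mem_bind, Multiset.mem_cons, Prod.mk.injEq, Multiset.notMem_zero, or_false]
  constructor
  · rintro ⟨a, ha, ⟨rfl, _⟩ | ⟨rfl, _⟩⟩ <;> exact ha
  · intro h
    exact ⟨d, h, by cases t <;> simp⟩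

@[simp] theorem flipAt_self (d : D) (x : D → Bool) : flipAt d x d = !x d := by simp [flipAt]

theorem flipAt_of_ne {d e : D} (h : e ≠ d) (x : D → Bool) : flipAt d x e = x e := by
  simp [flipAt, h]

theorem flipAt_update {d e : D} (h : e ≠ d) (x : D → Bool) (c : Bool) :
    flipAt d (Function.update x e c) = Function.update (flipAt d x) e c := by
  rw [flipAt, flipAt, Function.update_of_ne h.symm, Function.update_comm h]

theorem signProd_congr {l : List D} {x y : D → Bool} (h : ∀ d ∈ l, x d = y d) :
    signProd l x = signProd l y := by
  unfold signProd
  congr 1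
  exact List.map_congr_left fun d hd => by rw [h d hd]

theorem signProd_flipAt {l : List D} (hl : l.Nodup) {d : D} (hd : d ∈ l) (x : D → Bool) :
    signProd l (flipAt d x) = -signProd l x := by
  induction l with
  | nil => simp at hd
  | cons e l ih =>
    rw [List.nodup_cons] at hl
    have hc : ∀ y, signProd (e :: l) y = sgn (y e) * signProd l y := fun y => by simp [signProd]
    rw [hc, hc]
    by_cases h : d = e
    · subst h
      rw [flipAt_self, sgn_not, signProd_congr fun e he => flipAt_of_ne (ne_of_mem_of_not_mem he hl.1) x]
      ring
    · rw [flipAt_of_ne (Ne.symm h), ih hl.2 (by simpa [h] using hd)]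
      ring

theorem signProd_append (l l' : List D) (x : D → Bool) :
    signProd (l ++ l') x = signProd l x * signProd l' x := by
  simp [signProd]

theorem signProd_cons (d : D) (l : List D) (x : D → Bool) :
    signProd (d :: l) x = sgn (x d) * signProd l x := by
  simp [signProd]

theorem jwSign_append_left {l l' : List D} {d : D} (h : d ∈ l) (x : D → Bool) :
    jwSign (l ++ l') d x = jwSign l d x := by
  induction l with
  | nil => simp at h
  | cons e l ih =>
    simp only [List.cons_append, jwSign]
    split_ifs with he
    · rfl
    · rw [ih (by simpa [Ne.symm he] using h)]

theorem jwSign_append_right {l l' : List D} {d : D} (h : d ∉ l) (x : D → Bool) :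
    jwSign (l ++ l') d x = signProd l x * jwSign l' d x := by
  induction l with
  | nil => simp [signProd]
  | cons e l ih =>
    simp only [List.mem_cons, not_or] at h
    simp only [List.cons_append, jwSign, signProd_cons, if_neg (Ne.symm h.1), ih h.2, mul_assoc]

theorem jwSign_congr {l : List D} {x y : D → Bool} (h : ∀ d ∈ l, x d = y d) (d : D) :
    jwSign l d x = jwSign l d y := by
  induction l with
  | nil => rfl
  | cons e l ih =>
    simp only [jwSign, h e (by simp), ih fun d hd => h d (by simp [hd])]

/-- A family of states on the sites of a list, indexed by bulk bits, whose members are dimer states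
with the same dimers, with parities affine in the bulk bits. -/
structure DimerList (l : List D) (ψ : (T → Bool) → (D → Bool) → ℂ) : Prop where
  nodup : l.Nodup
  local_ : ∀ b x y, (∀ d ∈ l, x d = y d) → ψ b x = ψ b y
  parity : ∃ f, AffineBit f ∧ ∀ b x, signProd l x * ψ b x = sgn (f b) * ψ b x
  matched : Matched (PhaseRel fun μ b => listMajorana l μ (ψ b)) (modes (l : Multiset D))

/-- Moving `d` to the end removes the factor `Z_d` from the strings of the other sites and gives `d`
the string over all of them. Because the state has a definite total parity, that long string also
acts as `Z_d` up to sign. So every new Majorana vector is `Z_d` applied to the old one, up to an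
affine sign. -/
theorem DimerList.rotate_one {d : D} {l : List D} {ψ : (T → Bool) → (D → Bool) → ℂ}
    (h : DimerList (d :: l) ψ) : DimerList (l ++ [d]) ψ := by
  have hnd : (l ++ [d]).Nodup := by
    have := h.nodup; rw [← List.singleton_append] at this; exact List.nodup_append_comm.1 this
  have hdl : d ∉ l := (List.nodup_cons.1 h.nodup).1
  obtain ⟨f, hf, hp⟩ := h.parity
  refine ⟨hnd, fun b x y hxy => h.local_ b x y fun e he => hxy e ?_, ⟨f, hf, fun b x => ?_⟩, ?_⟩
  · simpa [or_comm] using he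
  · rw [← hp, signProd_append, signProd_cons]; simp [signProd, mul_comm]
  have hm : modes ((l ++ [d] : List D) : Multiset D) = modes ((d :: l : List D) : Multiset D) := by
    congr 1
    exact Multiset.coe_eq_coe.2 (List.perm_append_comm)
  rw [hm]
  -- For the moved site the total parity is evaluated after `d` has been flipped, which reverses it;
  -- hence the negation.
  let F : D × Bool → (T → Bool) → Bool := fun μ => if μ.1 = d then fun b => !f b else fun _ => false
  have hF : ∀ μ, AffineBit (F μ) := by
    intro μ; simp only [F]; split_ifs
    · exact hf.not
    · exact .const _
  have key : ∀ μ ∈ modes ((d :: l : List D) : Multiset D), ∀ b,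
      listMajorana (l ++ [d]) μ (ψ b) =
        sgn (F μ b) • fun x => sgn (x d) * listMajorana (d :: l) μ (ψ b) x := by
    rintro ⟨e, t⟩ he b
    funext x
    simp only [listMajorana, Pi.smul_apply, smul_eq_mul, F]
    by_cases hed : e = d
    · subst hed
      have h1 := hp b (flipAt e x)
      rw [signProd_flipAt h.nodup (by simp), signProd_cons] at h1
      rw [jwSign_append_right hdl]
      simp only [jwSign, if_true, sgn_not]
      have h2 := sgn_mul_self (x e)
      linear_combination (entryXY t (x e)) * (-sgn (x e)) * h1 -
        signProd l x * entryXY t (x e) * ψ b (flipAt e x) * h2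
    · have hel : e ∈ l := by
        have := mem_modes.1 he; simpa [hed] using this
      rw [jwSign_append_left hel]
      simp only [jwSign, if_neg (Ne.symm hed), if_neg hed]
      have h2 := sgn_mul_self (x d)
      have h3 : sgn false = 1 := rfl
      rw [h3]
      linear_combination (-jwSign l e x * entryXY t (x e) * ψ b (flipAt e x)) * h2
  refine h.matched.mono fun μ hμ ν hν hr =>
    hr.transport (fun _ v x => sgn (x d) * v x) ?_ (hF μ) (hF ν) (key μ hμ) (key ν hν)
  intro b c v
  funext x
  simp; ring

theorem DimerList.rotate {l l' : List D} {ψ : (T → Bool) → (D → Bool) → ℂ}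
    (h : DimerList (l ++ l') ψ) : DimerList (l' ++ l) ψ := by
  induction l generalizing l' with
  | nil => simpa using h
  | cons d l ih =>
    have := ih (l' := l' ++ [d]) (by simpa using h.rotate_one)
    simpa using this

/-- The Majorana operators of the second block carry the full `Z` string of the first, which acts on
the first state as its total parity. This is where affine dependence of that parity is needed. -/
theorem DimerList.tensor {l l' : List D} {ψ φ : (T → Bool) → (D → Bool) → ℂ}
    (h : DimerList l ψ) (h' : DimerList l' φ) (hd : ∀ d ∈ l, d ∉ l') :
    DimerList (l ++ l') fun b x => ψ b x * φ b x := by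
  obtain ⟨f, hf, hp⟩ := h.parity
  obtain ⟨f', hf', hp'⟩ := h'.parity
  refine ⟨List.Nodup.append h.nodup h'.nodup fun d hd1 hd2 => hd d hd1 hd2, ?_,
    ⟨_, hf.xor hf', ?_⟩, ?_⟩
  · intro b x y hxy
    rw [h.local_ b x y fun d hd => hxy d (by simp [hd]),
      h'.local_ b x y fun d hd => hxy d (by simp [hd])]
  · intro b x
    rw [signProd_append, sgn_xor]
    linear_combination (signProd l' x * φ b x) * hp b x + sgn (f b) * ψ b x * hp' b x
  rw [← Multiset.coe_add, modes_add]
  refine Matched.add ?_ ?_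
  · refine h.matched.mono fun μ hμ ν hν hr =>
      hr.transport (fun b v x => v x * φ b x) ?_ (.const false) (.const false) ?_ ?_
    · intro b c v; funext x; simp; ring
    all_goals
      intro b; funext x
      simp only [listMajorana, Pi.smul_apply, smul_eq_mul]
    on_goal 1 => have hμ := hμ
    on_goal 2 => replace hμ := hν
    all_goals
      rw [mem_modes, Multiset.mem_coe] at hμ
      rw [jwSign_append_left hμ, h'.local_ b (flipAt _ x) x fun e he =>
        flipAt_of_ne (ne_of_mem_of_not_mem he (hd _ hμ)) x]
      simp [sgn]; ring
  · refine h'.matched.mono fun μ hμ ν hν hr =>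
      hr.transport (fun b v x => ψ b x * v x) ?_ hf hf ?_ ?_
    · intro b c v; funext x; simp; ring
    all_goals
      intro b; funext x
      simp only [listMajorana, Pi.smul_apply, smul_eq_mul]
    on_goal 1 => have hμ := hμ
    on_goal 2 => replace hμ := hν
    all_goals
      rw [mem_modes, Multiset.mem_coe] at hμ
      rw [jwSign_append_right (fun hh => hd _ hh hμ), h.local_ b (flipAt _ x) x fun e he =>
        flipAt_of_ne (ne_of_mem_of_not_mem hμ (hd _ he)).symm x]
    on_goal 1 => linear_combination jwSign l' μ.1 x * entryXY μ.2 (x μ.1) * φ b (flipAt μ.1 x) * hp b x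
    on_goal 1 => linear_combination jwSign l' ν.1 x * entryXY ν.2 (x ν.1) * φ b (flipAt ν.1 x) * hp b x

/-- Give the sites `u` and `v` the same bit `c`. -/
def setPair (u v : D) (c : Bool) (x : D → Bool) : D → Bool :=
  Function.update (Function.update x u c) v c

/-- Contract the sites `u` and `v`. -/
def contract (u v : D) (ψ : (D → Bool) → ℂ) (x : D → Bool) : ℂ := ∑ c, ψ (setPair u v c x)

theorem contract_smul (u v : D) (c : ℂ) (ψ : (D → Bool) → ℂ) :
    contract u v (c • ψ) = c • contract u v ψ := by
  funext x; simp [contract]; ring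

theorem setPair_of_ne {u v d : D} (hu : d ≠ u) (hv : d ≠ v) (c : Bool) (x : D → Bool) :
    setPair u v c x d = x d := by
  simp [setPair, hu, hv]

theorem setPair_left (u v : D) (c : Bool) (x : D → Bool) : setPair u v c x u = c := by
  by_cases h : u = v
  · subst h; simp [setPair]
  · simp [setPair, h]

theorem setPair_right (u v : D) (c : Bool) (x : D → Bool) : setPair u v c x v = c := by
  simp [setPair]

/-- On the contracted space `X_u` agrees with `i` times `Y_v`, and `Y_u` with `i` times `X_v`, the
strings being taken into account. The four modes of the bond are eliminated by merging along these
two identities; the modes elsewhere pass through the contraction. -/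
theorem DimerList.contract {p q : List D} {u v : D} {ψ : (T → Bool) → (D → Bool) → ℂ}
    (h : DimerList (p ++ u :: v :: q) ψ) :
    DimerList (p ++ q) fun b => contract u v (ψ b) := by
  obtain ⟨f, hf, hp⟩ := h.parity
  have hnd := h.nodup
  rw [List.nodup_append] at hnd
  obtain ⟨hndp, hndq, hdis⟩ := hnd
  simp only [List.nodup_cons, List.mem_cons, not_or] at hndq
  obtain ⟨⟨huv, huq⟩, hvq, hndq⟩ := hndq
  have hup : u ∉ p := fun hh => hdis u hh u (by simp) rfl
  have hvp : v ∉ p := fun hh => hdis v hh v (by simp) rfl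
  have hneu : ∀ d ∈ p ++ q, d ≠ u := by
    rintro d hd rfl; simp [hup, huq] at hd
  have hnev : ∀ d ∈ p ++ q, d ≠ v := by
    rintro d hd rfl; simp [hvp, hvq] at hd
  have hset : ∀ c x, ∀ d ∈ p ++ q, setPair u v c x d = x d := fun c x d hd =>
    setPair_of_ne (hneu d hd) (hnev d hd) c x
  have hsetp : ∀ c x, ∀ d ∈ p, setPair u v c x d = x d := fun c x d hd => hset c x d (by simp [hd])
  have hsetq : ∀ c x, ∀ d ∈ q, setPair u v c x d = x d := fun c x d hd => hset c x d (by simp [hd])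
  refine ⟨List.Nodup.append hndp hndq fun d hd1 hd2 => hdis d hd1 d (by simp [hd2]) rfl, ?_,
    ⟨f, hf, ?_⟩, ?_⟩
  · intro b x y hxy
    refine Finset.sum_congr rfl fun c _ => h.local_ b _ _ fun d hd => ?_
    by_cases hdu : d = u
    · rw [hdu, setPair_left, setPair_left]
    by_cases hdv : d = v
    · rw [hdv, setPair_right, setPair_right]
    rw [setPair_of_ne hdu hdv, setPair_of_ne hdu hdv]
    exact hxy d (by simpa [hdu, hdv] using hd)
  · intro b x
    simp only [Happy.contract, Finset.mul_sum]
    refine Finset.sum_congr rfl fun c _ => ?_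
    have := hp b (setPair u v c x)
    rw [signProd_append, signProd_cons, signProd_cons, setPair_left, setPair_right,
      signProd_congr (hsetp c x), signProd_congr (hsetq c x)] at this
    rw [signProd_append]
    linear_combination this - signProd p x * signProd q x * ψ b (setPair u v c x) * sgn_mul_self c
  -- The modes of the bond are ordered so that the two identified pairs stand next to each other, as
  -- `Matched.merge` requires.
  have hm : modes ((p ++ u :: v :: q : List D) : Multiset D) =
      (u, false) ::ₘ (v, true) ::ₘ (u, true) ::ₘ (v, false) ::ₘ
        modes ((p ++ q : List D) : Multiset D) := by
    have : ((p ++ u :: v :: q : List D) : Multiset D) = u ::ₘ v ::ₘ ((p ++ q : List D) : Multiset D) := by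
      rw [Multiset.cons_coe, Multiset.cons_coe, Multiset.coe_eq_coe]
      exact List.perm_middle.trans (List.Perm.cons _ List.perm_middle)
    rw [this, modes_cons, modes_cons, Multiset.cons_swap (v, false), Multiset.cons_swap (u, true)]
  have hmat := h.matched
  rw [hm] at hmat
  let w : D × Bool → (T → Bool) → (D → Bool) → ℂ := fun μ b =>
    Happy.contract u v (listMajorana (p ++ u :: v :: q) μ (ψ b))
  have hw : Matched (PhaseRel w) ((u, false) ::ₘ (v, true) ::ₘ (u, true) ::ₘ (v, false) ::ₘ
        modes ((p ++ q : List D) : Multiset D)) := by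
    refine hmat.mono fun μ _ ν _ hr =>
      hr.transport (fun _ => Happy.contract u v) (fun _ => contract_smul u v)
        (.const false) (.const false) ?_ ?_ <;> intro b <;> simp [sgn, w]
  -- Flipping `u` at bond value `c` gives the same configuration as flipping `v` at the opposite
  -- value, so the two terms of the bond sum are exchanged.
  have hflip : ∀ c x, flipAt u (setPair u v c x) = flipAt v (setPair u v (!c) x) := by
    intro c x
    funext d
    by_cases hdu : d = u
    · subst hdu
      rw [flipAt_self, flipAt_of_ne huv, setPair_left, setPair_left]
    by_cases hdv : d = v
    · subst hdv
      rw [flipAt_self, flipAt_of_ne hdu, setPair_right, setPair_right, Bool.not_not]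
    rw [flipAt_of_ne hdu, flipAt_of_ne hdv, setPair_of_ne hdu hdv, setPair_of_ne hdu hdv]
  have hjw : ∀ c x, jwSign (p ++ u :: v :: q) u (setPair u v c x) = signProd p x := by
    intro c x
    rw [jwSign_append_right hup, signProd_congr (hsetp c x)]
    simp [jwSign]
  have hjw' : ∀ c x, jwSign (p ++ u :: v :: q) v (setPair u v c x) = signProd p x * sgn c := by
    intro c x
    rw [jwSign_append_right hvp, signProd_congr (hsetp c x)]
    simp [jwSign, huv, setPair_left]
  have j1 : ∀ b, w (u, false) b = (Complex.I * sgn false) • w (v, true) b := by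
    intro b; funext x
    simp only [w, Happy.contract, listMajorana, hjw, hjw', hflip, setPair_left, setPair_right,
      Fintype.sum_bool, Pi.smul_apply, smul_eq_mul, sgn, entryXY]
    simp
    linear_combination ((signProd p x * ψ b (flipAt v (setPair u v false x))) +
      signProd p x * ψ b (flipAt v (setPair u v true x))) * Complex.I_sq
  have j2 : ∀ b, w (u, true) b = (Complex.I * sgn false) • w (v, false) b := by
    intro b; funext x
    simp only [w, Happy.contract, listMajorana, hjw, hjw', hflip, setPair_left, setPair_right,
      Fintype.sum_bool, Pi.smul_apply, smul_eq_mul, sgn, entryXY]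
    simp
    ring
  have hw2 := (hw.merge PhaseRel.symm (PhaseRel.trans false j1)).merge PhaseRel.symm
    (PhaseRel.trans false j2)
  have key : ∀ μ ∈ modes ((p ++ q : List D) : Multiset D), ∀ b,
      listMajorana (p ++ q) μ (Happy.contract u v (ψ b)) = sgn false • w μ b := by
    rintro ⟨d, t⟩ hμ b
    rw [mem_modes, Multiset.mem_coe] at hμ
    have hdu := hneu d hμ
    have hdv := hnev d hμ
    funext x
    simp only [w, Happy.contract, listMajorana, Pi.smul_apply, smul_eq_mul, Finset.mul_sum]
    refine Finset.sum_congr rfl fun c _ => ?_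
    have e1 : flipAt d (setPair u v c x) = setPair u v c (flipAt d x) := by
      rw [setPair, setPair, flipAt_update hdv.symm, flipAt_update hdu.symm]
    rw [e1, setPair_of_ne hdu hdv]
    -- A site behind the bond sees the bond value twice in its string, and the two signs cancel.
    have e2 : jwSign (p ++ u :: v :: q) d (setPair u v c x) = jwSign (p ++ q) d x := by
      by_cases hdp : d ∈ p
      · rw [jwSign_append_left hdp, jwSign_append_left hdp, jwSign_congr (hsetp c x)]
      · rw [jwSign_append_right hdp, jwSign_append_right hdp, signProd_congr (hsetp c x)]
        simp only [jwSign, if_neg hdu.symm, if_neg hdv.symm, setPair_left, setPair_right]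
        rw [jwSign_congr (hsetq c x)]
        linear_combination signProd p x * jwSign q d x * sgn_mul_self c
    rw [e2]
    simp [sgn]
  refine hw2.mono fun μ hμ ν hν hr =>
    hr.transport (fun _ v => v) (fun _ _ _ => rfl) (.const false) (.const false) (key μ hμ) (key ν hν)

end DimerList

/-! ### Sums over the bits at a finite set of sites -/

section SumOver

variable {D : Type*}

/-- The sum of `F` over all values of the bits at the sites in `S`, the others being given by `x`. -/
def sumOver (S : Finset D) (F : (D → Bool) → ℂ) (x : D → Bool) : ℂ :=
  ∑ U ∈ S.powerset, F fun d => if d ∈ S then decide (d ∈ U) else x d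

theorem sumOver_empty (F : (D → Bool) → ℂ) (x : D → Bool) : sumOver ∅ F x = F x := by
  simp [sumOver]

theorem sumOver_insert {d : D} {S : Finset D} (hd : d ∉ S) (F : (D → Bool) → ℂ) (x : D → Bool) :
    sumOver (insert d S) F x = ∑ z, sumOver S F (Function.update x d z) := by
  rw [Fintype.sum_bool, add_comm, sumOver, Finset.sum_powerset_insert hd, sumOver, sumOver]
  congr 1
  all_goals
    refine Finset.sum_congr rfl fun U hU => ?_
    rw [Finset.mem_powerset] at hU
    congr 1
    funext e
    by_cases he : e = d
    · subst he
      have : e ∉ U := fun h => hd (hU h)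
      simp [hd, this]
    · simp [he]

theorem sumOver_congr {S : Finset D} {F G : (D → Bool) → ℂ} {x : D → Bool}
    (h : ∀ y, (∀ d ∉ S, y d = x d) → F y = G y) : sumOver S F x = sumOver S G x :=
  Finset.sum_congr rfl fun U _ => h _ fun d hd => by simp [hd]

theorem sumOver_mul_right {S : Finset D} (F : (D → Bool) → ℂ) {G : (D → Bool) → ℂ}
    (hG : ∀ x y, (∀ d ∉ S, x d = y d) → G x = G y) (x : D → Bool) :
    sumOver S (fun y => F y * G y) x = sumOver S F x * G x := by
  rw [sumOver, sumOver, Finset.sum_mul]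
  refine Finset.sum_congr rfl fun U _ => ?_
  congr 1
  exact hG _ _ fun d hd => by simp [hd]

theorem sumOver_mul_left {S : Finset D} (F : (D → Bool) → ℂ) {G : (D → Bool) → ℂ}
    (hG : ∀ x y, (∀ d ∉ S, x d = y d) → G x = G y) (x : D → Bool) :
    sumOver S (fun y => G y * F y) x = G x * sumOver S F x := by
  simp_rw [mul_comm (G _)]
  exact sumOver_mul_right F hG x

theorem sumOver_sum {ι : Type*} (s : Finset ι) (S : Finset D) (F : ι → (D → Bool) → ℂ)
    (x : D → Bool) : sumOver S (fun y => ∑ i ∈ s, F i y) x = ∑ i ∈ s, sumOver S (F i) x := by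
  simp only [sumOver]
  exact Finset.sum_comm

theorem sumOver_update {d : D} {S : Finset D} (hd : d ∉ S) (F : (D → Bool) → ℂ) (x : D → Bool)
    (z : Bool) :
    sumOver S F (Function.update x d z) = sumOver S (fun y => F (Function.update y d z)) x := by
  refine Finset.sum_congr rfl fun U _ => ?_
  congr 1
  funext e
  by_cases he : e = d
  · subst he; simp [hd]
  · simp [he]

theorem sumOver_union {S S' : Finset D} (h : Disjoint S S') (F : (D → Bool) → ℂ) (x : D → Bool) :
    sumOver (S ∪ S') F x = sumOver S (sumOver S' F) x := by
  induction S using Finset.induction_on generalizing x with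
  | empty => rw [Finset.empty_union, sumOver_empty]
  | insert d S hd ih =>
    rw [Finset.disjoint_insert_left] at h
    rw [Finset.insert_union, sumOver_insert (by simp [hd, h.1]), sumOver_insert hd]
    exact Finset.sum_congr rfl fun z _ => ih h.2 _

theorem sumOver_pair {u v : D} {S : Finset D} (huv : u ≠ v) (hu : u ∉ S) (hv : v ∉ S)
    (F : (D → Bool) → ℂ) (x : D → Bool) :
    sumOver (insert u (insert v S)) (fun y => if y u = y v then F y else 0) x =
      contract u v (sumOver S F) x := by
  rw [sumOver_insert (by simp [huv, hu]), contract]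
  refine Finset.sum_congr rfl fun z _ => ?_
  rw [sumOver_insert hv, Finset.sum_eq_single z]
  · refine sumOver_congr fun y hy => ?_
    rw [hy u hu, hy v hv]
    simp [huv]
  · intro z' _ hz'
    rw [sumOver_congr (G := fun _ => 0)]
    · simp [sumOver]
    intro y hy
    rw [hy u hu, hy v hv]
    simp [huv, Ne.symm hz']
  · simp

/-- Turns a prescribed value of some bits into a sum with an indicator, the form in which the
network fixes its open legs. -/
theorem sumOver_eq_single (S : Finset D) (G : (D → Bool) → ℂ) (x : D → Bool) :
    sumOver S (fun y => if ∀ d ∈ S, y d = x d then G y else 0) x = G x := by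
  rw [sumOver, Finset.sum_eq_single (S.filter fun d => x d = true)]
  · rw [if_pos]
    · congr 1
      funext d
      by_cases h : d ∈ S <;> simp [h]
    · intro d hd; simp [hd]
  · intro U hU hne
    rw [if_neg]
    intro h
    apply hne
    ext d
    rw [Finset.mem_powerset] at hU
    by_cases hd : d ∈ S
    · have := h d hd
      simp only [hd, if_true] at this
      simp [hd, ← this]
    · have : d ∉ U := fun h => hd (hU h)
      simp [hd, this]
  · intro h; exact absurd (Finset.mem_powerset.2 (Finset.filter_subset _ _)) h

theorem sumOver_equiv {ι : Type*} [Fintype ι] {S : Finset D} (e : ι ≃ S) (F : (D → Bool) → ℂ)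
    (x : D → Bool) :
    sumOver S F x = ∑ c : ι → Bool, F fun d => if h : d ∈ S then c (e.symm ⟨d, h⟩) else x d := by
  symm
  refine Finset.sum_bij' (fun c _ => S.filter fun d => ∃ h : d ∈ S, c (e.symm ⟨d, h⟩) = true)
    (fun U _ i => decide ((e i : D) ∈ U)) ?_ ?_ ?_ ?_ ?_
  · intro c _
    exact Finset.mem_powerset.2 (Finset.filter_subset _ _)
  · simp
  · intro c _
    funext i
    simp
  · intro U hU
    rw [Finset.mem_powerset] at hU
    ext d
    simp only [Finset.mem_filter, Equiv.apply_symm_apply, decide_eq_true_eq]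
    exact ⟨fun h => h.2.2, fun h => ⟨hU h, hU h, h⟩⟩
  · intro c _
    congr 1
    funext d
    by_cases h : d ∈ S <;> simp [h]

end SumOver

/-! ### Darts of the tiling -/

theorem r_pow_five : r ^ 5 = 1 := by
  have h : FreeGroup.of Gen.rot ^ 5 ∈ tilingRels := by simp [tilingRels]
  have := PresentedGroup.one_of_mem h
  simpa [r, PresentedGroup.of] using this

theorem s_mul_s : s * s = 1 := by
  have h : FreeGroup.of Gen.flip ^ 2 ∈ tilingRels := by simp [tilingRels]
  have := PresentedGroup.one_of_mem h
  simpa [s, PresentedGroup.of, sq] using this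

theorem r_mul_s_pow_four : (r * s) ^ 4 = 1 := by
  have h : (FreeGroup.of Gen.rot * FreeGroup.of Gen.flip) ^ 4 ∈ tilingRels := by simp [tilingRels]
  have := PresentedGroup.one_of_mem h
  simpa [r, s, PresentedGroup.of] using this

@[simp] theorem mul_s_mul_s (g : Dart) : g * s * s = g := by rw [mul_assoc, s_mul_s, mul_one]

/-- A permutation representation of the rotation group of the tiling. -/
def permRep : Dart →* Equiv.Perm (Fin 5) :=
  PresentedGroup.toGroup (f := fun x => match x with
    | .rot => finRotate 5
    | .flip => Equiv.swap 0 1) (by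
    intro w hw
    simp only [tilingRels, Set.mem_insert_iff, Set.mem_singleton_iff] at hw
    rcases hw with rfl | rfl | rfl <;> simp only [map_pow, map_mul, FreeGroup.lift_apply_of] <;>
      decide)

theorem permRep_r : permRep r = finRotate 5 := PresentedGroup.toGroup.of _

theorem permRep_s : permRep s = Equiv.swap 0 1 := PresentedGroup.toGroup.of _

/-- The defining relations only bound orders from above. That the five darts of a pentagon are
distinct is read off in `permRep`, where `r` becomes a 5-cycle. -/
theorem r_pow_injective {i j : Fin 5} (h : r ^ (i : ℕ) = r ^ (j : ℕ)) : i = j := by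
  have := congrArg permRep h
  rw [map_pow, map_pow, permRep_r] at this
  revert this i j
  have : ∀ i j : Fin 5, finRotate 5 ^ (i : ℕ) = finRotate 5 ^ (j : ℕ) → i = j := by decide
  intro i j _ h
  exact this i j h

/-- In `permRep` the powers of `r` are even and `s` is a transposition. Consequently no pentagon is
glued to itself. -/
theorem s_ne_r_pow (k : ℕ) : s ≠ r ^ k := by
  intro h
  have := congrArg (fun g => Equiv.Perm.sign (permRep g)) h
  simp only [map_pow, permRep_r, permRep_s] at this
  have h5 : Equiv.Perm.sign (finRotate 5) = 1 := by decide
  rw [h5, one_pow] at this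
  revert this
  decide

theorem r_pow_mod (k : ℕ) : r ^ (k % 5) = r ^ k := by
  conv_rhs => rw [← Nat.mod_add_div k 5, pow_add, pow_mul, r_pow_five, one_pow, mul_one]

theorem r_pow_add (i j : Fin 5) : r ^ ((i + j : Fin 5) : ℕ) = r ^ (i : ℕ) * r ^ (j : ℕ) := by
  rw [Fin.val_add, r_pow_mod, pow_add]

theorem tile_mul_r_pow (g : Dart) (k : ℕ) : tile (g * r ^ k) = tile g := by
  rw [tile, tile, QuotientGroup.eq]
  exact ⟨-k, by simp⟩

theorem tile_mul_r (g : Dart) : tile (g * r) = tile g := by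
  simpa using tile_mul_r_pow g 1

theorem tile_eq_iff {g h : Dart} : tile g = tile h ↔ ∃ k : Fin 5, h = g * r ^ (k : ℕ) := by
  constructor
  · intro hgh
    rw [tile, tile, QuotientGroup.eq] at hgh
    obtain ⟨z, hz⟩ := hgh
    have h5 : r ^ (z % 5) = r ^ z := by
      conv_rhs => rw [← Int.emod_add_mul_ediv z 5, zpow_add, zpow_mul]
      have : r ^ (5 : ℤ) = 1 := by exact_mod_cast r_pow_five
      rw [this, one_zpow, mul_one]
    have hnn := Int.emod_nonneg z (show (5 : ℤ) ≠ 0 by norm_num)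
    have hlt := Int.emod_lt_of_pos z (show (0 : ℤ) < 5 by norm_num)
    refine ⟨⟨(z % 5).toNat, by omega⟩, ?_⟩
    have h6 : r ^ (z % 5).toNat = r ^ z := by
      rw [← h5, ← zpow_natCast, Int.toNat_of_nonneg hnn]
    simp only [h6]
    simp only at hz
    rw [hz]; group
  · rintro ⟨k, rfl⟩
    exact (tile_mul_r_pow g k).symm

theorem tile_mul_s_ne (g : Dart) : tile (g * s) ≠ tile g := by
  intro h
  obtain ⟨k, hk⟩ := tile_eq_iff.1 h.symm
  exact s_ne_r_pow k (mul_left_cancel hk)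

theorem tile_pow_mul_s_ne (g : Dart) (k : ℕ) : tile (g * r ^ k * s) ≠ tile g := by
  rw [← tile_mul_r_pow g k]
  exact tile_mul_s_ne _

theorem mul_r_pow_injective (g : Dart) : Function.Injective fun k : Fin 5 => g * r ^ (k : ℕ) :=
  fun _ _ h => r_pow_injective (mul_left_cancel h)

theorem tile_surjective : Function.Surjective tile := QuotientGroup.mk_surjective

theorem tile_out (t : Tile) : tile (Quotient.out t) = t := QuotientGroup.out_eq' t

/-- The legs of the pentagons of a patch are the darts of these pentagons. -/
def legEquiv (R : Finset Tile) : Leg R ≃ {d : Dart // tile d ∈ R} :=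
  Equiv.ofBijective (fun l => ⟨l.dart, by
      rw [Leg.dart, tile_mul_r_pow, tile_out]; exact l.1.2⟩) (by
    constructor
    · rintro ⟨t, k⟩ ⟨t', k'⟩ h
      have h' : Quotient.out t.1 * r ^ (k : ℕ) = Quotient.out t'.1 * r ^ (k' : ℕ) :=
        congrArg Subtype.val h
      have ht : t = t' := by
        have := congrArg tile h'
        rw [tile_mul_r_pow, tile_mul_r_pow, tile_out, tile_out] at this
        exact Subtype.ext this
      subst ht
      rw [mul_r_pow_injective _ h']
    · rintro ⟨d, hd⟩
      obtain ⟨k, hk⟩ := tile_eq_iff.1 (tile_out (tile d))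
      exact ⟨(⟨tile d, hd⟩, k), Subtype.ext hk.symm⟩)

theorem legEquiv_apply (R : Finset Tile) (l : Leg R) : (legEquiv R l : Dart) = l.dart := rfl

instance (R : Finset Tile) : Finite {d : Dart // tile d ∈ R} := Finite.of_equiv _ (legEquiv R)

theorem finite_darts (R : Finset Tile) (p : Dart → Prop) : {d : Dart | tile d ∈ R ∧ p d}.Finite :=
  Set.Finite.subset (Set.finite_coe_iff.1 (inferInstanceAs (Finite {d : Dart // tile d ∈ R}))) fun _ h => h.1

/-- The darts of a patch that are glued to another dart of the patch. -/
def closedDarts (R : Finset Tile) : Finset Dart := (finite_darts R fun d => tile (d * s) ∈ R).toFinset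

/-- The darts on the boundary of a patch. -/
def openDarts (R : Finset Tile) : Finset Dart := (finite_darts R fun d => tile (d * s) ∉ R).toFinset

theorem mem_closedDarts {R : Finset Tile} {d : Dart} :
    d ∈ closedDarts R ↔ tile d ∈ R ∧ tile (d * s) ∈ R := by
  simp [closedDarts]

theorem mem_openDarts {R : Finset Tile} {d : Dart} :
    d ∈ openDarts R ↔ tile d ∈ R ∧ tile (d * s) ∉ R := by
  simp [openDarts]

/-! ### The five-qubit code -/

/-- The sign in an amplitude of the five-qubit code. -/
def pentagonBit (β y0 y1 y2 y3 y4 : Bool) : Bool :=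
  xor β (xor (y0 && y1) (xor (y1 && y2) (xor (y2 && y3) (xor (y3 && y4) (y4 && y0)))))

def xor5 (y0 y1 y2 y3 y4 : Bool) : Bool := xor y0 (xor y1 (xor y2 (xor y3 y4)))

theorem neg_one_pow_eq_sgn (n : ℕ) : (-1 : ℂ) ^ n = sgn (decide (n % 2 = 1)) := by
  rcases Nat.even_or_odd n with h | h
  · rw [h.neg_one_pow]; simp [sgn, Nat.even_iff.1 h]
  · rw [h.neg_one_pow]; simp [sgn, Nat.odd_iff.1 h]

/-- Boolean form of the amplitudes, in which identities become finite checks. -/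
theorem pentagon_eq (β : Bool) (y : Fin 5 → Bool) :
    pentagon β y = if xor5 (y 0) (y 1) (y 2) (y 3) (y 4) = β then
      sgn (pentagonBit β (y 0) (y 1) (y 2) (y 3) (y 4)) / 4 else 0 := by
  rw [pentagon, neg_one_pow_eq_sgn]
  simp only [Fin.sum_univ_five, show (0 : Fin 5) + 1 = 1 from rfl, show (1 : Fin 5) + 1 = 2 from rfl,
    show (2 : Fin 5) + 1 = 3 from rfl, show (3 : Fin 5) + 1 = 4 from rfl,
    show (4 : Fin 5) + 1 = 0 from rfl]
  generalize y 0 = y0; generalize y 1 = y1; generalize y 2 = y2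
  generalize y 3 = y3; generalize y 4 = y4
  have h1 : ((y0.toNat + y1.toNat + y2.toNat + y3.toNat + y4.toNat) % 2 = β.toNat) ↔
      xor5 y0 y1 y2 y3 y4 = β := by
    revert β y0 y1 y2 y3 y4; decide
  have h2 : decide ((β.toNat + (y0.toNat * y1.toNat + y1.toNat * y2.toNat + y2.toNat * y3.toNat +
      y3.toNat * y4.toNat + y4.toNat * y0.toNat)) % 2 = 1) = pentagonBit β y0 y1 y2 y3 y4 := by
    revert β y0 y1 y2 y3 y4; decide
  rw [h2]
  simp only [h1]

theorem pentagon_rotate (β : Bool) (y : Fin 5 → Bool) (j : Fin 5) :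
    pentagon β (fun k => y (j + k)) = pentagon β y := by
  have h1 := Equiv.sum_comp (Equiv.addLeft j) fun k => (y k).toNat
  have h2 := Equiv.sum_comp (Equiv.addLeft j) fun k => (y k).toNat * (y (k + 1)).toNat
  simp only [Equiv.coe_addLeft] at h1 h2
  simp only [pentagon, ← add_assoc, h1, h2]

section

variable {D T : Type*}

/-- The pairs are the dimers `1 → 6`, `3 → 8`, `5 → 10`, whose sign is the bulk bit, and `2 → 7`, `4
→ 9`, whose sign is fixed; `(e k, false)` and `(e k, true)` are the modes `2k+1` and `2k+2`. -/
theorem pentagon_family_rel (t : T) (e : Fin 5 → D) (he : Function.Injective e) :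
    ∀ p ∈ [((e 0, false), (e 2, true)), ((e 1, false), (e 3, true)), ((e 2, false), (e 4, true)),
      ((e 0, true), (e 3, false)), ((e 1, true), (e 4, false))],
      PhaseRel (fun μ (b : T → Bool) => listMajorana [e 0, e 1, e 2, e 3, e 4] μ
        fun x => pentagon (b t) fun k => x (e k)) p.1 p.2 := by
  have ne : ∀ i j : Fin 5, i ≠ j → e i ≠ e j := fun i j h h' => h (he h')
  have hph : ∀ c, entryXY true c = Complex.I * sgn (!c) := by
    intro c; cases c <;> simp [entryXY, sgn]
  have hph' : ∀ c, entryXY false c = 1 := by intro c; simp [entryXY]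
  have e01 := ne 0 1 (by decide); have e02 := ne 0 2 (by decide); have e03 := ne 0 3 (by decide)
  have e04 := ne 0 4 (by decide); have e12 := ne 1 2 (by decide); have e13 := ne 1 3 (by decide)
  have e14 := ne 1 4 (by decide); have e23 := ne 2 3 (by decide); have e24 := ne 2 4 (by decide)
  have e34 := ne 3 4 (by decide)
  -- Separates the parity condition for a nonzero amplitude from the comparison of signs where the
  -- condition holds; both are statements about six bits.
  have fin : ∀ (P P' : Prop) [Decidable P] [Decidable P'] (A A' c c' : ℂ), (P ↔ P') → (P → c * A = c' * A') →
      c * (if P then A / 4 else 0) = c' * (if P' then A' / 4 else 0) := by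
    intro P P' _ _ A A' c c' hP h
    by_cases hp : P
    · rw [if_pos hp, if_pos (hP.1 hp)]; linear_combination h hp / 4
    · rw [if_neg hp, if_neg (fun h => hp (hP.2 h))]; simp
  have key : ∀ u v : Bool, u = v → sgn u = sgn v := fun u v h => by rw [h]
  simp only [List.forall_mem_cons, List.not_mem_nil, IsEmpty.forall_iff, implies_true, and_true]
  refine ⟨⟨fun b => b t, .eval t, ?_⟩, ⟨fun b => b t, .eval t, ?_⟩, ⟨fun b => b t, .eval t, ?_⟩,
    ⟨fun _ => false, .const _, ?_⟩, ⟨fun _ => false, .const _, ?_⟩⟩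
  all_goals
    intro b; funext x
    simp only [listMajorana, Pi.smul_apply, smul_eq_mul, pentagon_eq, flipAt, jwSign, hph, hph',
      Function.update_apply, e01, e02, e03, e04, e12, e13, e14, e23, e24, e34, e01.symm, e02.symm,
      e03.symm, e04.symm, e12.symm, e13.symm, e14.symm, e23.symm, e24.symm, e34.symm, if_true,
      if_false]
    generalize x (e 0) = y0; generalize x (e 1) = y1; generalize x (e 2) = y2
    generalize x (e 3) = y3; generalize x (e 4) = y4; generalize b t = β
    simp only [← mul_assoc]
    refine fin _ _ _ _ _ _ ?_ ?_
    · revert y0 y1 y2 y3 y4 β; decide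
    intro h
  -- In each of the five cases both sides are gathered into the sign of a single Boolean expression,
  -- times `i` in the last two, and the expressions are compared by `decide`.
  · trans sgn (pentagonBit β (!y0) y1 y2 y3 y4)
    · ring
    trans sgn (xor β (xor y0 (xor y1 (xor (!y2) (pentagonBit β y0 y1 (!y2) y3 y4)))))
    · apply key; revert y0 y1 y2 y3 y4 β; decide
    · simp only [sgn_xor]; ring_nf; simp
  · trans sgn (xor y0 (pentagonBit β y0 (!y1) y2 y3 y4))
    · simp only [sgn_xor]; ring
    trans sgn (xor β (xor y0 (xor y1 (xor y2 (xor (!y3) (pentagonBit β y0 y1 y2 (!y3) y4))))))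
    · apply key; revert y0 y1 y2 y3 y4 β; decide
    · simp only [sgn_xor]; ring_nf; simp
  · trans sgn (xor y0 (xor y1 (pentagonBit β y0 y1 (!y2) y3 y4)))
    · simp only [sgn_xor]; ring
    trans sgn (xor β (xor y0 (xor y1 (xor y2 (xor y3 (xor (!y4) (pentagonBit β y0 y1 y2 y3 (!y4))))))))
    · apply key; revert y0 y1 y2 y3 y4 β; decide
    · simp only [sgn_xor]; ring_nf; simp
  · trans Complex.I * sgn (xor (!y0) (pentagonBit β (!y0) y1 y2 y3 y4))
    · simp only [sgn_xor]; ring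
    trans Complex.I * sgn (!(xor y0 (xor y1 (xor y2 (pentagonBit β y0 y1 y2 (!y3) y4)))))
    · congr 1; apply key; revert y0 y1 y2 y3 y4 β; decide
    · simp only [sgn_not, sgn_xor, show sgn false = 1 from rfl]; ring
  · trans Complex.I * sgn (xor y0 (xor (!y1) (pentagonBit β y0 (!y1) y2 y3 y4)))
    · simp only [sgn_xor]; ring
    trans Complex.I * sgn (!(xor y0 (xor y1 (xor y2 (xor y3 (pentagonBit β y0 y1 y2 y3 (!y4)))))))
    · congr 1; apply key; revert y0 y1 y2 y3 y4 β; decide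
    · simp only [sgn_not, sgn_xor, show sgn false = 1 from rfl]; ring

theorem dimerList_pentagon (t : T) (e : Fin 5 → D) (he : Function.Injective e) :
    DimerList [e 0, e 1, e 2, e 3, e 4] fun (b : T → Bool) x => pentagon (b t) fun k => x (e k) := by
  have ne : ∀ i j : Fin 5, i ≠ j → e i ≠ e j := fun i j h h' => h (he h')
  refine ⟨?_, ?_, ⟨fun b => b t, .eval t, ?_⟩, ?_⟩
  · have := List.nodup_ofFn.2 he
    simpa using this
  · intro b x y h
    congr 1
    funext k
    apply h
    fin_cases k <;> simp
  · intro b x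
    simp only [pentagon_eq, signProd, List.map_cons, List.map_nil, List.prod_cons, List.prod_nil,
      mul_one]
    split_ifs with h
    · rw [← h]; simp only [xor5, sgn_xor]
    · simp
  · have h := pentagon_family_rel t e he
    simp only [List.forall_mem_cons, List.not_mem_nil, IsEmpty.forall_iff, implies_true,
      and_true] at h
    obtain ⟨h1, h2, h3, h4, h5⟩ := h
    have := (((((Matched.zero (Rl := PhaseRel (fun μ (b : T → Bool) =>
      listMajorana [e 0, e 1, e 2, e 3, e 4] μ
        fun x => pentagon (b t) fun k => x (e k)))).cons h5).cons h4).cons h3).cons h2).cons h1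
    convert this using 1
    simp only [← Multiset.cons_coe, modes_cons]
    simp only [Multiset.coe_nil, show modes (0 : Multiset D) = 0 from rfl]
    ext μ
    simp only [Multiset.count_cons, Multiset.count_zero]
    ring

/-- The amplitudes of the five-qubit code, multiplied by four. -/
def pentagonInt (β y0 y1 y2 y3 y4 : Bool) : ℤ :=
  if xor5 y0 y1 y2 y3 y4 = β then (if pentagonBit β y0 y1 y2 y3 y4 then -1 else 1) else 0

theorem pentagon_eq_int (β : Bool) (y : Fin 5 → Bool) :
    pentagon β y = (pentagonInt β (y 0) (y 1) (y 2) (y 3) (y 4) : ℂ) / 4 := by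
  rw [pentagon_eq, pentagonInt]
  split_ifs with h1 h2 <;> simp [sgn, *]

theorem star_pentagon (β : Bool) (y : Fin 5 → Bool) : star (pentagon β y) = pentagon β y := by
  rw [pentagon_eq_int]; simp

/-- The pentagon, read as a map from one leg to the other four, is proportional to an isometry. The
squared norm 8 becomes `8 / 16 = 1 / 2` for the true amplitudes and is compensated by the factor
`√2` of the bond. -/
theorem sum_pentagonInt_one (β z z' : Bool) :
    ∑ y1, ∑ y2, ∑ y3, ∑ y4, pentagonInt β z y1 y2 y3 y4 * pentagonInt β z' y1 y2 y3 y4 =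
      if z = z' then 8 else 0 := by
  revert β z z'; decide

/-- The same for two neighbouring legs: `4 / 16 = 1 / 4`, compensated by the two factors `√2` of a
corner. -/
theorem sum_pentagonInt_two (β z w z' w' : Bool) :
    ∑ y2, ∑ y3, ∑ y4, pentagonInt β z w y2 y3 y4 * pentagonInt β z' w' y2 y3 y4 =
      if (z, w) = (z', w') then 4 else 0 := by
  revert β z w z' w'; decide

theorem sum_pentagonInt_zero (β : Bool) :
    ∑ y0, ∑ y1, ∑ y2, ∑ y3, ∑ y4, pentagonInt β y0 y1 y2 y3 y4 * pentagonInt β y0 y1 y2 y3 y4 =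
      16 := by
  revert β; decide

end

/-! ### The states of the network, as functions of the bits on the darts -/

/-- The amplitude of the pentagon `t` for given bits on the darts. -/
def tileAmp (β : Bool) (t : Tile) (x : Dart → Bool) : ℂ :=
  pentagon β fun k => x (Quotient.out t * r ^ (k : ℕ))

/-- Rotation invariance of the amplitudes makes the chosen representative of the pentagon
irrelevant. -/
theorem tileAmp_tile (β : Bool) (g : Dart) (x : Dart → Bool) :
    tileAmp β (tile g) x = pentagon β fun k => x (g * r ^ (k : ℕ)) := by
  obtain ⟨j, hj⟩ := tile_eq_iff.1 (tile_out (tile g))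
  rw [tileAmp, ← pentagon_rotate β _ j]
  congr 1
  funext k
  rw [r_pow_add, ← mul_assoc, ← hj]

theorem tileAmp_congr {β : Bool} {t : Tile} {x y : Dart → Bool}
    (h : ∀ d, tile d = t → x d = y d) : tileAmp β t x = tileAmp β t y := by
  rw [tileAmp, tileAmp]
  congr 1
  funext k
  exact h _ (by rw [tile_mul_r_pow, tile_out])

/-- The product of the amplitudes of the pentagons of a patch, for matching bits on its bonds. -/
def patchAmp (R : Finset Tile) (b : Tile → Bool) (x : Dart → Bool) : ℂ :=
  if ∀ d ∈ closedDarts R, x (d * s) = x d then ∏ t ∈ R, tileAmp (b t) t x else 0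

/-- The state of the network on a patch. -/
def patchState (R : Finset Tile) (b : Tile → Bool) (x : Dart → Bool) : ℂ :=
  ((Real.sqrt 2 ^ ((closedDarts R).card / 2) : ℝ) : ℂ) * sumOver (closedDarts R) (patchAmp R b) x

theorem patchAmp_congr {R : Finset Tile} {b : Tile → Bool} {x y : Dart → Bool}
    (h : ∀ d, tile d ∈ R → x d = y d) : patchAmp R b x = patchAmp R b y := by
  have h1 : (∀ d ∈ closedDarts R, x (d * s) = x d) ↔ ∀ d ∈ closedDarts R, y (d * s) = y d := by
    refine forall₂_congr fun d hd => ?_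
    rw [mem_closedDarts] at hd
    rw [h _ hd.1, h _ hd.2]
  have h2 : ∏ t ∈ R, tileAmp (b t) t x = ∏ t ∈ R, tileAmp (b t) t y :=
    Finset.prod_congr rfl fun t ht => tileAmp_congr fun d hd => h d (hd ▸ ht)
  rw [patchAmp, patchAmp, h2]
  simp only [h1]

theorem patchState_congr {R : Finset Tile} {b : Tile → Bool} {x y : Dart → Bool}
    (h : ∀ d ∈ openDarts R, x d = y d) : patchState R b x = patchState R b y := by
  rw [patchState, patchState]
  congr 1
  refine Finset.sum_congr rfl fun U _ => patchAmp_congr fun d hd => ?_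
  by_cases hc : d ∈ closedDarts R
  · simp [hc]
  · simp only [hc, if_false]
    refine h d (mem_openDarts.2 ⟨hd, fun h => hc (mem_closedDarts.2 ⟨hd, h⟩)⟩)

theorem disjoint_closedDarts_openDarts (R : Finset Tile) :
    Disjoint (closedDarts R) (openDarts R) := by
  rw [Finset.disjoint_left]
  intro d h1 h2
  exact (mem_openDarts.1 h2).2 (mem_closedDarts.1 h1).2

theorem mem_closedDarts_union_openDarts {R : Finset Tile} {d : Dart} :
    d ∈ closedDarts R ∪ openDarts R ↔ tile d ∈ R := by
  rw [Finset.mem_union, mem_closedDarts, mem_openDarts]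
  tauto

theorem card_closedDarts (R : Finset Tile) :
    Fintype.card {l : Leg R // ¬ l.IsOpen} = (closedDarts R).card := by
  rw [← Fintype.card_coe]
  refine Fintype.card_congr (((legEquiv R).subtypeEquiv (p := fun l : Leg R => ¬ l.IsOpen)
    (q := fun d : {d // tile d ∈ R} => tile ((d : Dart) * s) ∈ R) fun l => ?_).trans
    ((Equiv.subtypeSubtypeEquivSubtypeInter _ fun d => tile (d * s) ∈ R).trans
      (Equiv.subtypeEquivRight fun d => mem_closedDarts.symm)))
  rw [Leg.IsOpen, not_not]
  rfl

/-- Passing from legs to darts makes states of different patches functions on the same set of bits,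
so that patches can grow by induction. -/
theorem network_eq_patchState (R : Finset Tile) {N : ℕ} (leg : Fin N ≃ {l : Leg R // l.IsOpen})
    (b : Tile → Bool) (x : Dart → Bool) :
    network R leg (fun k => x (leg k).1.dart) (fun t => b t) = patchState R b x := by
  rw [network, Matrix.of_apply, patchState, card_closedDarts]
  congr 1
  -- The network sums over all legs and pins the open ones by an indicator; the open darts are added
  -- to the summation to match this.
  have hopen : sumOver (closedDarts R ∪ openDarts R)
      (fun y => if ∀ d ∈ openDarts R, y d = x d then patchAmp R b y else 0) x =
      sumOver (closedDarts R) (patchAmp R b) x := by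
    rw [sumOver_union (disjoint_closedDarts_openDarts R)]
    refine sumOver_congr fun y hy => ?_
    rw [← sumOver_eq_single (openDarts R) (patchAmp R b) y]
    congr 1
    funext z
    have : (∀ d ∈ openDarts R, z d = x d) ↔ ∀ d ∈ openDarts R, z d = y d := by
      refine forall₂_congr fun d hd => ?_
      rw [hy d (Finset.disjoint_right.1 (disjoint_closedDarts_openDarts R) hd)]
    simp only [this]
  let e : Leg R ≃ (closedDarts R ∪ openDarts R : Finset Dart) := (legEquiv R).trans
    (Equiv.subtypeEquivRight fun d => mem_closedDarts_union_openDarts.symm)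
  have he : ∀ l, (e l : Dart) = l.dart := fun l => rfl
  rw [← hopen, sumOver_equiv e]
  refine Finset.sum_congr (by ext; simp) fun c _ => ?_
  set y : Dart → Bool := fun d =>
    if h : d ∈ closedDarts R ∪ openDarts R then c (e.symm ⟨d, h⟩) else x d with hy
  have hyl : ∀ l : Leg R, y l.dart = c l := by
    intro l
    have h : l.dart ∈ closedDarts R ∪ openDarts R := (e l).2
    simp only [hy, h, dif_pos]
    congr 1
    rw [Equiv.symm_apply_eq]
    exact Subtype.ext (he l).symm
  have hex : ∀ d, tile d ∈ R → ∃ l : Leg R, l.dart = d := fun d hd =>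
    ⟨(legEquiv R).symm ⟨d, hd⟩, by rw [← legEquiv_apply]; simp⟩
  have hmem : ∀ l : Leg R, tile l.dart ∈ R := fun l => (legEquiv R l).2
  have h1 : (∀ l l' : Leg R, l'.dart = l.dart * s → c l' = c l) ↔
      ∀ d ∈ closedDarts R, y (d * s) = y d := by
    constructor
    · intro h d hd
      rw [mem_closedDarts] at hd
      obtain ⟨l, rfl⟩ := hex d hd.1
      obtain ⟨l', hl'⟩ := hex _ hd.2
      rw [← hl', hyl, hyl, h l l' hl']
    · intro h l l' hl'
      rw [← hyl, ← hyl, hl']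
      refine h _ (mem_closedDarts.2 ⟨hmem l, ?_⟩)
      rw [← hl']; exact hmem l'
  have h2 : (∀ k, c (leg k).1 = x (leg k).1.dart) ↔ ∀ d ∈ openDarts R, y d = x d := by
    constructor
    · intro h d hd
      rw [mem_openDarts] at hd
      obtain ⟨l, rfl⟩ := hex d hd.1
      have := h (leg.symm ⟨l, hd.2⟩)
      rw [Equiv.apply_symm_apply] at this
      rw [hyl, this]
    · intro h k
      rw [← hyl]
      exact h _ (mem_openDarts.2 ⟨hmem _, (leg k).2⟩)
  have h3 : ∏ t : R, pentagon (b t) (fun k => c (t, k)) = ∏ t ∈ R, tileAmp (b t) t y := by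
    rw [← Finset.prod_coe_sort R fun t => tileAmp (b t) t y]
    refine Finset.prod_congr rfl fun t _ => ?_
    rw [tileAmp]
    congr 1
    funext k
    exact (hyl (t, k)).symm
  rw [h3, patchAmp]
  by_cases hA : ∀ d ∈ openDarts R, y d = x d
  · rw [if_pos hA]
    simp only [h1, h2.2 hA, implies_true, and_true]
  · rw [if_neg hA, if_neg (fun h => hA (h2.1 h.2))]

theorem mem_closedDarts_insert {R : Finset Tile} {g d : Dart} :
    d ∈ closedDarts (insert (tile g) R) ↔ d ∈ closedDarts R ∨
      ∃ k : Fin 5, tile (g * r ^ (k : ℕ) * s) ∈ R ∧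
        (d = g * r ^ (k : ℕ) ∨ d = g * r ^ (k : ℕ) * s) := by
  rw [mem_closedDarts, mem_closedDarts, Finset.mem_insert, Finset.mem_insert]
  constructor
  · rintro ⟨h1 | h1, h2⟩
    · obtain ⟨k, rfl⟩ := tile_eq_iff.1 h1.symm
      exact .inr ⟨k, h2.resolve_left (tile_pow_mul_s_ne g k), .inl rfl⟩
    · rcases h2 with h2 | h2
      · obtain ⟨k, hk⟩ := tile_eq_iff.1 h2.symm
        have : d = g * r ^ (k : ℕ) * s := by rw [← hk, mul_s_mul_s]
        exact .inr ⟨k, this ▸ h1, .inr this⟩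
      · exact .inl ⟨h1, h2⟩
  · rintro (⟨h1, h2⟩ | ⟨k, hk, rfl | rfl⟩)
    · exact ⟨.inr h1, .inr h2⟩
    · exact ⟨.inl (tile_mul_r_pow g k), .inr hk⟩
    · rw [mul_s_mul_s]
      exact ⟨.inr hk, .inl (tile_mul_r_pow g k)⟩

theorem mem_openDarts_insert {R : Finset Tile} {g d : Dart} :
    d ∈ openDarts (insert (tile g) R) ↔ (d ∈ openDarts R ∧ ∀ k : Fin 5, d ≠ g * r ^ (k : ℕ) * s) ∨
      ∃ k : Fin 5, tile (g * r ^ (k : ℕ) * s) ∉ R ∧ d = g * r ^ (k : ℕ) := by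
  rw [mem_openDarts, mem_openDarts, Finset.mem_insert, Finset.mem_insert, not_or]
  constructor
  · rintro ⟨h1 | h1, h2, h3⟩
    · obtain ⟨k, rfl⟩ := tile_eq_iff.1 h1.symm
      exact .inr ⟨k, h3, rfl⟩
    · refine .inl ⟨⟨h1, h3⟩, ?_⟩
      rintro k rfl
      rw [mul_s_mul_s, tile_mul_r_pow] at h2
      exact h2 rfl
  · rintro (⟨⟨h1, h2⟩, h3⟩ | ⟨k, hk, rfl⟩)
    · refine ⟨.inr h1, fun h => ?_, h2⟩
      obtain ⟨k, hk⟩ := tile_eq_iff.1 h.symm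
      exact h3 k (by rw [← hk, mul_s_mul_s])
    · exact ⟨.inl (tile_mul_r_pow g k), tile_pow_mul_s_ne g k, hk⟩

theorem closedDarts_insert_edge {R : Finset Tile} {g : Dart}
    (hb : ∀ k : Fin 5, tile (g * r ^ (k : ℕ) * s) ∈ R ↔ k = 0) :
    closedDarts (insert (tile g) R) = insert g (insert (g * s) (closedDarts R)) := by
  ext d
  rw [mem_closedDarts_insert]
  simp only [hb, Finset.mem_insert, exists_eq_left, Fin.val_zero, pow_zero, mul_one]
  tauto

theorem closedDarts_insert_corner {R : Finset Tile} {g : Dart}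
    (hb : ∀ k : Fin 5, tile (g * r ^ (k : ℕ) * s) ∈ R ↔ k = 0 ∨ k = 1) :
    closedDarts (insert (tile g) R) =
      insert g (insert (g * s) (insert (g * r) (insert (g * r * s) (closedDarts R)))) := by
  ext d
  rw [mem_closedDarts_insert]
  simp only [hb, Finset.mem_insert, or_and_right, exists_or, exists_eq_left, Fin.val_zero, pow_zero,
    mul_one, Fin.val_one, pow_one]
  tauto

theorem patchAmp_insert {R : Finset Tile} {g : Dart} (hg : tile g ∉ R) (b : Tile → Bool)
    (x : Dart → Bool) :
    patchAmp (insert (tile g) R) b x =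
      if ∀ k : Fin 5, tile (g * r ^ (k : ℕ) * s) ∈ R → x (g * r ^ (k : ℕ)) = x (g * r ^ (k : ℕ) * s)
      then (pentagon (b (tile g)) fun k => x (g * r ^ (k : ℕ))) * patchAmp R b x else 0 := by
  have h1 : (∀ d ∈ closedDarts (insert (tile g) R), x (d * s) = x d) ↔
      (∀ k : Fin 5, tile (g * r ^ (k : ℕ) * s) ∈ R →
        x (g * r ^ (k : ℕ)) = x (g * r ^ (k : ℕ) * s)) ∧
      ∀ d ∈ closedDarts R, x (d * s) = x d := by
    constructor
    · intro h
      refine ⟨fun k hk => ?_, fun d hd => h d ((mem_closedDarts_insert).2 (.inl hd))⟩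
      exact (h _ ((mem_closedDarts_insert).2 (.inr ⟨k, hk, .inl rfl⟩))).symm
    · rintro ⟨h1, h2⟩ d hd
      rcases (mem_closedDarts_insert).1 hd with hd | ⟨k, hk, rfl | rfl⟩
      · exact h2 d hd
      · exact (h1 k hk).symm
      · rw [mul_s_mul_s]; exact h1 k hk
  rw [patchAmp, patchAmp, Finset.prod_insert hg, tileAmp_tile]
  simp only [h1, ite_and]
  split_ifs <;> simp

theorem not_mem_closedDarts_of_tile {R : Finset Tile} {d : Dart} (h : tile d ∉ R) :
    d ∉ closedDarts R := fun hd => h (mem_closedDarts.1 hd).1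

theorem not_mem_closedDarts_mul_s {R : Finset Tile} {d : Dart} (h : tile d ∉ R) :
    d * s ∉ closedDarts R := fun hd => h (by simpa using (mem_closedDarts.1 hd).2)

theorem sumOver_mul_patchAmp {R : Finset Tile} {g : Dart} (hg : tile g ∉ R) (b : Tile → Bool)
    (x : Dart → Bool) :
    sumOver (closedDarts R)
      (fun y => (pentagon (b (tile g)) fun k => y (g * r ^ (k : ℕ))) * patchAmp R b y) x =
      (pentagon (b (tile g)) fun k => x (g * r ^ (k : ℕ))) *
        sumOver (closedDarts R) (patchAmp R b) x := by
  refine sumOver_mul_left (patchAmp R b) (G := fun x => pentagon (b (tile g)) fun k =>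
    x (g * r ^ (k : ℕ))) (fun x y h => ?_) x
  congr 1
  funext k
  exact h _ (not_mem_closedDarts_of_tile (by rwa [tile_mul_r_pow]))

/-- Each of `c` new bonds adds two closed darts, and the exponent counts bonds. -/
theorem sqrt_two_pow_half (n : ℕ) (c : ℕ) :
    ((Real.sqrt 2 ^ ((n + 2 * c) / 2) : ℝ) : ℂ) =
      ((Real.sqrt 2 ^ c : ℝ) : ℂ) * ((Real.sqrt 2 ^ (n / 2) : ℝ) : ℂ) := by
  rw [← Complex.ofReal_mul, ← pow_add]
  congr 2
  omega

theorem patchState_edge {R : Finset Tile} {g : Dart} (hg : tile g ∉ R)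
    (hb : ∀ k : Fin 5, tile (g * r ^ (k : ℕ) * s) ∈ R ↔ k = 0) (b : Tile → Bool) :
    patchState (insert (tile g) R) b = ((Real.sqrt 2 ^ 1 : ℝ) : ℂ) • contract g (g * s) (fun y =>
      (pentagon (b (tile g)) fun k => y (g * r ^ (k : ℕ))) * patchState R b y) := by
  have hR := (hb 0).2 rfl
  rw [Fin.val_zero, pow_zero, mul_one] at hR
  have hgc := not_mem_closedDarts_of_tile hg
  have hgsc := not_mem_closedDarts_mul_s hg
  have hne : g ≠ g * s := fun h => hg (by rw [h]; exact hR)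
  funext x
  rw [patchState, closedDarts_insert_edge hb, Finset.card_insert_of_notMem (by simp [hgc, hne]),
    Finset.card_insert_of_notMem hgsc, add_assoc, show 1 + 1 = 2 * 1 from rfl, sqrt_two_pow_half,
    Pi.smul_apply, smul_eq_mul, mul_assoc]
  congr 1
  have : patchAmp (insert (tile g) R) b = fun y => if y g = y (g * s) then
      (pentagon (b (tile g)) fun k => y (g * r ^ (k : ℕ))) * patchAmp R b y else 0 := by
    funext y
    rw [patchAmp_insert hg]
    simp only [hb, forall_eq, Fin.val_zero, pow_zero, mul_one]
  rw [this, sumOver_pair hne hgc hgsc, contract, contract, Finset.mul_sum]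
  refine Finset.sum_congr rfl fun c _ => ?_
  rw [sumOver_mul_patchAmp hg, patchState]
  ring

theorem patchState_corner {R : Finset Tile} {g : Dart} (hg : tile g ∉ R)
    (hb : ∀ k : Fin 5, tile (g * r ^ (k : ℕ) * s) ∈ R ↔ k = 0 ∨ k = 1) (b : Tile → Bool) :
    patchState (insert (tile g) R) b = ((Real.sqrt 2 ^ 2 : ℝ) : ℂ) • contract g (g * s)
      (contract (g * r) (g * r * s) (fun y =>
        (pentagon (b (tile g)) fun k => y (g * r ^ (k : ℕ))) * patchState R b y)) := by
  have hR := (hb 0).2 (.inl rfl)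
  have hR1 := (hb 1).2 (.inr rfl)
  rw [Fin.val_zero, pow_zero, mul_one] at hR
  rw [Fin.val_one, pow_one] at hR1
  have hg1 : tile (g * r) ∉ R := by rwa [tile_mul_r]
  have hgc := not_mem_closedDarts_of_tile hg
  have hgsc := not_mem_closedDarts_mul_s hg
  have hgc1 := not_mem_closedDarts_of_tile hg1
  have hgsc1 := not_mem_closedDarts_mul_s hg1
  have hrs : g ≠ g * r := by
    have := (mul_r_pow_injective g).ne (show (0 : Fin 5) ≠ 1 by decide)
    simpa using this
  have h1 : g ≠ g * s := fun h => hg (by rw [h]; exact hR)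
  have h2 : g * r ≠ g * r * s := fun h => hg1 (by rw [h]; exact hR1)
  have h3 : g ≠ g * r * s := fun h => hg (by rw [h]; exact hR1)
  have h4 : g * s ≠ g * r := fun h => hg1 (by rw [← h]; exact hR)
  have h5 : g * s ≠ g * r * s := fun h => hrs (mul_right_cancel h)
  funext x
  rw [patchState, closedDarts_insert_corner hb,
    Finset.card_insert_of_notMem (by simp [*]), Finset.card_insert_of_notMem (by simp [*]),
    Finset.card_insert_of_notMem (by simp [*]), Finset.card_insert_of_notMem hgsc1,
    add_assoc, add_assoc, add_assoc, show 1 + (1 + (1 + 1)) = 2 * 2 from rfl, sqrt_two_pow_half,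
    Pi.smul_apply, smul_eq_mul, mul_assoc]
  congr 1
  have : patchAmp (insert (tile g) R) b = fun y => if y g = y (g * s) then
      (if y (g * r) = y (g * r * s) then
      (pentagon (b (tile g)) fun k => y (g * r ^ (k : ℕ))) * patchAmp R b y else 0) else 0 := by
    funext y
    rw [patchAmp_insert hg, ← ite_and]
    simp only [hb, forall_eq_or_imp, forall_eq, Fin.val_zero, pow_zero, mul_one, Fin.val_one,
      pow_one]
  rw [this, sumOver_pair h1 (by simp [*]) (by simp [*]), contract, contract, Finset.mul_sum]
  refine Finset.sum_congr rfl fun c _ => ?_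
  rw [sumOver_pair h2 hgc1 hgsc1, contract, contract, Finset.mul_sum]
  refine Finset.sum_congr rfl fun c _ => ?_
  rw [sumOver_mul_patchAmp hg, patchState]
  ring

/-! ### Normalization -/

section Norm

variable {D : Type*}

/-- The maps `τ z` and `σ z` write the bond values `z` into the arguments of the two factors. The
Gram matrix of `φ` over its open sites `Y` is, after scaling by `c`, the identity in `z`, so the
double sum over bond values collapses to the squared norm of `ψ`. -/
theorem sumOver_norm_contract {Z : Type*} [Fintype Z] {S Y : Finset D} (hd : Disjoint S Y)
    (ψ φ : (D → Bool) → ℂ) (σ τ : Z → (D → Bool) → D → Bool) (c : ℂ)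
    (hσ : ∀ z x y, (∀ d ∉ Y, x d = y d) → ψ (σ z x) = ψ (σ z y))
    (hφ : ∀ z z' x, sumOver Y (fun y => star (φ (τ z y)) * φ (τ z' y)) x * (star c * c) =
      if z = z' then 1 else 0)
    (hψ : ∀ x, sumOver S (fun y => ∑ z, star (ψ (σ z y)) * ψ (σ z y)) x = 1) (x : D → Bool) :
    sumOver (S ∪ Y) (fun x => star (c * ∑ z, φ (τ z x) * ψ (σ z x)) *
      (c * ∑ z, φ (τ z x) * ψ (σ z x))) x = 1 := by
  rw [sumOver_union hd, ← hψ x]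
  congr 1
  funext y
  have h1 : (fun x => star (c * ∑ z, φ (τ z x) * ψ (σ z x)) * (c * ∑ z, φ (τ z x) * ψ (σ z x))) =
      fun x => ∑ z, ∑ z', (star (φ (τ z x)) * φ (τ z' x)) *
        ((star c * c) * (star (ψ (σ z x)) * ψ (σ z' x))) := by
    funext x
    rw [star_mul', star_sum, mul_mul_mul_comm, Finset.sum_mul_sum, Finset.mul_sum]
    refine Finset.sum_congr rfl fun z _ => ?_
    rw [Finset.mul_sum]
    refine Finset.sum_congr rfl fun z' _ => ?_
    rw [star_mul']
    ring
  rw [h1, sumOver_sum]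
  refine Finset.sum_congr rfl fun z _ => ?_
  rw [sumOver_sum]
  have h2 : ∀ z', sumOver Y (fun x => (star (φ (τ z x)) * φ (τ z' x)) *
        ((star c * c) * (star (ψ (σ z x)) * ψ (σ z' x)))) y =
      (if z = z' then 1 else 0) * (star (ψ (σ z y)) * ψ (σ z' y)) := by
    intro z'
    rw [sumOver_mul_right _ (fun u w h => by rw [hσ z u w h, hσ z' u w h]), ← hφ z z' y]
    ring
  simp only [h2, ite_mul, one_mul, zero_mul, Finset.sum_ite_eq, Finset.mem_univ, if_true]

theorem sumOver_pentagon (β : Bool) {e : Fin 5 → D} (he : Function.Injective e)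
    (x : D → Bool) :
    sumOver {e 0, e 1, e 2, e 3, e 4} (fun y => star (pentagon β fun k => y (e k)) *
      pentagon β fun k => y (e k)) x = 1 := by
  have ne : ∀ i j : Fin 5, i ≠ j → e i ≠ e j := fun i j h h' => h (he h')
  rw [sumOver_insert (by simp [ne]), ← div_self (show (16 : ℂ) ≠ 0 by norm_num)]
  have h16 : (16 : ℂ) = ((16 : ℤ) : ℂ) := by norm_num
  nth_rw 1 [h16]
  rw [← sum_pentagonInt_zero β]
  push_cast
  simp only [Finset.sum_div]
  refine Finset.sum_congr rfl fun y0 _ => ?_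
  rw [sumOver_insert (by simp [ne])]
  refine Finset.sum_congr rfl fun y1 _ => ?_
  rw [sumOver_insert (by simp [ne])]
  refine Finset.sum_congr rfl fun y2 _ => ?_
  rw [sumOver_insert (by simp [ne]), ← insert_empty_eq]
  refine Finset.sum_congr rfl fun y3 _ => ?_
  rw [sumOver_insert (by simp)]
  refine Finset.sum_congr rfl fun y4 _ => ?_
  rw [sumOver_empty, star_pentagon]
  simp only [pentagon_eq_int, Function.update_apply, he.eq_iff]
  simp
  ring

theorem sumOver_pentagon_one (β : Bool) {e : Fin 5 → D} (he : Function.Injective e)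
    {v : D} (hv : v ∉ Set.range e) (z z' : Bool) (x : D → Bool) :
    sumOver {e 1, e 2, e 3, e 4} (fun y => star (pentagon β fun k => setPair (e 0) v z y (e k)) *
      pentagon β fun k => setPair (e 0) v z' y (e k)) x = if z = z' then 1 / 2 else 0 := by
  have ne : ∀ i j : Fin 5, i ≠ j → e i ≠ e j := fun i j h h' => h (he h')
  have hv' : ∀ i, e i ≠ v := fun i h => hv ⟨i, h⟩
  have h8 : (if z = z' then 1 / 2 else 0 : ℂ) = (((if z = z' then 8 else 0 : ℤ)) : ℂ) / 16 := by
    split_ifs <;> norm_num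
  rw [h8, ← sum_pentagonInt_one β]
  push_cast
  simp only [Finset.sum_div]
  rw [sumOver_insert (by simp [ne])]
  refine Finset.sum_congr rfl fun y1 _ => ?_
  rw [sumOver_insert (by simp [ne])]
  refine Finset.sum_congr rfl fun y2 _ => ?_
  rw [sumOver_insert (by simp [ne]), ← insert_empty_eq]
  refine Finset.sum_congr rfl fun y3 _ => ?_
  rw [sumOver_insert (by simp)]
  refine Finset.sum_congr rfl fun y4 _ => ?_
  rw [sumOver_empty, star_pentagon]
  simp only [pentagon_eq_int, setPair, Function.update_apply, he.eq_iff, hv']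
  simp
  ring

theorem sumOver_pentagon_two (β : Bool) {e : Fin 5 → D} (he : Function.Injective e)
    {v v' : D} (hv : v ∉ Set.range e) (hv' : v' ∉ Set.range e)
    (z z' : Bool × Bool) (x : D → Bool) :
    sumOver {e 2, e 3, e 4} (fun y =>
      star (pentagon β fun k => setPair (e 1) v' z.2 (setPair (e 0) v z.1 y) (e k)) *
      pentagon β fun k => setPair (e 1) v' z'.2 (setPair (e 0) v z'.1 y) (e k)) x =
      if z = z' then 1 / 4 else 0 := by
  have ne : ∀ i j : Fin 5, i ≠ j → e i ≠ e j := fun i j h h' => h (he h')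
  have hv1 : ∀ i, e i ≠ v := fun i h => hv ⟨i, h⟩
  have hv1' : ∀ i, e i ≠ v' := fun i h => hv' ⟨i, h⟩
  have h8 : (if z = z' then 1 / 4 else 0 : ℂ) =
      (((if (z.1, z.2) = (z'.1, z'.2) then 4 else 0 : ℤ)) : ℂ) / 16 := by
    simp only [Prod.mk.eta]
    split_ifs <;> norm_num
  rw [h8, ← sum_pentagonInt_two β]
  push_cast
  simp only [Finset.sum_div]
  rw [sumOver_insert (by simp [ne])]
  refine Finset.sum_congr rfl fun y2 _ => ?_
  rw [sumOver_insert (by simp [ne]), ← insert_empty_eq]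
  refine Finset.sum_congr rfl fun y3 _ => ?_
  rw [sumOver_insert (by simp)]
  refine Finset.sum_congr rfl fun y4 _ => ?_
  rw [sumOver_empty, star_pentagon]
  simp only [pentagon_eq_int, setPair, Function.update_apply, he.eq_iff, hv1, hv1']
  simp
  ring

end Norm

theorem DimerList.smul {D T : Type*} {l : List D} {ψ : (T → Bool) → (D → Bool) → ℂ} (c : ℂ)
    (h : DimerList l ψ) : DimerList l fun b => c • ψ b := by
  obtain ⟨f, hf, hp⟩ := h.parity
  refine ⟨h.nodup, fun b x y hxy => ?_, ⟨f, hf, fun b x => ?_⟩, ?_⟩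
  · simp only [Pi.smul_apply, h.local_ b x y hxy]
  · simp only [Pi.smul_apply, smul_eq_mul]
    linear_combination c * hp b x
  · refine h.matched.mono fun μ _ ν _ hr =>
      hr.transport (fun _ v => c • v) (fun _ a v => smul_comm _ _ _) (.const false) (.const false)
        ?_ ?_ <;>
    · intro b
      funext x
      simp [listMajorana, sgn]
      ring

/-! ### The boundary of a patch -/

/-- The walk stops at the first boundary edge that it meets, which determines its length. -/
theorem NextOnBoundary.unique {R : Finset Tile} {g h h' : Dart} (H : NextOnBoundary R g h)
    (H' : NextOnBoundary R g h') : h = h' := by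
  obtain ⟨j, rfl, h1, h2⟩ := H
  obtain ⟨j', rfl, h1', h2'⟩ := H'
  rcases lt_trichotomy j j' with h | rfl | h
  · exact absurd (h2' j h) h1
  · rfl
  · exact absurd (h2 j' h) h1'

theorem NextOnBoundary.mono {R R' : Finset Tile} (hR : R ⊆ R') {g h : Dart}
    (H : NextOnBoundary R g h) (hh : tile (h * s) ∉ R') : NextOnBoundary R' g h := by
  obtain ⟨j, rfl, h1, h2⟩ := H
  exact ⟨j, rfl, hh, fun i hi => hR (h2 i hi)⟩

/-- Once `v` is glued, the walk that used to stop there takes one more turn and stops at the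
neighbouring edge of the new pentagon. -/
theorem NextOnBoundary.through {R R' : Finset Tile} (hR : R ⊆ R') {g v : Dart}
    (H : NextOnBoundary R g v) (hv : tile (v * s) ∈ R') (hh : tile (v * s * r * s) ∉ R') :
    NextOnBoundary R' g (v * s * r) := by
  obtain ⟨j, hj, h1, h2⟩ := H
  refine ⟨j + 1, by rw [pow_succ, ← mul_assoc, ← hj, ← mul_assoc], hh, fun i hi => ?_⟩
  rcases Nat.lt_succ_iff_lt_or_eq.1 hi with hi | rfl
  · exact hR (h2 i hi)
  · rwa [← hj]

/-- The walk from the last edge `w` of the new pentagon crosses the bond in its first turn, since `w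
* r * s = v`, and then follows the old walk from `v`; hence the shift of the index by one. -/
theorem NextOnBoundary.from_glued {R R' : Finset Tile} (hR : R ⊆ R') {w v e : Dart}
    (H : NextOnBoundary R v e) (hw : w * r = v * s) (hv : tile v ∈ R') (he : tile (e * s) ∉ R') :
    NextOnBoundary R' w e := by
  obtain ⟨j, hj, h1, h2⟩ := H
  have key : ∀ i, w * r * (s * r) ^ (i + 1) = v * r * (s * r) ^ i := by
    intro i
    rw [hw, pow_succ', ← mul_assoc, ← mul_assoc, mul_s_mul_s]
  refine ⟨j + 1, by rw [key, hj], he, fun i hi => ?_⟩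
  rcases i with _ | i
  · rwa [pow_zero, mul_one, hw, mul_s_mul_s]
  · rw [key]
    exact hR (h2 i (by omega))

theorem nextOnBoundary_mul_r {R : Finset Tile} {g : Dart} (h : tile (g * r * s) ∉ R) :
    NextOnBoundary R g (g * r) :=
  ⟨0, by simp, h, fun i hi => absurd hi (Nat.not_lt_zero i)⟩

/-- The list `l` runs once around the boundary of `R`. -/
structure IsBoundary (R : Finset Tile) (l : List Dart) : Prop where
  nodup : l.Nodup
  mem_iff : ∀ d, d ∈ l ↔ d ∈ openDarts R
  chain : Cycle.Chain (NextOnBoundary R) (l : Cycle Dart)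
  length : 5 ≤ l.length

theorem IsBoundary.rotate {R : Finset Tile} {l l' : List Dart} (h : IsBoundary R (l ++ l')) :
    IsBoundary R (l' ++ l) := by
  refine ⟨List.nodup_append_comm.1 h.nodup, fun d => ?_, ?_, ?_⟩
  · rw [← h.mem_iff]; simp [or_comm]
  · rw [Cycle.coe_eq_coe.2 List.isRotated_append]; exact h.chain
  · have := h.length; simp only [List.length_append] at this ⊢; omega

/-- A boundary along which the states of the network are normalized dimer states. -/
structure DimerBoundary (R : Finset Tile) (l : List Dart) : Prop extends IsBoundary R l where
  dimers : DimerList l (patchState R)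
  norm : ∀ b x, sumOver (openDarts R) (fun y => star (patchState R b y) * patchState R b y) x = 1

theorem DimerBoundary.rotate {R : Finset Tile} {l l' : List Dart}
    (h : DimerBoundary R (l ++ l')) : DimerBoundary R (l' ++ l) :=
  ⟨h.toIsBoundary.rotate, h.dimers.rotate, h.norm⟩

theorem DimerBoundary.exists_cons {R : Finset Tile} {l : List Dart} (h : DimerBoundary R l)
    {d : Dart} (hd : d ∈ openDarts R) : ∃ p, DimerBoundary R (d :: p) := by
  rw [← h.mem_iff] at hd
  obtain ⟨l1, l2, rfl⟩ := List.append_of_mem hd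
  exact ⟨l2 ++ l1, by simpa using h.rotate⟩

/-- The chain ended at the glued dart `v`. Only its last step changes, and there the turn continues
through the new pentagon to `h`. -/
theorem isChain_replace_last {R R' : Finset Tile} (hR : R ⊆ R') {p : List Dart} {v h : Dart}
    (hp : ∀ d ∈ p, tile (d * s) ∉ R') (hv : tile (v * s) ∈ R') (hh : tile (h * s) ∉ R')
    (hvh : v * s * r = h) (H : List.IsChain (NextOnBoundary R) (p ++ [v])) :
    List.IsChain (NextOnBoundary R') (p ++ [h]) := by
  rw [List.isChain_append] at H ⊢
  obtain ⟨h1, -, h3⟩ := H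
  refine ⟨h1.imp_of_mem_imp fun a b _ hb hab => hab.mono hR (hp b hb), by simp, ?_⟩
  intro x hx y hy
  obtain rfl : y = h := by simpa using hy.symm
  subst hvh
  exact (h3 x hx v (by simp)).through hR hv hh

theorem pentagon_dimerList_pow (g : Dart) :
    DimerList [g, g * r, g * r ^ 2, g * r ^ 3, g * r ^ 4] fun (b : Tile → Bool) x =>
      pentagon (b (tile g)) fun k => x (g * r ^ (k : ℕ)) := by
  simpa using dimerList_pentagon (tile g) _ (mul_r_pow_injective g)

theorem mul_r_pow_four_mul_r (g : Dart) : g * r ^ 4 * r = g := by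
  rw [mul_assoc, ← pow_succ, r_pow_five, mul_one]

theorem exists_dimerBoundary_single (t : Tile) : ∃ l, DimerBoundary {t} l := by
  obtain ⟨g, rfl⟩ := tile_surjective t
  have hopen : ∀ k : ℕ, tile (g * r ^ k * s) ∉ ({tile g} : Finset Tile) := by
    intro k
    simpa using tile_pow_mul_s_ne g k
  have hc : closedDarts {tile g} = ∅ := by
    ext d
    rw [mem_closedDarts]
    simp only [Finset.mem_singleton, Finset.notMem_empty, iff_false, not_and]
    intro h1 h2
    exact tile_mul_s_ne d (h2.trans h1.symm)
  have hps : patchState {tile g} = fun b x => pentagon (b (tile g)) fun k => x (g * r ^ (k : ℕ)) := by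
    funext b x
    rw [patchState, hc, sumOver_empty, patchAmp, hc]
    simp [tileAmp_tile]
  have hod : openDarts {tile g} = {g * r ^ 0, g * r ^ 1, g * r ^ 2, g * r ^ 3, g * r ^ 4} := by
    ext d
    rw [mem_openDarts]
    simp only [Finset.mem_singleton, Finset.mem_insert]
    constructor
    · rintro ⟨h1, -⟩
      obtain ⟨k, rfl⟩ := tile_eq_iff.1 h1.symm
      fin_cases k <;> simp
    · have h : ∀ k : ℕ, tile (g * r ^ k) = tile g ∧ tile (g * r ^ k * s) ≠ tile g := fun k =>
        ⟨tile_mul_r_pow g k, tile_pow_mul_s_ne g k⟩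
      rintro (rfl | rfl | rfl | rfl | rfl)
      exacts [h 0, h 1, h 2, h 3, h 4]
  have hdl := pentagon_dimerList_pow g
  refine ⟨[g, g * r, g * r ^ 2, g * r ^ 3, g * r ^ 4], ⟨hdl.nodup, ?_, ?_, by simp⟩, ?_, ?_⟩
  · intro d
    rw [hod]
    simp
  · rw [Cycle.chain_coe_cons]
    have step : ∀ k : ℕ, NextOnBoundary {tile g} (g * r ^ k) (g * r ^ (k + 1)) := by
      intro k
      rw [pow_succ, ← mul_assoc]
      refine nextOnBoundary_mul_r ?_
      rw [mul_assoc g, ← pow_succ]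
      exact hopen _
    have h4 := step 4
    rw [r_pow_five, mul_one] at h4
    have h0 := step 0
    have h1 := step 1
    simp only [zero_add, pow_zero, mul_one, pow_one, one_add_one_eq_two] at h0 h1
    simp only [List.cons_append, List.nil_append, List.isChain_cons_cons, List.isChain_singleton]
    exact ⟨h0, h1, step 2, step 3, h4, trivial⟩
  · rw [hps]
    exact hdl
  · intro b x
    rw [hps, hod]
    simpa using sumOver_pentagon (b (tile g)) (mul_r_pow_injective g) x

/-- Starting the old cycle at `g * s` and ending the pentagon's cycle at `g` makes the two glued
darts adjacent in the concatenated list. One contraction then gives both the new state and the new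
cycle. -/
theorem exists_dimerBoundary_edge {R : Finset Tile} {g : Dart} (hg : tile g ∉ R)
    (hb : ∀ k : Fin 5, tile (g * r ^ (k : ℕ) * s) ∈ R ↔ k = 0) {l : List Dart}
    (hl : DimerBoundary R l) : ∃ l, DimerBoundary (insert (tile g) R) l := by
  have hR := (hb 0).2 rfl
  rw [Fin.val_zero, pow_zero, mul_one] at hR
  have hgs : g * s ∈ openDarts R := mem_openDarts.2 ⟨hR, by rwa [mul_s_mul_s]⟩
  obtain ⟨p, hp⟩ := hl.exists_cons hgs
  obtain ⟨hgsp, hpnd⟩ := List.nodup_cons.1 hp.nodup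
  have hopen : ∀ k : ℕ, k ∈ [1, 2, 3, 4] → tile (g * r ^ k * s) ∉ insert (tile g) R := by
    intro k hk
    rw [Finset.mem_insert, not_or]
    refine ⟨tile_pow_mul_s_ne g k, fun h => ?_⟩
    have h5 : k < 5 ∧ k ≠ 0 := by
      simp at hk; omega
    have := (hb ⟨k, h5.1⟩).1 h
    exact h5.2 (congrArg Fin.val this)
  have hmem : ∀ d, d ∈ openDarts (insert (tile g) R) ↔
      (d ∈ p ∨ d = g * r ∨ d = g * r ^ 2 ∨ d = g * r ^ 3 ∨ d = g * r ^ 4) := by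
    intro d
    rw [mem_openDarts_insert]
    have h1 : (∃ k : Fin 5, tile (g * r ^ (k : ℕ) * s) ∉ R ∧ d = g * r ^ (k : ℕ)) ↔
        d = g * r ∨ d = g * r ^ 2 ∨ d = g * r ^ 3 ∨ d = g * r ^ 4 := by
      simp only [hb]
      simp [Fin.exists_fin_succ]
    have h2 : (d ∈ openDarts R ∧ ∀ k : Fin 5, d ≠ g * r ^ (k : ℕ) * s) ↔ d ∈ p := by
      rw [← hp.mem_iff, List.mem_cons]
      constructor
      · rintro ⟨h | h, h'⟩
        · exact absurd h (by simpa using h' 0)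
        · exact h
      · intro h
        refine ⟨.inr h, ?_⟩
        rintro k rfl
        have := (mem_openDarts.1 ((hp.mem_iff _).1 (List.mem_cons_of_mem _ h))).1
        rw [hb] at this
        subst this
        exact hgsp (by simpa using h)
    rw [h1, h2]
  have hpo : ∀ d ∈ p, tile (d * s) ∉ insert (tile g) R := fun d hd =>
    (mem_openDarts.1 ((hmem d).2 (.inl hd))).2
  have hpR : ∀ d ∈ p, tile d ∈ R := fun d hd =>
    (mem_openDarts.1 ((hp.mem_iff d).1 (List.mem_cons_of_mem _ hd))).1
  have hlen := hp.length
  have hdl : DimerList ([g * r, g * r ^ 2, g * r ^ 3, g * r ^ 4] ++ p)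
      (patchState (insert (tile g) R)) := by
    have h1 : DimerList ([g * r, g * r ^ 2, g * r ^ 3, g * r ^ 4] ++ [g]) _ :=
      DimerList.rotate (l := [g]) (pentagon_dimerList_pow g)
    have h2 := h1.tensor hp.dimers (by
      intro d hd hd'
      have h3 : tile d = tile g := by
        simp only [List.cons_append, List.nil_append, List.mem_cons, List.not_mem_nil,
          or_false] at hd
        rcases hd with rfl | rfl | rfl | rfl | rfl
        · exact tile_mul_r g
        · exact tile_mul_r_pow g _
        · exact tile_mul_r_pow g _
        · exact tile_mul_r_pow g _
        · rfl
      exact hg (h3 ▸ (mem_openDarts.1 ((hp.mem_iff d).1 hd')).1))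
    rw [List.append_assoc] at h2
    have h3 := (DimerList.contract (p := [g * r, g * r ^ 2, g * r ^ 3, g * r ^ 4]) h2).smul
      ((Real.sqrt 2 ^ 1 : ℝ) : ℂ)
    convert h3 using 1
    funext b
    exact patchState_edge hg hb b
  refine ⟨_, ⟨hdl.nodup, ?_, ?_, ?_⟩, hdl, ?_⟩
  · intro d
    rw [hmem]
    simp only [List.mem_append, List.mem_cons, List.not_mem_nil, or_false]
    tauto
  · have hc := hp.chain
    rw [Cycle.chain_coe_cons] at hc
    obtain ⟨a, p', rfl⟩ : ∃ a p', p = a :: p' := by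
      cases p with
      | nil => simp at hlen
      | cons a p' => exact ⟨a, p', rfl⟩
    rw [List.cons_append, List.isChain_cons_cons] at hc
    -- These two facts are the seams of the new cycle: from the old boundary into the pentagon, and
    -- back.
    have hlast := isChain_replace_last (Finset.subset_insert _ _) hpo
      (v := g * s) (h := g * r) (by simp) (by simpa using hopen 1 (by simp)) (by simp) hc.2
    have hfirst := hc.1.from_glued (Finset.subset_insert (tile g) R) (w := g * r ^ 4)
      (by rw [mul_r_pow_four_mul_r, mul_s_mul_s]) (by simp [hR]) (hpo a (by simp))
    have step : ∀ k : ℕ, k + 1 ∈ [1, 2, 3, 4] →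
        NextOnBoundary (insert (tile g) R) (g * r ^ k) (g * r ^ (k + 1)) := by
      intro k hk
      rw [pow_succ, ← mul_assoc]
      refine nextOnBoundary_mul_r ?_
      rw [mul_assoc g, ← pow_succ]
      exact hopen _ hk
    have h1 := step 1 (by simp)
    rw [pow_one] at h1
    rw [List.cons_append, Cycle.chain_coe_cons]
    simp only [List.cons_append, List.nil_append, List.isChain_cons_cons] at hlast ⊢
    exact ⟨h1, step 2 (by simp), step 3 (by simp), hfirst, hlast⟩
  · simp only [List.length_append, List.length_cons, List.length_nil] at hlen ⊢
    omega
  · intro b x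
    have hset : openDarts (insert (tile g) R) =
        p.toFinset ∪ {g * r, g * r ^ 2, g * r ^ 3, g * r ^ 4} := by
      ext d
      rw [hmem]
      simp only [Finset.mem_union, List.mem_toFinset, Finset.mem_insert, Finset.mem_singleton]
    have hpt : ∀ d : Dart, d ∈ ({g * r, g * r ^ 2, g * r ^ 3, g * r ^ 4} : Finset Dart) →
        tile d = tile g := by
      intro d hd
      simp only [Finset.mem_insert, Finset.mem_singleton] at hd
      rcases hd with rfl | rfl | rfl | rfl
      · exact tile_mul_r g
      all_goals exact tile_mul_r_pow g _
    have hdis : Disjoint p.toFinset ({g * r, g * r ^ 2, g * r ^ 3, g * r ^ 4} : Finset Dart) := by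
      rw [Finset.disjoint_left]
      intro d hd hd'
      exact hg (hpt d hd' ▸ hpR d (List.mem_toFinset.1 hd))
    have hS : insert (g * s) p.toFinset = openDarts R := by
      ext d
      rw [← hp.mem_iff]
      simp
    rw [hset, patchState_edge hg hb]
    have hgr := sumOver_pentagon_one (b (tile g)) (mul_r_pow_injective g) (v := g * s) (by
      rintro ⟨k, hk⟩
      refine hg ?_
      rw [← tile_mul_r_pow g k, show g * r ^ (k : ℕ) = g * s from hk]
      exact hR)
    simp only [Fin.val_zero, pow_zero, mul_one] at hgr
    have hsq : star ((Real.sqrt 2 ^ 1 : ℝ) : ℂ) * ((Real.sqrt 2 ^ 1 : ℝ) : ℂ) = 2 := by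
      rw [Complex.star_def, Complex.conj_ofReal, ← Complex.ofReal_mul, ← pow_add,
        show 1 + 1 = 2 from rfl, Real.sq_sqrt (by norm_num)]
      norm_num
    refine sumOver_norm_contract hdis (patchState R b)
      (fun y => pentagon (b (tile g)) fun k => y (g * r ^ (k : ℕ)))
      (fun z => setPair g (g * s) z) (fun z => setPair g (g * s) z) _ ?_ ?_ ?_ x
    · intro z y y' h
      refine patchState_congr fun d hd => ?_
      have hdR := (mem_openDarts.1 hd).1
      have hdg : d ≠ g := by rintro rfl; exact hg hdR
      by_cases hds : d = g * s
      · rw [hds, setPair_right, setPair_right]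
      · rw [setPair_of_ne hdg hds, setPair_of_ne hdg hds]
        exact h d fun hd' => hg (hpt d hd' ▸ hdR)
    · intro z z' y
      rw [hsq]
      have := hgr z z' y
      erw [this]
      split_ifs <;> norm_num
    · intro y
      rw [sumOver_sum, ← hp.norm b y, ← hS, sumOver_insert (by simpa using hgsp)]
      refine Finset.sum_congr rfl fun z _ => ?_
      rw [sumOver_update (by simpa using hgsp)]
      refine sumOver_congr fun w _ => ?_
      have : patchState R b (setPair g (g * s) z w) =
          patchState R b (Function.update w (g * s) z) := by
        refine patchState_congr fun d hd => ?_
        have hdg : d ≠ g := by rintro rfl; exact hg (mem_openDarts.1 hd).1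
        by_cases hds : d = g * s
        · rw [hds, setPair_right]; simp
        · rw [setPair_of_ne hdg hds, Function.update_of_ne hds]
      rw [this]

theorem r_s_r_s_r_s_r : r * s * r * s * r * s * r = s := by
  have h := r_mul_s_pow_four
  have h2 : r * s * r * s * r * s * r * s = 1 := by
    rw [← h]; simp only [pow_succ, pow_zero, one_mul, mul_assoc]
  have h3 := congrArg (· * s) h2
  simpa using h3

/-- Four pentagons meet at the corner vertex, and the three other than `tile g` lie in `R`. The walk
therefore turns through them, and `(r s)⁴ = 1` closes it up at `g * s`. So the two edges to be glued
are consecutive on the old boundary. -/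
theorem nextOnBoundary_corner {R : Finset Tile} {g : Dart} (hg : tile g ∉ R)
    (h0 : tile (g * s) ∈ R) (hv : tile (g * r * s * r * s) ∈ R) :
    NextOnBoundary R (g * r * s) (g * s) := by
  have key : g * r * s * r * (s * r) ^ 2 = g * s := by
    conv_rhs => rw [← r_s_r_s_r_s_r]
    simp only [pow_succ, pow_zero, one_mul, mul_assoc]
  refine ⟨2, key.symm, by rwa [mul_s_mul_s], fun i hi => ?_⟩
  interval_cases i
  · simpa using hv
  · rw [← tile_mul_r]
    have : g * r * s * r * (s * r) ^ 1 * s * r = g * s := by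
      rw [← key]; simp only [pow_succ, pow_zero, one_mul, mul_assoc]
    rwa [this]

/-- The two bonds are nested in the concatenated list `…, g, g * r, g * r * s, g * s, …`. After
contraction of the inner one, the outer pair is adjacent and can be contracted in turn. -/
theorem exists_dimerBoundary_corner {R : Finset Tile} {g : Dart} (hg : tile g ∉ R)
    (hb : ∀ k : Fin 5, tile (g * r ^ (k : ℕ) * s) ∈ R ↔ k = 0 ∨ k = 1)
    (hv : tile (g * r * s * r * s) ∈ R) {l : List Dart}
    (hl : DimerBoundary R l) : ∃ l, DimerBoundary (insert (tile g) R) l := by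
  have hR := (hb 0).2 (.inl rfl)
  have hR1 := (hb 1).2 (.inr rfl)
  rw [Fin.val_zero, pow_zero, mul_one] at hR
  rw [Fin.val_one, pow_one] at hR1
  have hg1 : tile (g * r) ∉ R := by rwa [tile_mul_r]
  have hgrs : g * r * s ∈ openDarts R := mem_openDarts.2 ⟨hR1, by rwa [mul_s_mul_s]⟩
  obtain ⟨p, hp⟩ := hl.exists_cons hgrs
  have hlen := hp.length
  obtain ⟨a, p, rfl⟩ : ∃ a p', p = a :: p' := by
    cases p with
    | nil => simp at hlen
    | cons a p' => exact ⟨a, p', rfl⟩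
  have hc := hp.chain
  rw [Cycle.chain_coe_cons, List.cons_append, List.isChain_cons_cons] at hc
  -- The old cycle was started at `g * r * s`; uniqueness of the successor identifies its second
  -- entry.
  obtain rfl : a = g * s := hc.1.unique (nextOnBoundary_corner hg hR hv)
  obtain ⟨hgrsp, hnd⟩ := List.nodup_cons.1 hp.nodup
  obtain ⟨hgsp, hpnd⟩ := List.nodup_cons.1 hnd
  rw [List.mem_cons, not_or] at hgrsp
  have hopen : ∀ k : ℕ, k ∈ [2, 3, 4] → tile (g * r ^ k * s) ∉ insert (tile g) R := by
    intro k hk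
    rw [Finset.mem_insert, not_or]
    refine ⟨tile_pow_mul_s_ne g k, fun h => ?_⟩
    have h5 : k < 5 ∧ k ≠ 0 ∧ k ≠ 1 := by
      simp at hk; omega
    rcases (hb ⟨k, h5.1⟩).1 h with h | h
    · exact h5.2.1 (congrArg Fin.val h)
    · exact h5.2.2 (congrArg Fin.val h)
  have hmem : ∀ d, d ∈ openDarts (insert (tile g) R) ↔
      (d ∈ p ∨ d = g * r ^ 2 ∨ d = g * r ^ 3 ∨ d = g * r ^ 4) := by
    intro d
    rw [mem_openDarts_insert]
    have h1 : (∃ k : Fin 5, tile (g * r ^ (k : ℕ) * s) ∉ R ∧ d = g * r ^ (k : ℕ)) ↔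
        d = g * r ^ 2 ∨ d = g * r ^ 3 ∨ d = g * r ^ 4 := by
      simp only [hb]
      simp [Fin.exists_fin_succ]
    have h2 : (d ∈ openDarts R ∧ ∀ k : Fin 5, d ≠ g * r ^ (k : ℕ) * s) ↔ d ∈ p := by
      rw [← hp.mem_iff, List.mem_cons, List.mem_cons]
      constructor
      · rintro ⟨h | h | h, h'⟩
        · exact absurd h (by simpa using h' 1)
        · exact absurd h (by simpa using h' 0)
        · exact h
      · intro h
        refine ⟨.inr (.inr h), ?_⟩
        rintro k rfl
        have := (mem_openDarts.1 ((hp.mem_iff _).1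
          (List.mem_cons_of_mem _ (List.mem_cons_of_mem _ h)))).1
        rw [hb] at this
        rcases this with rfl | rfl
        · exact hgsp (by simpa using h)
        · exact hgrsp.2 (by simpa using h)
    rw [h1, h2]
  have hpo : ∀ d ∈ p, tile (d * s) ∉ insert (tile g) R := fun d hd =>
    (mem_openDarts.1 ((hmem d).2 (.inl hd))).2
  have hpR : ∀ d ∈ p, tile d ∈ R := fun d hd =>
    (mem_openDarts.1 ((hp.mem_iff d).1 (List.mem_cons_of_mem _ (List.mem_cons_of_mem _ hd)))).1
  have hdl : DimerList ([g * r ^ 2, g * r ^ 3, g * r ^ 4] ++ p)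
      (patchState (insert (tile g) R)) := by
    have h1 : DimerList ([g * r ^ 2, g * r ^ 3, g * r ^ 4] ++ [g, g * r]) _ :=
      DimerList.rotate (l := [g, g * r]) (pentagon_dimerList_pow g)
    have h2 := h1.tensor hp.dimers (by
      intro d hd hd'
      have h3 : tile d = tile g := by
        simp only [List.cons_append, List.nil_append, List.mem_cons, List.not_mem_nil,
          or_false] at hd
        rcases hd with rfl | rfl | rfl | rfl | rfl
        · exact tile_mul_r_pow g _
        · exact tile_mul_r_pow g _
        · exact tile_mul_r_pow g _
        · rfl
        · exact tile_mul_r g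
      exact hg (h3 ▸ (mem_openDarts.1 ((hp.mem_iff d).1 hd')).1))
    have h3 := DimerList.contract (p := [g * r ^ 2, g * r ^ 3, g * r ^ 4, g]) h2
    have h4 := (DimerList.contract (p := [g * r ^ 2, g * r ^ 3, g * r ^ 4]) h3).smul
      ((Real.sqrt 2 ^ 2 : ℝ) : ℂ)
    convert h4 using 1
    funext b
    exact patchState_corner hg hb b
  refine ⟨_, ⟨hdl.nodup, ?_, ?_, ?_⟩, hdl, ?_⟩
  · intro d
    rw [hmem]
    simp only [List.mem_append, List.mem_cons, List.not_mem_nil, or_false]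
    tauto
  · obtain ⟨a, p', rfl⟩ : ∃ a p', p = a :: p' := by
      cases p with
      | nil => simp at hlen
      | cons a p' => exact ⟨a, p', rfl⟩
    have hc2 := hc.2
    rw [List.cons_append, List.isChain_cons_cons] at hc2
    have hlast := isChain_replace_last (Finset.subset_insert _ _) hpo
      (v := g * r * s) (h := g * r ^ 2) (by simp [tile_mul_r]) (hopen 2 (by simp))
      (by rw [mul_s_mul_s, sq, mul_assoc]) hc2.2
    have hfirst := hc2.1.from_glued (Finset.subset_insert (tile g) R) (w := g * r ^ 4)
      (by rw [mul_r_pow_four_mul_r, mul_s_mul_s]) (by simp [hR]) (hpo a (by simp))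
    have step : ∀ k : ℕ, k + 1 ∈ [2, 3, 4] →
        NextOnBoundary (insert (tile g) R) (g * r ^ k) (g * r ^ (k + 1)) := by
      intro k hk
      rw [pow_succ, ← mul_assoc]
      refine nextOnBoundary_mul_r ?_
      rw [mul_assoc g, ← pow_succ]
      exact hopen _ hk
    rw [List.cons_append, Cycle.chain_coe_cons]
    simp only [List.cons_append, List.nil_append, List.isChain_cons_cons] at hlast ⊢
    exact ⟨step 2 (by simp), step 3 (by simp), hfirst, hlast⟩
  · simp only [List.length_append, List.length_cons, List.length_nil] at hlen ⊢
    omega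
  · intro b x
    have hset : openDarts (insert (tile g) R) =
        p.toFinset ∪ {g * r ^ 2, g * r ^ 3, g * r ^ 4} := by
      ext d
      rw [hmem]
      simp only [Finset.mem_union, List.mem_toFinset, Finset.mem_insert, Finset.mem_singleton]
    have hpt : ∀ d : Dart, d ∈ ({g * r ^ 2, g * r ^ 3, g * r ^ 4} : Finset Dart) →
        tile d = tile g := by
      intro d hd
      simp only [Finset.mem_insert, Finset.mem_singleton] at hd
      rcases hd with rfl | rfl | rfl
      all_goals exact tile_mul_r_pow g _
    have hdis : Disjoint p.toFinset ({g * r ^ 2, g * r ^ 3, g * r ^ 4} : Finset Dart) := by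
      rw [Finset.disjoint_left]
      intro d hd hd'
      exact hg (hpt d hd' ▸ hpR d (List.mem_toFinset.1 hd))
    have hS : insert (g * s) (insert (g * r * s) p.toFinset) = openDarts R := by
      ext d
      rw [← hp.mem_iff]
      simp only [Finset.mem_insert, List.mem_toFinset, List.mem_cons]
      tauto
    have hne : ∀ d, tile d ∈ R → d ∉ Set.range fun k : Fin 5 => g * r ^ (k : ℕ) := by
      rintro _ hd ⟨k, rfl⟩
      exact hg (by rwa [← tile_mul_r_pow g k])
    have hgr := sumOver_pentagon_two (b (tile g)) (mul_r_pow_injective g) (v := g * s)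
      (v' := g * r * s) (hne _ hR) (hne _ hR1)
    have hsq : star ((Real.sqrt 2 ^ 2 : ℝ) : ℂ) * ((Real.sqrt 2 ^ 2 : ℝ) : ℂ) = 4 := by
      rw [Real.sq_sqrt (by norm_num), Complex.star_def, Complex.conj_ofReal]
      norm_num
    have hσ : ∀ (z : Bool × Bool) y d, tile d ∈ R → setPair (g * r) (g * r * s) z.2
        (setPair g (g * s) z.1 y) d =
        Function.update (Function.update y (g * s) z.1) (g * r * s) z.2 d := by
      intro z y d hd
      have hdg : d ≠ g := by rintro rfl; exact hg hd
      have hdg1 : d ≠ g * r := by rintro rfl; exact hg1 hd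
      by_cases h1 : d = g * r * s
      · rw [h1, setPair_right, Function.update_self]
      · rw [setPair_of_ne hdg1 h1, Function.update_of_ne h1]
        by_cases h2 : d = g * s
        · rw [h2, setPair_right, Function.update_self]
        · rw [setPair_of_ne hdg h2, Function.update_of_ne h2]
    have main := sumOver_norm_contract (Z := Bool × Bool) hdis (patchState R b)
      (fun y => pentagon (b (tile g)) fun k => y (g * r ^ (k : ℕ)))
      (fun z y => setPair (g * r) (g * r * s) z.2 (setPair g (g * s) z.1 y))
      (fun z y => setPair (g * r) (g * r * s) z.2 (setPair g (g * s) z.1 y))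
      ((Real.sqrt 2 ^ 2 : ℝ) : ℂ) ?_ ?_ ?_ x
    · rw [hset, patchState_corner hg hb]
      refine Eq.trans ?_ main
      congr 1
      funext y
      simp only [Pi.smul_apply, smul_eq_mul, contract, Fintype.sum_prod_type]
    · intro z y y' h
      refine patchState_congr fun d hd => ?_
      have hdR := (mem_openDarts.1 hd).1
      rw [hσ z y d hdR, hσ z y' d hdR]
      have hdd := h d fun hd' => hg (hpt d hd' ▸ hdR)
      simp only [Function.update_apply, hdd]
    · intro z z' y
      rw [hsq]
      have := hgr z z' y
      simp only [Fin.val_zero, pow_zero, mul_one, Fin.val_one, pow_one] at this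
      erw [this]
      split_ifs <;> norm_num
    · intro y
      rw [sumOver_sum, ← hp.norm b y, ← hS,
        sumOver_insert (by
          rw [Finset.mem_insert, not_or, List.mem_toFinset]
          exact ⟨Ne.symm hgrsp.1, hgsp⟩), Fintype.sum_prod_type]
      refine Finset.sum_congr rfl fun z _ => ?_
      rw [sumOver_insert (by simpa using hgrsp.2)]
      refine Finset.sum_congr rfl fun z' _ => ?_
      rw [sumOver_update (by simpa using hgrsp.2), sumOver_update (by simpa using hgsp)]
      refine sumOver_congr fun w _ => ?_
      have : patchState R b (setPair (g * r) (g * r * s) z' (setPair g (g * s) z w)) =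
          patchState R b (Function.update (Function.update w (g * s) z) (g * r * s) z') :=
        patchState_congr fun d hd => hσ (z, z') w d (mem_openDarts.1 hd).1
      simp only [this]

theorem IsPatch.exists_dimerBoundary {R : Finset Tile} (hR : IsPatch R) :
    ∃ l, DimerBoundary R l := by
  induction hR with
  | single t => exact exists_dimerBoundary_single t
  | edge R g _ hg hb ih =>
    obtain ⟨l, hl⟩ := ih
    exact exists_dimerBoundary_edge hg hb hl
  | corner R g _ hg hb hv ih =>
    obtain ⟨l, hl⟩ := ih
    exact exists_dimerBoundary_corner hg hb hv hl

/-! ### The numbering of the boundary -/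

theorem legDart_injective {R : Finset Tile} : Function.Injective (Leg.dart : Leg R → Dart) :=
  fun _ _ h => (legEquiv R).injective (Subtype.ext h)

theorem exists_leg_of_mem_openDarts {R : Finset Tile} {d : Dart} (hd : d ∈ openDarts R) :
    ∃ l : {l : Leg R // l.IsOpen}, l.1.dart = d := by
  rw [mem_openDarts] at hd
  have h : ((legEquiv R).symm ⟨d, hd.1⟩).dart = d := by
    rw [← legEquiv_apply, Equiv.apply_symm_apply]
  exact ⟨⟨(legEquiv R).symm ⟨d, hd.1⟩, by rw [Leg.IsOpen, h]; exact hd.2⟩, h⟩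

theorem leg_mem_openDarts {R : Finset Tile} (l : {l : Leg R // l.IsOpen}) :
    l.1.dart ∈ openDarts R :=
  mem_openDarts.2 ⟨(legEquiv R l.1).2, l.2⟩

/-- The boundary successor is unique, so the constructed cycle, rotated to begin at the leg number
0, agrees entry by entry with the given numbering. This also shows that the boundary is a single
cycle. -/
theorem dimerBoundary_ofFn {R : Finset Tile} (hR : IsPatch R) {N : ℕ}
    (leg : Fin N ≃ {l : Leg R // l.IsOpen})
    (hleg : ∀ k, NextOnBoundary R (leg k).1.dart (leg (finRotate N k)).1.dart) :
    DimerBoundary R (List.ofFn fun k => (leg k).1.dart) := by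
  obtain ⟨l, hl⟩ := hR.exists_dimerBoundary
  have hinj : Function.Injective fun k => (leg k).1.dart := fun k k' h =>
    leg.injective (Subtype.ext (legDart_injective h))
  have hperm : ∀ {l}, DimerBoundary R l → l.Perm (List.ofFn fun k => (leg k).1.dart) := by
    intro l hl
    rw [List.perm_ext_iff_of_nodup hl.nodup (List.nodup_ofFn.2 hinj)]
    intro d
    rw [hl.mem_iff, List.mem_ofFn]
    constructor
    · intro hd
      obtain ⟨l, rfl⟩ := exists_leg_of_mem_openDarts hd
      exact ⟨leg.symm l, by simp⟩
    · rintro ⟨k, rfl⟩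
      exact leg_mem_openDarts _
  have hN : l.length = N := by simpa using (hperm hl).length_eq
  have hN5 : 5 ≤ N := hN ▸ hl.length
  obtain ⟨n, rfl⟩ : ∃ n, N = n + 1 := ⟨N - 1, by omega⟩
  obtain ⟨p, hp⟩ := hl.exists_cons (leg_mem_openDarts (leg 0))
  have hpN : ((leg 0).1.dart :: p).length = n + 1 := by simpa using (hperm hp).length_eq
  have hch := hp.chain
  rw [Cycle.chain_coe_cons] at hch
  have hch' := List.IsChain.left_of_append (l₁ := (leg 0).1.dart :: p) hch
  rw [List.isChain_iff_getElem] at hch'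
  suffices h : (leg 0).1.dart :: p = List.ofFn fun k => (leg k).1.dart by rwa [← h]
  have key : ∀ (i : ℕ) (hi : i < n + 1), ((leg 0).1.dart :: p)[i]'(by omega) =
      (leg ⟨i, hi⟩).1.dart := by
    intro i
    induction i with
    | zero => intro _; rfl
    | succ i ih =>
      intro hi
      have h1 := hch' i (by omega)
      rw [ih (by omega)] at h1
      have h2 := hleg ⟨i, by omega⟩
      have h3 : finRotate (n + 1) ⟨i, by omega⟩ = ⟨i + 1, hi⟩ := finRotate_of_lt (by omega)
      rw [h3] at h2
      exact h1.unique h2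
  refine List.ext_getElem (by simpa using hpN) fun i h1 h2 => ?_
  rw [List.getElem_ofFn]
  exact key i (by simpa using h2)

/-! ### Dimers of the network -/

theorem majorana_mulVec {N : ℕ} (μ : Mode N) (ψ : (Fin N → Bool) → ℂ) (y : Fin N → Bool) :
    (majorana μ *ᵥ ψ) y = (∏ j with j < μ.1, sgn (y j)) * entryXY μ.2 (y μ.1) *
      ψ (flipAt μ.1 y) := by
  obtain ⟨k, t⟩ := μ
  rw [Matrix.mulVec, dotProduct, Finset.sum_eq_single (flipAt k y)]
  · congr 1
    simp only [majorana, tensorOp, Matrix.of_apply]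
    rw [← Finset.mul_prod_erase _ _ (Finset.mem_univ k), mul_comm]
    congr 1
    · rw [Finset.prod_filter, ← Finset.mul_prod_erase Finset.univ _ (Finset.mem_univ k)]
      simp only [lt_self_iff_false, if_false, one_mul]
      refine Finset.prod_congr rfl fun j hj => ?_
      have hjk := (Finset.mem_erase.1 hj).1
      rw [flipAt_of_ne hjk]
      by_cases h : j < k <;> simp [h, hjk, pauliZ]
    · simp only [lt_self_iff_false, if_false, if_true, flipAt_self]
      cases t <;> cases y k <;> simp [pauliX, pauliY, entryXY]
  · intro y' _ hy'
    obtain ⟨j, hj⟩ := Function.ne_iff.1 hy'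
    rw [majorana, tensorOp, Matrix.of_apply, Finset.prod_eq_zero (Finset.mem_univ j), zero_mul]
    by_cases hjk : j = k
    · subst hjk
      rw [flipAt_self] at hj
      have : y j = y' j := by
        cases h1 : y j <;> cases h2 : y' j <;> simp_all
      cases t <;> simp [pauliX, pauliY, this]
    · rw [flipAt_of_ne hjk] at hj
      by_cases h : j < k <;> simp [h, hjk, pauliZ, Ne.symm hj]
  · simp

theorem jwSign_getElem {D : Type*} {l : List D} (hl : l.Nodup) (k : ℕ) (hk : k < l.length)
    (x : D → Bool) : jwSign l l[k] x = signProd (l.take k) x := by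
  have hmem : l[k] ∉ l.take k := by
    intro h
    have h2 := hl
    rw [← List.take_append_drop k l, List.drop_eq_getElem_cons hk] at h2
    exact (List.nodup_append.1 h2).2.2 _ h _ (List.mem_cons_self) rfl
  have key : jwSign (l.take k ++ l[k] :: l.drop (k + 1)) l[k] x = signProd (l.take k) x := by
    rw [jwSign_append_right hmem]
    simp [jwSign]
  rwa [← List.drop_eq_getElem_cons hk, List.take_append_drop] at key

theorem modes_map {D D' : Type*} (f : D → D') (s : Multiset D) :
    modes (s.map f) = (modes s).map (Prod.map f id) := by
  induction s using Multiset.induction_on with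
  | empty => rfl
  | cons a s ih => simp [modes_cons, ih]

theorem modes_univ (N : ℕ) :
    modes (Finset.univ : Finset (Fin N)).val = (Finset.univ : Finset (Fin N × Bool)).val := by
  have h : ∀ s : Multiset (Fin N), modes s = s ×ˢ (Finset.univ : Finset Bool).val := by
    intro s
    induction s using Multiset.induction_on with
    | empty => rfl
    | cons a s ih =>
      rw [modes_cons, Multiset.cons_product, ih, Multiset.cons_swap]
      simp
  exact h _

section

variable {R : Finset Tile} {N : ℕ} (leg : Fin N ≃ {l : Leg R // l.IsOpen})

def boundaryEquiv : Fin N ≃ openDarts R :=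
  leg.trans (Equiv.ofBijective (fun l => ⟨l.1.dart, leg_mem_openDarts l⟩)
    ⟨fun _ _ h => Subtype.ext (legDart_injective (congrArg Subtype.val h)), fun d => by
      obtain ⟨l, hl⟩ := exists_leg_of_mem_openDarts d.2
      exact ⟨l, Subtype.ext hl⟩⟩)

/-- Boundary bits as bits on the darts. -/
def boundaryBits (y : Fin N → Bool) (d : Dart) : Bool :=
  if h : d ∈ openDarts R then y ((boundaryEquiv leg).symm ⟨d, h⟩) else false

theorem boundaryBits_leg (y : Fin N → Bool) (k : Fin N) :
    boundaryBits leg y (leg k).1.dart = y k := by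
  have h : (leg k).1.dart ∈ openDarts R := leg_mem_openDarts _
  rw [boundaryBits, dif_pos h]
  congr 1
  rw [Equiv.symm_apply_eq]
  rfl

/-- Bits on the pentagons of a patch, extended to the tiling. -/
def bulkBits (b : R → Bool) (t : Tile) : Bool := if h : t ∈ R then b ⟨t, h⟩ else false

theorem network_apply (y : Fin N → Bool) (b : R → Bool) :
    network R leg y b = patchState R (bulkBits b) (boundaryBits leg y) := by
  rw [← network_eq_patchState R leg]
  congr
  · funext k
    exact (boundaryBits_leg leg y k).symm
  · funext t
    simp [bulkBits]

theorem AffineBit.bulkBits {f : (Tile → Bool) → Bool} (hf : AffineBit f) :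
    AffineBit fun b : R → Bool => f (bulkBits b) := by
  intro b b'
  have h := hf (Happy.bulkBits b) (Happy.bulkBits b')
  have h1 : (fun t => Bool.xor (Happy.bulkBits b t) (Happy.bulkBits b' t)) =
      Happy.bulkBits fun t => Bool.xor (b t) (b' t) := by
    funext t
    simp only [Happy.bulkBits]
    split_ifs <;> rfl
  have h0 : (Happy.bulkBits fun _ : R => false) = fun _ => false := by
    funext t
    simp [Happy.bulkBits]
  rw [h1] at h
  simp only [h, h0]

theorem majorana_mulVec_network (hl : (List.ofFn fun k => (leg k).1.dart).Nodup) (μ : Mode N)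
    (b : R → Bool) (y : Fin N → Bool) :
    (majorana μ *ᵥ fun x => network R leg x b) y =
      listMajorana (List.ofFn fun k => (leg k).1.dart) ((leg μ.1).1.dart, μ.2)
        (patchState R (bulkBits b)) (boundaryBits leg y) := by
  rw [majorana_mulVec, listMajorana, network_apply, boundaryBits_leg]
  congr 1
  · congr 1
    have h := jwSign_getElem hl μ.1 (by simp) (boundaryBits leg y)
    rw [List.getElem_ofFn] at h
    simp only [Fin.eta] at h
    rw [h, signProd, List.map_take, List.map_ofFn, List.prod_take_ofFn]
    refine Finset.prod_congr (by ext; simp) fun j _ => ?_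
    simp [boundaryBits_leg]
  · refine patchState_congr fun d hd => ?_
    obtain ⟨k, hk⟩ := (boundaryEquiv leg).surjective ⟨d, hd⟩
    obtain rfl : (leg k).1.dart = d := congrArg Subtype.val hk
    by_cases h : k = μ.1
    · subst h
      rw [boundaryBits_leg, flipAt_self, flipAt_self, boundaryBits_leg]
    · rw [boundaryBits_leg, flipAt_of_ne h, flipAt_of_ne, boundaryBits_leg]
      exact fun h' => h (leg.injective (Subtype.ext (legDart_injective h')))

/-- All that is used later about the tiling and the pentagons: common dimers of all code states,
affine parities and normalization. -/
theorem exists_dimerDiagram (hR : IsPatch R)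
    (hleg : ∀ k, NextOnBoundary R (leg k).1.dart (leg (finRotate N k)).1.dart) :
    ∃ d : DimerDiagram N R, d.Describes (network R leg) ∧
      (∀ k, AffineBit fun b => d.parity b k) ∧
      ∀ b, ∑ x, star (network R leg x b) * network R leg x b = 1 := by
  have hB := dimerBoundary_ofFn hR leg hleg
  have hnd := hB.nodup
  let Rl : Fin N × Bool → Fin N × Bool → Prop := fun μ ν =>
    ∃ f : (R → Bool) → Bool, AffineBit f ∧
      ∀ b, HasDimer (fun x => network R leg x b) μ ν (f b)
  have hN : Nonempty (Fin N) := by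
    have := hB.length
    rw [List.length_ofFn] at this
    exact ⟨⟨0, by omega⟩⟩
  have hinj : Function.Injective fun k => (leg k).1.dart := List.nodup_ofFn.1 hnd
  have hm : Matched Rl (Finset.univ : Finset (Fin N × Bool)).val := by
    have h1 := hB.dimers.matched
    have h2 := h1.map (Rl' := Rl)
      (Prod.map (Function.invFun fun k => (leg k).1.dart) id) ?_
    · rw [← modes_map] at h2
      convert h2
      rw [← modes_univ]
      congr 1
      rw [Multiset.map_coe, List.map_ofFn]
      have : (Function.invFun fun k => (leg k).1.dart) ∘ (fun k => (leg k).1.dart) = id :=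
        Function.invFun_comp hinj
      rw [this]
      simp [List.ofFn_id]
      rfl
    · rintro ⟨d, t⟩ hd ⟨d', t'⟩ hd' ⟨f, hf, h⟩
      rw [mem_modes, Multiset.mem_coe, List.mem_ofFn] at hd hd'
      obtain ⟨k, rfl⟩ := hd
      obtain ⟨k', rfl⟩ := hd'
      refine ⟨_, hf.bulkBits, fun b => ?_⟩
      change HasDimer _ (Function.invFun (fun k => (leg k).1.dart) (leg k).1.dart, t)
        (Function.invFun (fun k => (leg k).1.dart) (leg k').1.dart, t') _
      have e : ∀ k, Function.invFun (fun k => (leg k).1.dart) (leg k).1.dart = k :=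
        Function.leftInverse_invFun hinj
      rw [e, e, HasDimer]
      funext y
      rw [Matrix.add_mulVec, Matrix.smul_mulVec, Pi.add_apply, Pi.smul_apply,
        majorana_mulVec_network leg hnd, majorana_mulVec_network leg hnd]
      have := congrFun (h (bulkBits b)) (boundaryBits leg y)
      simp only at this
      rw [this]
      simp
  obtain ⟨e, he⟩ := hm.exists_equiv
  choose f hf hd using he
  refine ⟨⟨e, fun b k => f k b⟩, fun b k => hd k b, hf, fun b => ?_⟩
  rw [← hB.norm (bulkBits b) fun _ => false, sumOver_equiv (boundaryEquiv leg)]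
  refine Finset.sum_congr (by ext; simp) fun y _ => ?_
  rw [network_apply]
  rfl

end

/-! ### Product operators -/

section TensorOp

variable {ι : Type*} [Fintype ι]

theorem tensorOp_mul [DecidableEq ι] (x y : ι → Matrix Bool Bool ℂ) :
    tensorOp x * tensorOp y = tensorOp fun j => x j * y j := by
  ext s t
  simp only [tensorOp, Matrix.mul_apply, Matrix.of_apply, ← Finset.prod_mul_distrib]
  rw [Finset.prod_univ_sum, Fintype.piFinset_univ]

theorem tensorOp_one : tensorOp (fun _ : ι => (1 : Matrix Bool Bool ℂ)) = 1 := by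
  ext s t
  simp only [tensorOp, Matrix.of_apply, Matrix.one_apply]
  by_cases h : s = t
  · simp [h]
  · obtain ⟨j, hj⟩ := Function.ne_iff.1 h
    rw [if_neg h, Finset.prod_eq_zero (Finset.mem_univ j)]
    simp [hj]

theorem tensorOp_conjTranspose (x : ι → Matrix Bool Bool ℂ) :
    (tensorOp x)ᴴ = tensorOp fun j => (x j)ᴴ := by
  ext s t
  simp [tensorOp, Matrix.conjTranspose_apply]

theorem tensorOp_smul (c : ι → ℂ) (x : ι → Matrix Bool Bool ℂ) :
    tensorOp (fun j => c j • x j) = (∏ j, c j) • tensorOp x := by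
  ext s t
  simp [tensorOp, Finset.prod_mul_distrib]

theorem pauliZ_mul_pauliZ : pauliZ * pauliZ = 1 := by
  ext s t
  cases s <;> cases t <;> simp [pauliZ, sgn]

theorem pauliZ_conjTranspose : pauliZᴴ = pauliZ := by
  ext s t
  cases s <;> cases t <;> simp [pauliZ, sgn]

/-- `X` or `Y`. -/
def pauliXY (t : Bool) : Matrix Bool Bool ℂ := if t then pauliY else pauliX

theorem pauliXY_mul_self (t : Bool) : pauliXY t * pauliXY t = 1 := by
  ext u v
  cases t <;> cases u <;> cases v <;> simp [pauliXY, pauliX, pauliY, Matrix.mul_apply]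

theorem pauliXY_conjTranspose (t : Bool) : (pauliXY t)ᴴ = pauliXY t := by
  ext u v
  cases t <;> cases u <;> cases v <;> simp [pauliXY, pauliX, pauliY]

theorem pauliXY_mul_pauliZ (t : Bool) : pauliXY t * pauliZ = -(pauliZ * pauliXY t) := by
  ext u v
  cases t <;> cases u <;> cases v <;> simp [pauliXY, pauliX, pauliY, pauliZ, sgn]

theorem pauliXY_anticomm {t t' : Bool} (h : t ≠ t') :
    pauliXY t * pauliXY t' = -(pauliXY t' * pauliXY t) := by
  ext u v
  cases t <;> cases t' <;> cases u <;> cases v <;>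
    simp [pauliXY, pauliX, pauliY, Matrix.mul_apply] at h ⊢

end TensorOp

/-! ### Majorana operators of an ordered register -/

section JordanWigner

variable {ι : Type*} [Fintype ι] [LinearOrder ι]

/-- The factors of a Jordan–Wigner Majorana operator. -/
def jwSite (μ : ι × Bool) (j : ι) : Matrix Bool Bool ℂ :=
  if j < μ.1 then pauliZ else if j = μ.1 then pauliXY μ.2 else 1

/-- The Jordan–Wigner Majorana operators of an ordered register. -/
def jwOp (μ : ι × Bool) : Matrix (ι → Bool) (ι → Bool) ℂ := tensorOp (jwSite μ)

theorem majorana_eq_jwOp {N : ℕ} (μ : Mode N) : majorana μ = jwOp μ := by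
  rw [majorana, jwOp]
  congr 1

theorem jwOp_mul_self (μ : ι × Bool) : jwOp μ * jwOp μ = 1 := by
  rw [jwOp, tensorOp_mul, ← tensorOp_one]
  congr 1
  funext j
  rw [jwSite]
  split_ifs
  · exact pauliZ_mul_pauliZ
  · exact pauliXY_mul_self _
  · simp

theorem jwOp_conjTranspose (μ : ι × Bool) : (jwOp μ)ᴴ = jwOp μ := by
  rw [jwOp, tensorOp_conjTranspose]
  congr 1
  funext j
  rw [jwSite]
  split_ifs
  · exact pauliZ_conjTranspose
  · exact pauliXY_conjTranspose _
  · simp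

theorem jwOp_anticomm_of_le {μ ν : ι × Bool} (h : μ ≠ ν) (hle : μ.1 ≤ ν.1) :
    jwOp μ * jwOp ν = -(jwOp ν * jwOp μ) := by
  obtain ⟨k, t⟩ := μ
  obtain ⟨l, t'⟩ := ν
  rw [jwOp, jwOp, tensorOp_mul, tensorOp_mul]
  have key : (fun j => jwSite (k, t) j * jwSite (l, t') j) = fun j =>
      (if j = k then (-1 : ℂ) else 1) • (jwSite (l, t') j * jwSite (k, t) j) := by
    funext j
    simp only [jwSite]
    rcases lt_trichotomy j k with hj | rfl | hj
    · have : j < l := lt_of_lt_of_le hj hle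
      simp [hj, this, hj.ne]
    · rcases lt_or_eq_of_le hle with hl | hl
      · simp at hl
        simp [hl, pauliXY_mul_pauliZ]
      · simp at hl
        subst hl
        have : t ≠ t' := fun hh => h (by rw [hh])
        simp [pauliXY_anticomm this]
    · simp [hj.not_gt, hj.ne']
  rw [key, tensorOp_smul]
  simp

theorem jwOp_anticomm {μ ν : ι × Bool} (h : μ ≠ ν) : jwOp μ * jwOp ν = -(jwOp ν * jwOp μ) := by
  rcases le_total μ.1 ν.1 with hle | hle
  · exact jwOp_anticomm_of_le h hle
  · rw [jwOp_anticomm_of_le h.symm hle, neg_neg]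

/-- The parity operator `-i γ_μ γ_ν` of two modes of a register. -/
def jwPair (μ ν : ι × Bool) : Matrix (ι → Bool) (ι → Bool) ℂ := (-Complex.I) • (jwOp μ * jwOp ν)

theorem jwPair_mul_self {μ ν : ι × Bool} (h : μ ≠ ν) : jwPair μ ν * jwPair μ ν = 1 := by
  have : jwOp μ * jwOp ν * (jwOp μ * jwOp ν) = -1 := by
    nth_rewrite 1 [jwOp_anticomm h]
    rw [neg_mul, mul_assoc, ← mul_assoc (jwOp μ), jwOp_mul_self, one_mul,
      jwOp_mul_self]
  rw [jwPair, smul_mul_smul_comm, this, neg_mul_neg, Complex.I_mul_I]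
  simp

theorem jwPair_conjTranspose {μ ν : ι × Bool} (h : μ ≠ ν) : (jwPair μ ν)ᴴ = jwPair μ ν := by
  rw [jwPair, Matrix.conjTranspose_smul, Matrix.conjTranspose_mul, jwOp_conjTranspose,
    jwOp_conjTranspose, jwOp_anticomm h.symm]
  simp

theorem jwPair_mul_jwOp {μ ν ρ : ι × Bool} (h : μ ≠ ρ) (h' : ν ≠ ρ) :
    jwPair μ ν * jwOp ρ = jwOp ρ * jwPair μ ν := by
  rw [jwPair, smul_mul_assoc, mul_smul_comm, mul_assoc, jwOp_anticomm h', mul_neg, ← mul_assoc,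
    jwOp_anticomm h, neg_mul, neg_neg, mul_assoc]

theorem jwPair_mul_jwOp_left {μ ν : ι × Bool} (h : μ ≠ ν) :
    jwPair μ ν * jwOp μ = -(jwOp μ * jwPair μ ν) := by
  rw [jwPair, smul_mul_assoc, mul_smul_comm, mul_assoc, jwOp_anticomm h.symm, mul_neg, smul_neg]

theorem jwPair_comm {μ ν ρ τ : ι × Bool} (h1 : μ ≠ ρ) (h2 : ν ≠ ρ) (h3 : μ ≠ τ) (h4 : ν ≠ τ) :
    jwPair μ ν * jwPair ρ τ = jwPair ρ τ * jwPair μ ν := by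
  conv_lhs => rw [jwPair.eq_1 ρ τ]
  conv_rhs => rw [jwPair.eq_1 ρ τ]
  rw [mul_smul_comm, smul_mul_assoc, ← mul_assoc, jwPair_mul_jwOp h1 h2, mul_assoc,
    jwPair_mul_jwOp h3 h4, mul_assoc]

end JordanWigner

/-! ### States as matrices between a region and its complement -/

section Bipartite

variable {ι : Type*} [Fintype ι] [DecidableEq ι] (A : Finset ι)

/-- Configurations of a register, as pairs of configurations of a region and its complement. -/
def splitEquiv : (ι → Bool) ≃ (A → Bool) × ((Aᶜ : Finset ι) → Bool) where
  toFun x := (fun k => x k, fun k => x k)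
  invFun u q := if h : q ∈ A then u.1 ⟨q, h⟩ else u.2 ⟨q, Finset.mem_compl.2 h⟩
  left_inv x := by funext q; by_cases h : q ∈ A <;> simp [h]
  right_inv u := by
    ext k
    · simp
    · have := Finset.mem_compl.1 k.2
      simp [this]

/-- The matrix of amplitudes of a state between a region and its complement. -/
def stateMatrix (ψ : (ι → Bool) → ℂ) : Matrix (A → Bool) ((Aᶜ : Finset ι) → Bool) ℂ :=
  Matrix.of fun u v => ψ ((splitEquiv A).symm (u, v))

variable {A}

theorem splitEquiv_symm_mem (u : (A → Bool) × ((Aᶜ : Finset ι) → Bool)) (k : A) :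
    (splitEquiv A).symm u k = u.1 k := by
  simp [splitEquiv]

theorem splitEquiv_symm_compl (u : (A → Bool) × ((Aᶜ : Finset ι) → Bool))
    (k : (Aᶜ : Finset ι)) : (splitEquiv A).symm u k = u.2 k := by
  have := Finset.mem_compl.1 k.2
  simp [splitEquiv, this]

theorem sum_split (f : (ι → Bool) → ℂ) :
    ∑ x, f x = ∑ u, ∑ v, f ((splitEquiv A).symm (u, v)) := by
  rw [← Fintype.sum_prod_type', ← Equiv.sum_comp (splitEquiv A).symm]

theorem stateMatrix_injective : Function.Injective (stateMatrix A) := by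
  intro ψ φ h
  funext x
  have := congrFun (congrFun h (splitEquiv A x).1) (splitEquiv A x).2
  simpa [stateMatrix] using this

theorem stateMatrix_smul (c : ℂ) (ψ : (ι → Bool) → ℂ) :
    stateMatrix A (c • ψ) = c • stateMatrix A ψ := rfl

theorem stateMatrix_extendOp (X : Matrix (A → Bool) (A → Bool) ℂ) (ψ : (ι → Bool) → ℂ) :
    stateMatrix A (extendOp A X *ᵥ ψ) = X * stateMatrix A ψ := by
  ext u v
  rw [stateMatrix, Matrix.of_apply, Matrix.mulVec, dotProduct, sum_split (A := A),
    Matrix.mul_apply]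
  refine Finset.sum_congr rfl fun u' _ => ?_
  rw [Finset.sum_eq_single v]
  · rw [extendOp, Matrix.of_apply, if_pos]
    · simp [splitEquiv_symm_mem, stateMatrix]
    · intro q hq
      have h1 := splitEquiv_symm_compl (u, v) ⟨q, Finset.mem_compl.2 hq⟩
      have h2 := splitEquiv_symm_compl (u', v) ⟨q, Finset.mem_compl.2 hq⟩
      simp only at h1 h2
      rw [h1, h2]
  · intro v' _ hv
    rw [extendOp, Matrix.of_apply, if_neg, zero_mul]
    intro h
    apply hv
    funext k
    have := h k (Finset.mem_compl.1 k.2)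
    rw [splitEquiv_symm_compl, splitEquiv_symm_compl] at this
    exact this.symm
  · simp

theorem stateMatrix_extendOp_compl (Y : Matrix ((Aᶜ : Finset ι) → Bool) ((Aᶜ : Finset ι) → Bool) ℂ)
    (ψ : (ι → Bool) → ℂ) :
    stateMatrix A (extendOp Aᶜ Y *ᵥ ψ) = stateMatrix A ψ * Yᵀ := by
  ext u v
  rw [stateMatrix, Matrix.of_apply, Matrix.mulVec, dotProduct, sum_split (A := A),
    Matrix.mul_apply, Finset.sum_comm]
  refine Finset.sum_congr rfl fun v' _ => ?_
  rw [Finset.sum_eq_single u]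
  · rw [extendOp, Matrix.of_apply, if_pos]
    · simp [splitEquiv_symm_compl, stateMatrix, mul_comm]
    · intro q hq
      rw [Finset.mem_compl, not_not] at hq
      have h1 := splitEquiv_symm_mem (u, v) ⟨q, hq⟩
      have h2 := splitEquiv_symm_mem (u, v') ⟨q, hq⟩
      simp only at h1 h2
      rw [h1, h2]
  · intro u' _ hu
    rw [extendOp, Matrix.of_apply, if_neg, zero_mul]
    intro h
    apply hu
    funext k
    have := h k (by simp)
    rw [splitEquiv_symm_mem, splitEquiv_symm_mem] at this
    exact this.symm
  · simp

theorem stateMatrix_tensorOp (x : ι → Matrix Bool Bool ℂ) (ψ : (ι → Bool) → ℂ) :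
    stateMatrix A (tensorOp x *ᵥ ψ) =
      tensorOp (fun k : A => x k) * stateMatrix A ψ *
        (tensorOp fun k : (Aᶜ : Finset ι) => x k)ᵀ := by
  ext u v
  rw [stateMatrix, Matrix.of_apply, Matrix.mulVec, dotProduct, sum_split (A := A),
    Matrix.mul_apply, Finset.sum_comm]
  refine Finset.sum_congr rfl fun v' _ => ?_
  rw [Matrix.mul_apply, Finset.sum_mul]
  refine Finset.sum_congr rfl fun u' _ => ?_
  simp only [tensorOp, Matrix.of_apply, Matrix.transpose_apply]
  have h1 : ∏ q, x q ((splitEquiv A).symm (u, v) q) ((splitEquiv A).symm (u', v') q) =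
      (∏ k : A, x k (u k) (u' k)) * ∏ k : (Aᶜ : Finset ι), x k (v k) (v' k) := by
    rw [← Finset.prod_mul_prod_compl A]
    congr 1
    · rw [← Finset.prod_coe_sort]
      simp only [splitEquiv_symm_mem]
    · rw [← Finset.prod_coe_sort]
      simp only [splitEquiv_symm_compl]
  rw [h1, stateMatrix, Matrix.of_apply]
  ring

theorem localProduct_mulVec {N : ℕ} {Q Q' : Type*} (A : Finset (Fin N))
    (U : Matrix Q (A → Bool) ℂ) (U' : Matrix Q' ((Aᶜ : Finset (Fin N)) → Bool) ℂ)
    (ψ : (Fin N → Bool) → ℂ) (q : Q × Q') :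
    (localProduct A U U' *ᵥ ψ) q = (U * stateMatrix A ψ * U'ᵀ) q.1 q.2 := by
  rw [Matrix.mulVec, dotProduct, sum_split (A := A), Matrix.mul_apply, Finset.sum_comm]
  refine Finset.sum_congr rfl fun v _ => ?_
  rw [Matrix.mul_apply, Finset.sum_mul]
  refine Finset.sum_congr rfl fun u _ => ?_
  simp only [localProduct, Matrix.of_apply, Matrix.transpose_apply, splitEquiv_symm_mem,
    splitEquiv_symm_compl, stateMatrix]
  ring

end Bipartite

/-! ### Complete systems of commuting parity operators -/

section Orthonormal

variable {α Q : Type*} [Fintype α]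

/-- The matrix that maps the vectors of an orthonormal family to basis vectors. -/
def frame (u : Q → α → ℂ) : Matrix Q α ℂ := Matrix.of fun q x => star (u q x)

theorem frame_mulVec (u : Q → α → ℂ) (w : α → ℂ) (q : Q) :
    (frame u *ᵥ w) q = star (u q) ⬝ᵥ w := rfl

variable [Fintype Q] [DecidableEq Q]

/-- An orthonormal family of vectors. -/
def IsOrtho {α Q : Type*} [Fintype α] [DecidableEq Q] (u : Q → α → ℂ) : Prop :=
  ∀ q q', star (u q) ⬝ᵥ u q' = if q = q' then 1 else 0

theorem IsOrtho.isUnitary {u : Q → α → ℂ} (h : IsOrtho u) (hc : Fintype.card Q = Fintype.card α) :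
    IsUnitary (frame u) := by
  have h1 : frame u * (frame u)ᴴ = 1 := by
    ext q q'
    rw [Matrix.mul_apply, Matrix.one_apply, ← h q q']
    simp [frame, dotProduct]
  have h2 := (Matrix.mul_eq_one_comm_of_card_eq Q α ℂ hc).1 h1
  exact ⟨by convert h1, by convert h2⟩

theorem IsOrtho.eq_sum {u : Q → α → ℂ} (h : IsOrtho u) (hc : Fintype.card Q = Fintype.card α)
    (w : α → ℂ) : w = ∑ q, (star (u q) ⬝ᵥ w) • u q := by
  have h1 := (h.isUnitary hc).2
  calc w = ((frame u)ᴴ * frame u) *ᵥ w := by rw [h1, Matrix.one_mulVec]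
    _ = (frame u)ᴴ *ᵥ (frame u *ᵥ w) := by rw [Matrix.mulVec_mulVec]
    _ = _ := by
      funext x
      rw [Matrix.mulVec, dotProduct, Finset.sum_apply]
      refine Finset.sum_congr rfl fun q _ => ?_
      rw [frame_mulVec]
      simp [frame, mul_comm]

theorem star_dotProduct_self (v : α → ℂ) :
    star v ⬝ᵥ v = ((∑ x, Complex.normSq (v x) : ℝ) : ℂ) := by
  rw [dotProduct, Complex.ofReal_sum]
  exact Finset.sum_congr rfl fun x _ => by
    rw [Complex.normSq_eq_conj_mul_self, Pi.star_apply, Complex.star_def]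

theorem exists_normalize {v : α → ℂ} (hv : v ≠ 0) :
    ∃ c : ℂ, c ≠ 0 ∧ star (c • v) ⬝ᵥ (c • v) = 1 := by
  have hx0 : 0 < ∑ x, Complex.normSq (v x) := by
    obtain ⟨x, hx⟩ := Function.ne_iff.1 hv
    exact Finset.sum_pos' (fun _ _ => Complex.normSq_nonneg _)
      ⟨x, Finset.mem_univ x, Complex.normSq_pos.2 hx⟩
  have hx := star_dotProduct_self v
  set x := ∑ x, Complex.normSq (v x)
  refine ⟨((Real.sqrt x)⁻¹ : ℝ), ?_, ?_⟩
  · simpa using (Real.sqrt_pos.2 hx0).ne'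
  · rw [star_smul, smul_dotProduct, dotProduct_smul, hx, smul_eq_mul, smul_eq_mul,
      Complex.star_def, Complex.conj_ofReal, ← Complex.ofReal_mul, ← Complex.ofReal_mul,
      ← mul_assoc, ← mul_inv, Real.mul_self_sqrt hx0.le, inv_mul_cancel₀ hx0.ne']
    simp

end Orthonormal

theorem sum_vecMulVec_mulVec {α β S : Type*} [Fintype α] [Fintype β] [Fintype S] [DecidableEq S]
    {f : S → β → ℂ} (hf : IsOrtho f) (g : S → α → ℂ) (s : S) :
    (∑ t, Matrix.vecMulVec (g t) (f t)) *ᵥ star (f s) = g s := by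
  rw [Matrix.sum_mulVec]
  simp only [Matrix.vecMulVec_mulVec]
  rw [Finset.sum_eq_single s]
  · rw [dotProduct_comm, hf s s]
    simp
  · intro t _ ht
    rw [dotProduct_comm, hf s t, if_neg (Ne.symm ht)]
    simp
  · simp

theorem eq_of_sum_vecMulVec_eq {α β S : Type*} [Fintype α] [Fintype β] [Fintype S] [DecidableEq S]
    {f : S → β → ℂ} (hf : IsOrtho f) {g g' : S → α → ℂ}
    (h : ∑ t, Matrix.vecMulVec (g t) (f t) = ∑ t, Matrix.vecMulVec (g' t) (f t)) : g = g' := by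
  funext s
  rw [← sum_vecMulVec_mulVec hf g s, h, sum_vecMulVec_mulVec hf]

theorem eq_of_sum_vecMulVec_eq' {α β S : Type*} [Fintype α] [Fintype β] [Fintype S] [DecidableEq S]
    {g : S → α → ℂ} (hg : IsOrtho g) {f f' : S → β → ℂ}
    (h : ∑ t, Matrix.vecMulVec (g t) (f t) = ∑ t, Matrix.vecMulVec (g t) (f' t)) : f = f' := by
  refine eq_of_sum_vecMulVec_eq hg ?_
  have := congrArg Matrix.transpose h
  simpa only [Matrix.transpose_sum, Matrix.transpose_vecMulVec] using this

theorem mul_sum_vecMulVec {α α' β S : Type*} [Fintype α] [Fintype S] (P : Matrix α' α ℂ)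
    (g : S → α → ℂ) (f : S → β → ℂ) :
    P * ∑ s, Matrix.vecMulVec (g s) (f s) = ∑ s, Matrix.vecMulVec (P *ᵥ g s) (f s) := by
  rw [Matrix.mul_sum]
  exact Finset.sum_congr rfl fun s _ => Matrix.mul_vecMulVec _ _ _

theorem sum_vecMulVec_mul {α β β' S : Type*} [Fintype β] [Fintype S] (P : Matrix β' β ℂ)
    (g : S → α → ℂ) (f : S → β → ℂ) :
    (∑ s, Matrix.vecMulVec (g s) (f s)) * Pᵀ = ∑ s, Matrix.vecMulVec (g s) (P *ᵥ f s) := by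
  rw [Matrix.sum_mul]
  refine Finset.sum_congr rfl fun s _ => ?_
  rw [Matrix.vecMulVec_mul, Matrix.vecMul_transpose]

/-- Commuting parity operators whose joint eigenspaces are lines, with operators that flip them
one by one. -/
structure ParitySystem (J α : Type*) [Fintype J] [Fintype α] [DecidableEq α] where
  P : J → Matrix α α ℂ
  flip : J → Matrix α α ℂ
  P_sq : ∀ j, P j * P j = 1
  P_herm : ∀ j, (P j)ᴴ = P j
  P_comm : ∀ j k, P j * P k = P k * P j
  flip_sq : ∀ j, flip j * flip j = 1
  flip_herm : ∀ j, (flip j)ᴴ = flip j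
  anti : ∀ j, P j * flip j = -(flip j * P j)
  flip_comm : ∀ j k, j ≠ k → P k * flip j = flip j * P k
  card : 2 ^ Fintype.card J = Fintype.card α

namespace ParitySystem

variable {J α : Type*} [Fintype J] [Fintype α] [DecidableEq α]
  (S : ParitySystem J α)

/-- The joint eigenvectors of the parity operators with the signs `σ`. -/
def IsEigen (σ : J → Bool) (v : α → ℂ) : Prop := ∀ j, S.P j *ᵥ v = sgn (σ j) • v

variable {S}

theorem IsEigen.smul {σ : J → Bool} {v : α → ℂ} (h : S.IsEigen σ v) (c : ℂ) :
    S.IsEigen σ (c • v) := fun j => by rw [Matrix.mulVec_smul, h j, smul_comm]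

theorem star_dotProduct_P (j : J) (v w : α → ℂ) :
    star v ⬝ᵥ (S.P j *ᵥ w) = star (S.P j *ᵥ v) ⬝ᵥ w := by
  rw [Matrix.star_mulVec, S.P_herm, Matrix.dotProduct_mulVec]

theorem IsEigen.dotProduct_P {σ : J → Bool} {v : α → ℂ} (h : S.IsEigen σ v) (j : J) (w : α → ℂ) :
    star v ⬝ᵥ (S.P j *ᵥ w) = sgn (σ j) * (star v ⬝ᵥ w) := by
  rw [star_dotProduct_P, h j, star_smul, smul_dotProduct, star_sgn, smul_eq_mul]

theorem IsEigen.ortho {σ τ : J → Bool} {v w : α → ℂ} (hv : S.IsEigen σ v) (hw : S.IsEigen τ w)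
    (h : σ ≠ τ) : star v ⬝ᵥ w = 0 := by
  obtain ⟨j, hj⟩ := Function.ne_iff.1 h
  have h1 := hv.dotProduct_P j w
  rw [hw j, dotProduct_smul, smul_eq_mul] at h1
  have h2 : (sgn (τ j) - sgn (σ j)) * (star v ⬝ᵥ w) = 0 := by rw [sub_mul, h1, sub_self]
  rcases mul_eq_zero.1 h2 with h3 | h3
  · exact absurd (sgn_injective (sub_eq_zero.1 h3)).symm hj
  · exact h3

theorem flip_mulVec_ne_zero (j : J) {v : α → ℂ} (hv : v ≠ 0) : S.flip j *ᵥ v ≠ 0 := by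
  intro h
  apply hv
  rw [← Matrix.one_mulVec v, ← S.flip_sq j, ← Matrix.mulVec_mulVec, h, Matrix.mulVec_zero]

variable [DecidableEq J]

/-- The signs are imposed one at a time by the projection `1 ± P j`. If it annihilates the vector,
the vector has the opposite sign throughout, and `flip j` corrects it without disturbing the signs
already reached. -/
theorem exists_eigen_ne_zero [Nonempty α] (σ : J → Bool) : ∃ v, v ≠ 0 ∧ S.IsEigen σ v := by
  have key : ∀ s : Finset J, ∃ v : α → ℂ, v ≠ 0 ∧ ∀ j ∈ s, S.P j *ᵥ v = sgn (σ j) • v := by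
    intro s
    induction s using Finset.induction_on with
    | empty => exact ⟨fun _ => 1, fun h => one_ne_zero (congrFun h (Classical.arbitrary α)), by simp⟩
    | insert j s hj ih =>
      obtain ⟨v, hv, h⟩ := ih
      by_cases h0 : v + sgn (σ j) • S.P j *ᵥ v = 0
      · refine ⟨S.flip j *ᵥ v, flip_mulVec_ne_zero j hv, ?_⟩
        have h1 : S.P j *ᵥ v = -(sgn (σ j) • v) := by
          have h2 := congrArg (fun w => sgn (σ j) • w) h0
          simp only [smul_add, smul_zero, smul_smul, sgn_mul_self, one_smul] at h2
          exact eq_neg_of_add_eq_zero_right h2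
        intro k hk
        rcases Finset.mem_insert.1 hk with rfl | hk
        · rw [Matrix.mulVec_mulVec, S.anti, Matrix.neg_mulVec, ← Matrix.mulVec_mulVec, h1,
            Matrix.mulVec_neg, neg_neg, Matrix.mulVec_smul]
        · rw [Matrix.mulVec_mulVec, S.flip_comm j k (fun h => hj (h ▸ hk)), ← Matrix.mulVec_mulVec,
            h k hk, Matrix.mulVec_smul]
      · refine ⟨_, h0, ?_⟩
        intro k hk
        rw [Matrix.mulVec_add, Matrix.mulVec_smul, Matrix.mulVec_mulVec]
        rcases Finset.mem_insert.1 hk with rfl | hk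
        · rw [S.P_sq, Matrix.one_mulVec, smul_add, smul_smul, sgn_mul_self, one_smul, add_comm]
        · rw [S.P_comm, ← Matrix.mulVec_mulVec, h k hk, Matrix.mulVec_smul, smul_add, smul_comm]
  obtain ⟨v, hv, h⟩ := key Finset.univ
  exact ⟨v, hv, fun j => h j (Finset.mem_univ j)⟩

theorem exists_basis [Nonempty α] :
    ∃ v : (J → Bool) → α → ℂ, (∀ σ, S.IsEigen σ (v σ)) ∧ IsOrtho v := by
  have h : ∀ σ : J → Bool, ∃ v, S.IsEigen σ v ∧ star v ⬝ᵥ v = 1 := by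
    intro σ
    obtain ⟨v, hv, h⟩ := exists_eigen_ne_zero (S := S) σ
    obtain ⟨c, -, hc⟩ := exists_normalize hv
    exact ⟨c • v, h.smul c, hc⟩
  choose v hv hn using h
  refine ⟨v, hv, fun σ τ => ?_⟩
  split_ifs with hστ
  · rw [← hστ, hn]
  · exact (hv σ).ortho (hv τ) hστ

theorem card_eq (S : ParitySystem J α) : Fintype.card (J → Bool) = Fintype.card α := by
  rw [← S.card]; simp

/-- There are as many sign patterns as dimensions, so every joint eigenspace is a line. -/
theorem IsEigen.eq_smul {v : (J → Bool) → α → ℂ} (hv : ∀ σ, S.IsEigen σ (v σ)) (ho : IsOrtho v)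
    {σ : J → Bool} {w : α → ℂ} (hw : S.IsEigen σ w) : w = (star (v σ) ⬝ᵥ w) • v σ := by
  conv_lhs => rw [ho.eq_sum S.card_eq w]
  rw [Finset.sum_eq_single σ]
  · intro τ _ hτ
    rw [(hv τ).ortho hw hτ, zero_smul]
  · simp

theorem IsEigen.flip {σ : J → Bool} {v : α → ℂ} (h : S.IsEigen σ v) (j : J) :
    S.IsEigen (Function.update σ j (!σ j)) (S.flip j *ᵥ v) := by
  intro k
  rw [Matrix.mulVec_mulVec]
  by_cases hk : k = j
  · subst hk
    rw [S.anti, Matrix.neg_mulVec, ← Matrix.mulVec_mulVec, h k, Function.update_self, sgn_not,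
      Matrix.mulVec_smul, neg_smul]
  · rw [S.flip_comm j k (Ne.symm hk), ← Matrix.mulVec_mulVec, h k, Function.update_of_ne hk,
      Matrix.mulVec_smul]

end ParitySystem

/-! ### Schmidt decomposition with respect to parity operators -/

/-- The amplitude of a Bell pair. -/
def bellAmp : ℂ := ((1 / Real.sqrt 2 : ℝ) : ℂ)

theorem star_bellAmp : star bellAmp = bellAmp := by
  rw [bellAmp, Complex.star_def, Complex.conj_ofReal]

theorem bellAmp_mul_self : bellAmp * bellAmp = 1 / 2 := by
  rw [bellAmp, ← Complex.ofReal_mul, div_mul_div_comm, Real.mul_self_sqrt (by norm_num)]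
  norm_num

theorem bellAmp_ne_zero : bellAmp ≠ 0 := by
  intro h
  have := bellAmp_mul_self
  rw [h] at this
  norm_num at this

theorem const_of_flip_invariant {n : ℕ} {E : Type*} {f : (Fin n → Bool) → E}
    (h : ∀ s e, f (Function.update s e (!s e)) = f s) (s t : Fin n → Bool) : f s = f t := by
  have key : ∀ T : Finset (Fin n), f (fun e => if e ∈ T then s e else t e) = f t := by
    intro T
    induction T using Finset.induction_on with
    | empty => simp
    | insert e T he ih =>
      rw [← ih]
      by_cases hst : s e = t e
      · congr 1
        funext e'
        by_cases h' : e' = e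
        · subst h'; simp [hst]
        · simp [h']
      · rw [← h _ e]
        congr 1
        funext e'
        by_cases h' : e' = e
        · subst h'
          simp only [Function.update_self, Finset.mem_insert, true_or, if_true, if_neg he]
          cases h1 : s e' <;> cases h2 : t e' <;> simp_all
        · simp [h']
  have := key Finset.univ
  simpa using this

section Schmidt

variable {α β : Type*} [Fintype α] [DecidableEq α] [Fintype β] [DecidableEq β]

theorem transpose_mulVec_star {P : Matrix β β ℂ} (hP : Pᴴ = P) (v : β → ℂ) :
    Pᵀ *ᵥ star v = star (P *ᵥ v) := by
  rw [Matrix.star_mulVec, hP, Matrix.mulVec_transpose]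

theorem star_mulVec_dotProduct (M : Matrix α α ℂ) (v w : α → ℂ) :
    star (M *ᵥ v) ⬝ᵥ (M *ᵥ w) = star v ⬝ᵥ ((Mᴴ * M) *ᵥ w) := by
  rw [Matrix.star_mulVec, ← Matrix.mulVec_mulVec, Matrix.dotProduct_mulVec (star v)]

variable {X X' : Type*} [Fintype X] [DecidableEq X] [Fintype X'] [DecidableEq X'] {n : ℕ}

/-- The state `Ψ` has fixed parities `p` and `p'` on both sides, and parities on both sides that are
equal up to signs `κ` and maximally uncertain. -/
structure IsEntangled (S : ParitySystem (X ⊕ Fin n) α) (S' : ParitySystem (X' ⊕ Fin n) β)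
    (Ψ : Matrix α β ℂ) (p : X → Bool) (p' : X' → Bool) (κ : Fin n → Bool) : Prop where
  left : ∀ x, S.P (.inl x) * Ψ = sgn (p x) • Ψ
  right : ∀ x, Ψ * (S'.P (.inl x))ᵀ = sgn (p' x) • Ψ
  pair : ∀ e, S.P (.inr e) * Ψ = sgn (κ e) • (Ψ * (S'.P (.inr e))ᵀ)
  cross : ∀ e, ∃ M : Matrix α α ℂ, Mᴴ * M = 1 ∧ M * Ψ * (S'.flip (.inr e))ᵀ = Ψ
  norm : ∑ i, ∑ j, star (Ψ i j) * Ψ i j = 1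

variable {S : ParitySystem (X ⊕ Fin n) α} {S' : ParitySystem (X' ⊕ Fin n) β}
  {Ψ : Matrix α β ℂ} {p : X → Bool} {p' : X' → Bool} {κ : Fin n → Bool}

theorem sum_norm_vecMulVec {T : Type*} [Fintype T] [DecidableEq T] {f : T → β → ℂ}
    (hf : IsOrtho f) (G : T → α → ℂ) (hΨ : Ψ = ∑ s, Matrix.vecMulVec (G s) (f s)) :
    ∑ i, ∑ j, star (Ψ i j) * Ψ i j = ∑ s, star (G s) ⬝ᵥ G s := by
  have h1 : ∀ i j, Ψ i j = ∑ s, G s i * f s j := by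
    intro i j
    rw [hΨ, Matrix.sum_apply]
    rfl
  have h2 : ∀ i, ∑ j, star (Ψ i j) * Ψ i j = ∑ s, star (G s i) * G s i := by
    intro i
    have h3 : ∀ j, star (Ψ i j) * Ψ i j =
        ∑ s, ∑ t, star (G s i) * G t i * (star (f s j) * f t j) := by
      intro j
      rw [h1, star_sum, Finset.sum_mul_sum]
      refine Finset.sum_congr rfl fun s _ => Finset.sum_congr rfl fun t _ => ?_
      rw [star_mul']
      ring
    simp only [h3]
    rw [Finset.sum_comm]
    refine Finset.sum_congr rfl fun s _ => ?_
    rw [Finset.sum_comm, Finset.sum_eq_single s]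
    · rw [← Finset.mul_sum]
      have := hf s s
      rw [dotProduct, if_pos rfl] at this
      simp only [Pi.star_apply] at this
      rw [this, mul_one]
    · intro t _ ht
      rw [← Finset.mul_sum]
      have := hf s t
      rw [dotProduct, if_neg (Ne.symm ht)] at this
      simp only [Pi.star_apply] at this
      rw [this, mul_zero]
    · simp
  simp only [h2]
  rw [Finset.sum_comm]
  rfl

theorem eq_sum_vecMulVec {Q : Type*} [Fintype Q] [DecidableEq Q] {v : Q → β → ℂ} (hv : IsOrtho v)
    (hc : Fintype.card Q = Fintype.card β) (Ψ : Matrix α β ℂ) :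
    Ψ = ∑ q, Matrix.vecMulVec (Ψ *ᵥ star (v q)) (v q) := by
  ext i j
  rw [Matrix.sum_apply]
  have := congrFun (hv.eq_sum hc (Ψ i)) j
  rw [this, Finset.sum_apply]
  refine Finset.sum_congr rfl fun q _ => ?_
  rw [Matrix.vecMulVec_apply, Pi.smul_apply, smul_eq_mul, Matrix.mulVec, dotProduct_comm]

/-- The fixed parities restrict the right factor to eigenvectors `f s` labelled by the pair parities
`s`. Their partners `G s` on the left are eigenvectors for patterns tied to `s`, hence orthogonal.
It remains to see that their norms agree, which follows from the operators in `cross`. -/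
theorem IsEntangled.schmidt [Nonempty β] (h : IsEntangled S S' Ψ p p' κ) :
    ∃ (g : (Fin n → Bool) → α → ℂ) (f : (Fin n → Bool) → β → ℂ), IsOrtho g ∧ IsOrtho f ∧
      (∀ s, S.IsEigen (Sum.elim p fun e => xor (κ e) (s e)) (g s)) ∧
      (∀ s, S'.IsEigen (Sum.elim p' s) (f s)) ∧
      Ψ = bellAmp ^ n • ∑ s, Matrix.vecMulVec (g s) (f s) := by
  obtain ⟨v, hv, ho⟩ := S'.exists_basis
  let f : (Fin n → Bool) → β → ℂ := fun s => v (Sum.elim p' s)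
  have hfe : ∀ s, S'.IsEigen (Sum.elim p' s) (f s) := fun s => hv _
  have hinj : Function.Injective fun s : Fin n → Bool => (Sum.elim p' s : X' ⊕ Fin n → Bool) := by
    intro s t hst
    funext e
    exact congrFun hst (.inr e)
  have hf : IsOrtho f := by
    intro s t
    rw [ho]
    exact if_congr hinj.eq_iff rfl rfl
  let G : (Fin n → Bool) → α → ℂ := fun s => Ψ *ᵥ star (f s)
  have hP : ∀ (j) (σ) (w : β → ℂ), S'.IsEigen σ w →
      (Ψ * (S'.P j)ᵀ) *ᵥ star w = sgn (σ j) • (Ψ *ᵥ star w) := by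
    intro j σ w hw
    rw [← Matrix.mulVec_mulVec, transpose_mulVec_star (S'.P_herm j), hw j, star_smul, star_sgn,
      Matrix.mulVec_smul]
  -- Basis vectors whose signs on `X'` differ from `p'` contribute nothing.
  have hΨ : Ψ = ∑ s, Matrix.vecMulVec (G s) (f s) := by
    conv_lhs => rw [eq_sum_vecMulVec ho S'.card_eq Ψ]
    symm
    refine Finset.sum_of_injOn (fun s => Sum.elim p' s) hinj.injOn (by simp) ?_ fun s _ => rfl
    intro σ _ hσ
    obtain ⟨x, hx⟩ : ∃ x, σ (.inl x) ≠ p' x := by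
      by_contra! hcon
      refine hσ ⟨fun e => σ (.inr e), by simp, ?_⟩
      funext j
      cases j with
      | inl x => exact (hcon x).symm
      | inr e => rfl
    have h1 := hP (.inl x) σ _ (hv σ)
    rw [h.right, Matrix.smul_mulVec] at h1
    have h2 : (sgn (p' x) - sgn (σ (.inl x))) • (Ψ *ᵥ star (v σ)) = 0 := by
      rw [sub_smul, h1, sub_self]
    rcases smul_eq_zero.1 h2 with h3 | h3
    · exact absurd (sgn_injective (sub_eq_zero.1 h3)).symm hx
    · rw [h3, Matrix.zero_vecMulVec]
  have hGe : ∀ s, S.IsEigen (Sum.elim p fun e => xor (κ e) (s e)) (G s) := by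
    intro s j
    cases j with
    | inl x =>
      rw [Matrix.mulVec_mulVec, h.left, Matrix.smul_mulVec]
      rfl
    | inr e =>
      rw [Matrix.mulVec_mulVec, h.pair, Matrix.smul_mulVec, hP _ _ _ (hfe s), smul_smul,
        Sum.elim_inr, Sum.elim_inr, sgn_xor]
  -- Flipping one parity on the right sends `f s` to a unimodular multiple of the basis vector of
  -- the flipped pattern, because eigenspaces are lines. The isometry `M` on the left undoes the
  -- flip, so `G s` and its flipped partner have equal norm.
  have hcon : ∀ s t, star (G s) ⬝ᵥ G s = star (G t) ⬝ᵥ G t := by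
    refine const_of_flip_invariant fun s e => ?_
    obtain ⟨M, hM, hMΨ⟩ := h.cross e
    have h1 := (hfe s).flip (.inr e)
    have hup : Function.update (Sum.elim p' s) (.inr e) (!(Sum.elim p' s : X' ⊕ Fin n → Bool) (.inr e))
        = Sum.elim p' (Function.update s e (!s e)) := by
      funext j
      cases j with
      | inl x => simp
      | inr e' =>
        by_cases he : e' = e
        · subst he; simp
        · simp [he]
    rw [hup] at h1
    have h2 := h1.eq_smul hv ho
    set c := star (v (Sum.elim p' (Function.update s e (!s e)))) ⬝ᵥ (S'.flip (.inr e) *ᵥ f s)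
    have hc : star c * c = 1 := by
      have h3 : star (S'.flip (.inr e) *ᵥ f s) ⬝ᵥ (S'.flip (.inr e) *ᵥ f s) = 1 := by
        rw [star_mulVec_dotProduct, S'.flip_herm, S'.flip_sq, Matrix.one_mulVec, hf, if_pos rfl]
      rw [h2, star_smul, smul_dotProduct, dotProduct_smul, ho, if_pos rfl] at h3
      simpa using h3
    have h4 : G s = star c • (M *ᵥ G (Function.update s e (!s e))) := by
      calc G s = (M * Ψ * (S'.flip (.inr e))ᵀ) *ᵥ star (f s) := by rw [hMΨ]
        _ = M *ᵥ (Ψ *ᵥ star (S'.flip (.inr e) *ᵥ f s)) := by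
          rw [← Matrix.mulVec_mulVec, transpose_mulVec_star (S'.flip_herm _),
            ← Matrix.mulVec_mulVec]
        _ = _ := by
          rw [h2, star_smul, Matrix.mulVec_smul, Matrix.mulVec_smul]
    rw [h4, star_smul, smul_dotProduct, dotProduct_smul, star_mulVec_dotProduct, hM,
      Matrix.one_mulVec, smul_smul, star_star, mul_comm, hc, one_smul]
  have hsum := h.norm
  rw [sum_norm_vecMulVec hf G hΨ] at hsum
  -- There are `2 ^ n` equal squared norms, with sum 1.
  have hG : ∀ s, star (G s) ⬝ᵥ G s = (1 / 2) ^ n := by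
    intro s
    rw [Finset.sum_congr rfl fun t _ => hcon t s] at hsum
    simp only [Finset.sum_const, Finset.card_univ, Fintype.card_fun, Fintype.card_bool,
      Fintype.card_fin, nsmul_eq_mul, Nat.cast_pow, Nat.cast_ofNat] at hsum
    rw [one_div, inv_pow]
    exact eq_inv_of_mul_eq_one_right hsum
  have hb : bellAmp ^ n ≠ 0 := pow_ne_zero _ bellAmp_ne_zero
  refine ⟨fun s => (bellAmp ^ n)⁻¹ • G s, f, ?_, hf, fun s => (hGe s).smul _, hfe, ?_⟩
  · intro s t
    split_ifs with hst
    · subst hst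
      rw [star_smul, smul_dotProduct, dotProduct_smul, hG, smul_eq_mul, smul_eq_mul, star_inv₀,
        star_pow, star_bellAmp, ← bellAmp_mul_self, mul_pow]
      field_simp
    · refine ((hGe s).smul _).ortho ((hGe t).smul _) fun heq => hst ?_
      funext e
      have := congrFun heq (.inr e)
      simpa using this
  · conv_lhs => rw [hΨ]
    rw [Finset.smul_sum]
    refine Finset.sum_congr rfl fun s _ => ?_
    rw [Matrix.smul_vecMulVec, smul_smul, mul_inv_cancel₀ hb, one_smul]

/-- The right Schmidt vectors are orthonormal, so an equation for the action on the whole state can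
be read term by term. -/
theorem mul_schmidt {g : (Fin n → Bool) → α → ℂ} {f : (Fin n → Bool) → β → ℂ} (hf : IsOrtho f)
    (hΨ : Ψ = bellAmp ^ n • ∑ s, Matrix.vecMulVec (g s) (f s)) (O : Matrix α α ℂ)
    {g' : (Fin n → Bool) → α → ℂ}
    (h : O * Ψ = bellAmp ^ n • ∑ s, Matrix.vecMulVec (g' s) (f s)) (s : Fin n → Bool) :
    O *ᵥ g s = g' s := by
  have hb : bellAmp ^ n ≠ 0 := pow_ne_zero _ bellAmp_ne_zero
  rw [hΨ, Matrix.mul_smul, mul_sum_vecMulVec] at h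
  have := smul_right_injective _ hb h
  exact congrFun (eq_of_sum_vecMulVec_eq hf this) s

theorem schmidt_mul {g : (Fin n → Bool) → α → ℂ} {f : (Fin n → Bool) → β → ℂ} (hg : IsOrtho g)
    (hΨ : Ψ = bellAmp ^ n • ∑ s, Matrix.vecMulVec (g s) (f s)) (O : Matrix β β ℂ)
    {f' : (Fin n → Bool) → β → ℂ}
    (h : Ψ * Oᵀ = bellAmp ^ n • ∑ s, Matrix.vecMulVec (g s) (f' s)) (s : Fin n → Bool) :
    O *ᵥ f s = f' s := by
  have hb : bellAmp ^ n ≠ 0 := pow_ne_zero _ bellAmp_ne_zero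
  rw [hΨ, Matrix.smul_mul, sum_vecMulVec_mul] at h
  have := smul_right_injective _ hb h
  exact congrFun (eq_of_sum_vecMulVec_eq' hg this) s

/-- States with the same fixed parities on the left have Schmidt vectors with a common sign pattern,
hence on a common line. An operator cannot fix this line and also annihilate it. -/
theorem IsEntangled.not_distinguishable [Nonempty α] [Nonempty β] {Ψ₂ : Matrix α β ℂ}
    {p₂' : X' → Bool} {κ₂ : Fin n → Bool} (h : IsEntangled S S' Ψ p p' κ)
    (h₂ : IsEntangled S S' Ψ₂ p p₂' κ₂) {O : Matrix α α ℂ} (hO : O * Ψ = Ψ) (hO₂ : O * Ψ₂ = 0) :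
    False := by
  obtain ⟨g, f, hg, hf, hge, -, hΨ⟩ := h.schmidt
  obtain ⟨g₂, f₂, hg₂, hf₂, hge₂, -, hΨ₂⟩ := h₂.schmidt
  obtain ⟨v, hv, ho⟩ := S.exists_basis
  let s : Fin n → Bool := fun _ => false
  -- Chosen so that the left vector `g t` has the pair signs `κ₂`, like `g₂ s` with `s = 0`.
  let t : Fin n → Bool := fun e => xor (κ₂ e) (κ e)
  have h1 : O *ᵥ g t = g t := mul_schmidt hf hΨ O (by rw [hO]; exact hΨ) t
  have h2 : O *ᵥ g₂ s = 0 :=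
    mul_schmidt hf₂ hΨ₂ O (g' := fun _ => 0) (by rw [hO₂]; simp) s
  have e1 : S.IsEigen (Sum.elim p κ₂) (g t) := by
    have := hge t
    convert this using 2
    funext e
    simp only [t]
    cases κ e <;> cases κ₂ e <;> rfl
  have e2 : S.IsEigen (Sum.elim p κ₂) (g₂ s) := by
    have := hge₂ s
    convert this using 2
    funext e
    simp [s]
  have h3 := e1.eq_smul hv ho
  have h4 := e2.eq_smul hv ho
  set a := star (v (Sum.elim p κ₂)) ⬝ᵥ g t
  set b := star (v (Sum.elim p κ₂)) ⬝ᵥ g₂ s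
  have hb : b ≠ 0 := by
    intro hb
    have := hg₂ s s
    rw [h4, hb] at this
    simp at this
  rw [h4, Matrix.mulVec_smul] at h2
  have h5 := (smul_eq_zero.1 h2).resolve_left hb
  rw [h3, Matrix.mulVec_smul, h5, smul_zero] at h1
  have := hg t t
  rw [h3, ← h1] at this
  simp at this

end Schmidt

/-! ### Bases adapted to a code with complementary recovery -/

section Code

variable {α β : Type*} [Fintype α] [DecidableEq α] [Fintype β] [DecidableEq β]
variable {X X' I K : Type*} [Fintype X] [DecidableEq X] [Fintype X'] [DecidableEq X'] {n : ℕ}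

/-- Schmidt vectors chosen separately for each pair `(i, k)` would have unrelated phases. Instead
one decomposition, at `(i₀, k₀)`, is transported by the recovery operators; as these act on separate
sides, the left vectors depend on `i` alone and the right ones on `k` alone. -/
theorem exists_code_vectors [Nonempty β] {S : ParitySystem (X ⊕ Fin n) α}
    {S' : ParitySystem (X' ⊕ Fin n) β} {Ψ : I → K → Matrix α β ℂ} {p : X → I → Bool}
    {p' : X' → K → Bool} {κ : I → K → Fin n → Bool}
    (h : ∀ i k, IsEntangled S S' (Ψ i k) (fun x => p x i) (fun x => p' x k) (κ i k))
    {O : I → I → Matrix α α ℂ} {O' : K → K → Matrix β β ℂ}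
    (hO : ∀ i i' k, O i i' * Ψ i' k = Ψ i k) (hO' : ∀ i k k', Ψ i k' * (O' k k')ᵀ = Ψ i k)
    (hOs : ∀ i i', (O i i')ᴴ * O i i' = O i' i') (hOs' : ∀ k k', (O' k k')ᴴ * O' k k' = O' k' k')
    (i₀ : I) (k₀ : K) :
    ∃ (u : I → (Fin n → Bool) → α → ℂ) (u' : K → (Fin n → Bool) → β → ℂ)
      (ε : I → Fin n → Bool) (ε' : K → Fin n → Bool),
      (∀ i s, S.IsEigen (Sum.elim (fun x => p x i) fun e => xor (ε i e) (s e)) (u i s)) ∧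
      (∀ i s, star (u i s) ⬝ᵥ u i s = 1) ∧
      (∀ k s, S'.IsEigen (Sum.elim (fun x => p' x k) fun e => xor (ε' k e) (s e)) (u' k s)) ∧
      (∀ k s, star (u' k s) ⬝ᵥ u' k s = 1) ∧
      ∀ i k, Ψ i k = bellAmp ^ n • ∑ s, Matrix.vecMulVec (u i s) (u' k s) := by
  obtain ⟨g, f, hg, hf, hge, hfe, hΨ⟩ := (h i₀ k₀).schmidt
  have hL : ∀ i, Ψ i k₀ = bellAmp ^ n • ∑ s, Matrix.vecMulVec (O i i₀ *ᵥ g s) (f s) := by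
    intro i
    rw [← hO i i₀ k₀, hΨ, Matrix.mul_smul, mul_sum_vecMulVec]
  have hR : ∀ k, Ψ i₀ k = bellAmp ^ n • ∑ s, Matrix.vecMulVec (g s) (O' k k₀ *ᵥ f s) := by
    intro k
    rw [← hO' i₀ k k₀, hΨ, Matrix.smul_mul, sum_vecMulVec_mul]
  have hg0 : ∀ s, O i₀ i₀ *ᵥ g s = g s := mul_schmidt hf hΨ _ (by rw [hO]; exact hΨ)
  have hf0 : ∀ s, O' k₀ k₀ *ᵥ f s = f s := schmidt_mul hg hΨ _ (by rw [hO']; exact hΨ)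
  -- The left signs come from the states with `k = k₀`, whose right vectors are still `f`. The right
  -- signs come from the states with `i = i₀`, whose left vectors `g` already carry `κ i₀ k₀`; that
  -- sign is therefore included in `ε'`.
  refine ⟨fun i s => O i i₀ *ᵥ g s, fun k s => O' k k₀ *ᵥ f s, fun i => κ i k₀,
    fun k e => xor (κ i₀ k e) (κ i₀ k₀ e), ?_, ?_, ?_, ?_, ?_⟩
  · intro i s j
    cases j with
    | inl x =>
      refine mul_schmidt hf (hL i) (S.P (.inl x)) (g' := fun s => sgn (p x i) • (O i i₀ *ᵥ g s)) ?_ s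
      rw [(h i k₀).left, hL i]
      simp only [Matrix.smul_vecMulVec, Finset.smul_sum, smul_smul]
      exact Finset.sum_congr rfl fun t _ => by rw [mul_comm]
    | inr e =>
      refine mul_schmidt hf (hL i) (S.P (.inr e))
        (g' := fun s => sgn (xor (κ i k₀ e) (s e)) • (O i i₀ *ᵥ g s)) ?_ s
      rw [(h i k₀).pair, hL i, Matrix.smul_mul, sum_vecMulVec_mul, smul_comm]
      congr 1
      rw [Finset.smul_sum]
      refine Finset.sum_congr rfl fun t _ => ?_
      rw [hfe t (.inr e), Matrix.vecMulVec_smul, Matrix.smul_vecMulVec, smul_smul, sgn_xor,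
        Sum.elim_inr]
  · intro i s
    rw [star_mulVec_dotProduct, hOs, hg0, hg, if_pos rfl]
  · intro k s j
    cases j with
    | inl x =>
      refine schmidt_mul hg (hR k) (S'.P (.inl x))
        (f' := fun s => sgn (p' x k) • (O' k k₀ *ᵥ f s)) ?_ s
      rw [(h i₀ k).right, hR k, smul_comm]
      congr 1
      rw [Finset.smul_sum]
      refine Finset.sum_congr rfl fun t _ => ?_
      rw [Matrix.vecMulVec_smul]
    | inr e =>
      refine schmidt_mul hg (hR k) (S'.P (.inr e))
        (f' := fun s => sgn (xor (xor (κ i₀ k e) (κ i₀ k₀ e)) (s e)) • (O' k k₀ *ᵥ f s)) ?_ s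
      have hp : Ψ i₀ k * (S'.P (.inr e))ᵀ = sgn (κ i₀ k e) • (S.P (.inr e) * Ψ i₀ k) := by
        rw [(h i₀ k).pair, smul_smul, sgn_mul_self, one_smul]
      rw [hp, hR k, Matrix.mul_smul, mul_sum_vecMulVec, smul_comm]
      congr 1
      rw [Finset.smul_sum]
      refine Finset.sum_congr rfl fun t _ => ?_
      rw [hge t (.inr e), Matrix.smul_vecMulVec, Matrix.vecMulVec_smul, smul_smul, sgn_xor, sgn_xor,
        Sum.elim_inr, sgn_xor, mul_assoc]
  · intro k s
    rw [star_mulVec_dotProduct, hOs', hf0, hf, if_pos rfl]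
  · intro i k
    rw [← hO i i₀ k, hR k, Matrix.mul_smul, mul_sum_vecMulVec]

end Code

/-! ### Completing the code vectors to an orthonormal basis. -/

section Frame

variable {α L X : Type*} [Fintype α] [DecidableEq α] [Fintype L] [DecidableEq L] [Fintype X]
  [DecidableEq X] {n : ℕ}

/-- The parities that are assigned to the basis states of the qubits of a region: `p` are the
parities of the dimers in the region for a given state of the logical qubits. -/
def regPattern (p : L ⊕ X → (L → Bool) → Bool) (ε : (L → Bool) → Fin n → Bool)
    (q : (L → Bool) × (X → Bool) × (Fin n → Bool)) : (L ⊕ X) ⊕ Fin n → Bool :=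
  Sum.elim (Sum.elim (fun l => p (.inl l) q.1) fun k => xor (p (.inr k) q.1) (q.2.1 k))
    fun e => xor (ε q.1 e) (q.2.2 e)

theorem regPattern_injective {p : L ⊕ X → (L → Bool) → Bool} (ε : (L → Bool) → Fin n → Bool)
    (hp : ∀ i i', (∀ l, p (.inl l) i = p (.inl l) i') → i = i') :
    Function.Injective (regPattern p ε) := by
  rintro ⟨i, χ, s⟩ ⟨i', χ', s'⟩ h
  obtain rfl : i = i' := hp i i' fun l => congrFun h (.inl (.inl l))
  have h1 : χ = χ' := by
    funext k
    have := congrFun h (.inl (.inr k))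
    simpa [regPattern] using this
  have h2 : s = s' := by
    funext e
    have := congrFun h (.inr e)
    simpa [regPattern] using this
  rw [h1, h2]

/-- Where the auxiliary qubits are all 0 the vectors `u` must be kept with their phases, because
code states are superpositions of them. Elsewhere any unit eigenvectors will do. Orthogonality is
automatic, since different basis labels have different sign patterns. -/
theorem exists_frame [Nonempty α] (S : ParitySystem ((L ⊕ X) ⊕ Fin n) α)
    {p : L ⊕ X → (L → Bool) → Bool} {ε : (L → Bool) → Fin n → Bool}
    (hp : ∀ i i', (∀ l, p (.inl l) i = p (.inl l) i') → i = i')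
    {u : (L → Bool) → (Fin n → Bool) → α → ℂ}
    (hu : ∀ i s, S.IsEigen (Sum.elim (fun x => p x i) fun e => xor (ε i e) (s e)) (u i s))
    (hn : ∀ i s, star (u i s) ⬝ᵥ u i s = 1) :
    ∃ w : (L → Bool) × (X → Bool) × (Fin n → Bool) → α → ℂ, IsOrtho w ∧
      (∀ q, S.IsEigen (regPattern p ε q) (w q)) ∧ ∀ i s, w (i, fun _ => false, s) = u i s := by
  obtain ⟨v, hv, ho⟩ := S.exists_basis
  let w : (L → Bool) × (X → Bool) × (Fin n → Bool) → α → ℂ := fun q =>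
    if q.2.1 = fun _ => false then u q.1 q.2.2 else v (regPattern p ε q)
  have hw : ∀ q, S.IsEigen (regPattern p ε q) (w q) := by
    intro q
    by_cases h : q.2.1 = fun _ => false
    · simp only [w, if_pos h]
      convert hu q.1 q.2.2 using 1
      funext j
      rcases j with (l | k) | e <;> simp [regPattern, h]
    · simp only [w, if_neg h]
      exact hv _
  refine ⟨w, fun q q' => ?_, hw, fun i s => by simp [w]⟩
  split_ifs with hq
  · subst hq
    by_cases h : q.2.1 = fun _ => false
    · simp only [w, if_pos h, hn]
    · simp only [w, if_neg h]
      rw [ho, if_pos rfl]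
  · exact (hw q).ortho (hw q') fun h => hq (regPattern_injective ε hp h)

theorem card_reg (S : ParitySystem ((L ⊕ X) ⊕ Fin n) α) :
    Fintype.card ((L → Bool) × (X → Bool) × (Fin n → Bool)) = Fintype.card α := by
  rw [← S.card]
  simp [pow_add, mul_assoc]

end Frame

/-! ### Majorana operators of a region -/

section Region

variable {ι : Type*} [Fintype ι] [LinearOrder ι] {J : Type*} [Fintype J]

/-- The parities of a complete set of disjoint pairs of modes. -/
def jwSystem (y : J × Bool → ι × Bool) (hy : Function.Bijective y) :
    ParitySystem J (ι → Bool) where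
  P j := jwPair (y (j, false)) (y (j, true))
  flip j := jwOp (y (j, false))
  P_sq j := by
    have h : y (j, false) ≠ y (j, true) := hy.1.ne (by simp)
    convert jwPair_mul_self h
  P_herm j := jwPair_conjTranspose (hy.1.ne (by simp))
  P_comm j k := by
    by_cases h : j = k
    · rw [h]
    · exact jwPair_comm (hy.1.ne (by simp [h])) (hy.1.ne (by simp [h])) (hy.1.ne (by simp [h]))
        (hy.1.ne (by simp [h]))
  flip_sq j := by convert jwOp_mul_self _
  flip_herm j := jwOp_conjTranspose _
  anti j := jwPair_mul_jwOp_left (hy.1.ne (by simp))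
  flip_comm j k h := jwPair_mul_jwOp (hy.1.ne (by simp [Ne.symm h])) (hy.1.ne (by simp [Ne.symm h]))
  card := by
    have := Fintype.card_of_bijective hy
    simp only [Fintype.card_prod, Fintype.card_bool] at this
    rw [Fintype.card_fun, Fintype.card_bool]
    congr 1
    omega

end Region

/-! ### Majorana operators across the cut at the end of an initial segment. -/

section Segment

variable {N : ℕ} {A : Finset (Fin N)}

/-- The operator `Z ⋯ Z` on a region. -/
def zString (A : Finset (Fin N)) : Matrix (A → Bool) (A → Bool) ℂ := tensorOp fun _ => pauliZ

theorem zString_mul_self : zString A * zString A = 1 := by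
  rw [zString, tensorOp_mul]
  simp only [pauliZ_mul_pauliZ]
  convert tensorOp_one

theorem zString_conjTranspose : (zString A)ᴴ = zString A := by
  rw [zString, tensorOp_conjTranspose]
  simp only [pauliZ_conjTranspose]

theorem stateMatrix_majorana (hA : ∀ j ∈ A, ∀ k ∉ A, j < k) {μ : Mode N} (hμ : μ.1 ∈ A)
    (ψ : (Fin N → Bool) → ℂ) :
    stateMatrix A (majorana μ *ᵥ ψ) = jwOp ((⟨μ.1, hμ⟩, μ.2) : A × Bool) * stateMatrix A ψ := by
  rw [majorana_eq_jwOp, jwOp, stateMatrix_tensorOp]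
  have h1 : (fun k : (Aᶜ : Finset (Fin N)) => jwSite μ (k : Fin N)) = fun _ => 1 := by
    funext k
    have := hA _ hμ k (Finset.mem_compl.1 k.2)
    rw [jwSite, if_neg this.not_gt, if_neg this.ne']
  have h2 : (fun k : A => jwSite μ (k : Fin N)) = jwSite ((⟨μ.1, hμ⟩, μ.2) : A × Bool) := by
    funext k
    simp only [jwSite, ← Subtype.coe_lt_coe, ← Subtype.coe_inj]
  have h3 : tensorOp (fun _ : (Aᶜ : Finset (Fin N)) => (1 : Matrix Bool Bool ℂ)) = 1 := tensorOp_one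
  rw [h1, h2, h3, Matrix.transpose_one]
  convert Matrix.mul_one _
  rfl

/-- The string of a mode behind `A` covers all of `A`, so a single Majorana operator there is not
local. -/
theorem stateMatrix_majorana_compl (hA : ∀ j ∈ A, ∀ k ∉ A, j < k) {μ : Mode N} (hμ : μ.1 ∈ Aᶜ)
    (ψ : (Fin N → Bool) → ℂ) :
    stateMatrix A (majorana μ *ᵥ ψ) =
      zString A * stateMatrix A ψ * (jwOp ((⟨μ.1, hμ⟩, μ.2) : (Aᶜ : Finset (Fin N)) × Bool))ᵀ := by
  rw [majorana_eq_jwOp, jwOp, stateMatrix_tensorOp]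
  have h1 : (fun k : A => jwSite μ (k : Fin N)) = fun _ => pauliZ := by
    funext k
    rw [jwSite, if_pos (hA k k.2 _ (Finset.mem_compl.1 hμ))]
  have h2 : (fun k : (Aᶜ : Finset (Fin N)) => jwSite μ (k : Fin N)) =
      jwSite ((⟨μ.1, hμ⟩, μ.2) : (Aᶜ : Finset (Fin N)) × Bool) := by
    funext k
    simp only [jwSite, ← Subtype.coe_lt_coe, ← Subtype.coe_inj]
  rw [h1, h2]
  rfl

theorem stateMatrix_pairParity (hA : ∀ j ∈ A, ∀ k ∉ A, j < k) {μ ν : Mode N} (hμ : μ.1 ∈ A)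
    (hν : ν.1 ∈ A) (ψ : (Fin N → Bool) → ℂ) :
    stateMatrix A (pairParity μ ν *ᵥ ψ) =
      jwPair ((⟨μ.1, hμ⟩, μ.2) : A × Bool) (⟨ν.1, hν⟩, ν.2) * stateMatrix A ψ := by
  rw [pairParity, Matrix.smul_mulVec, ← Matrix.mulVec_mulVec, stateMatrix_smul,
    stateMatrix_majorana hA hμ, stateMatrix_majorana hA hν, jwPair, Matrix.smul_mul,
    Matrix.mul_assoc]
  rfl

/-- In a product of two modes the strings over `A` cancel, which makes parity operators of the
complement local. -/
theorem stateMatrix_pairParity_compl (hA : ∀ j ∈ A, ∀ k ∉ A, j < k) {μ ν : Mode N}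
    (hμ : μ.1 ∈ Aᶜ) (hν : ν.1 ∈ Aᶜ) (ψ : (Fin N → Bool) → ℂ) :
    stateMatrix A (pairParity μ ν *ᵥ ψ) = stateMatrix A ψ *
      (jwPair ((⟨μ.1, hμ⟩, μ.2) : (Aᶜ : Finset (Fin N)) × Bool) (⟨ν.1, hν⟩, ν.2))ᵀ := by
  rw [pairParity, Matrix.smul_mulVec, ← Matrix.mulVec_mulVec, stateMatrix_smul,
    stateMatrix_majorana_compl hA hμ, stateMatrix_majorana_compl hA hν, jwPair,
    Matrix.transpose_smul, Matrix.mul_smul, Matrix.transpose_mul, ← Matrix.mul_assoc,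
    ← Matrix.mul_assoc, ← Matrix.mul_assoc, zString_mul_self, Matrix.one_mul]
  rfl

end Segment

/-! ### The modes of a region -/

namespace DimerDiagram

variable {N : ℕ} {B : Type*} (d : DimerDiagram N B) {A L : Finset (Fin N)} {n : ℕ}
  {g : Fin n × Bool → Fin N}

theorem mem_inside {k : Fin N} : k ∈ d.inside A ↔ ∀ t, (d.ends (k, t)).1 ∈ A := by
  simp [inside]

theorem mem_crossing {k : Fin N} :
    k ∈ d.crossing A ↔ ¬ ((d.ends (k, false)).1 ∈ A ↔ (d.ends (k, true)).1 ∈ A) := by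
  simp [crossing]

theorem crossing_compl : d.crossing Aᶜ = d.crossing A := by
  ext k
  rw [mem_crossing, mem_crossing, Finset.mem_compl, Finset.mem_compl]
  tauto

theorem IsPairing.compl (h : d.IsPairing A g) : d.IsPairing Aᶜ g := by
  rw [IsPairing, crossing_compl]
  exact h

theorem IsPairing.mem_crossing {d : DimerDiagram N B} (h : d.IsPairing A g) (z : Fin n × Bool) :
    g z ∈ d.crossing A := by
  rw [← Finset.mem_coe, ← h.2]
  exact ⟨z, rfl⟩

/-- Which of the two ends of a crossing dimer is in the region. -/
def sideIn (A : Finset (Fin N)) (k : Fin N) : Bool := decide ((d.ends (k, false)).1 ∉ A)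

theorem endIn_eq (k : Fin N) : d.endIn A k = d.ends (k, d.sideIn A k) := by
  by_cases h : (d.ends (k, false)).1 ∈ A <;> simp [endIn, sideIn, h]

theorem endIn_mem {k : Fin N} (h : k ∈ d.crossing A) : (d.endIn A k).1 ∈ A := by
  rw [mem_crossing] at h
  by_cases h' : (d.ends (k, false)).1 ∈ A
  · simp [endIn, h']
  · simp only [endIn, if_neg h']
    tauto

theorem sideIn_eq {k : Fin N} (h : k ∈ d.crossing A) {t : Bool} (ht : (d.ends (k, t)).1 ∈ A) :
    d.sideIn A k = t := by
  rw [mem_crossing] at h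
  cases t <;> simp [sideIn] <;> tauto

theorem sideIn_compl (k : Fin N) : d.sideIn Aᶜ k = !d.sideIn A k := by
  simp [sideIn]

/-- The dimer of a qubit that is formed from a dimer in the region. -/
def label (A L : Finset (Fin N)) : L ⊕ d.aux A L → Fin N :=
  Sum.elim (fun k => (k : Fin N)) fun k => (k : Fin N)

theorem label_injective : Function.Injective (d.label A L) := by
  refine Function.Injective.sumElim Subtype.val_injective Subtype.val_injective ?_
  rintro ⟨k, hk⟩ ⟨k', hk'⟩ h
  obtain rfl : k = k' := h
  exact (Finset.mem_sdiff.1 hk').2 hk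

theorem label_mem (hL : L ⊆ d.inside A) (x : L ⊕ d.aux A L) : d.label A L x ∈ d.inside A := by
  cases x with
  | inl k => exact hL k.2
  | inr k => exact (Finset.mem_sdiff.1 k.2).1

theorem exists_label {k : Fin N} (hk : k ∈ d.inside A) : ∃ x, d.label A L x = k := by
  by_cases h : k ∈ L
  · exact ⟨.inl ⟨k, h⟩, rfl⟩
  · exact ⟨.inr ⟨k, Finset.mem_sdiff.2 ⟨hk, h⟩⟩, rfl⟩

/-- The dimer ends in the region, arranged by the qubits that they form. -/
def regionEnd (A L : Finset (Fin N)) (g : Fin n × Bool → Fin N) :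
    ((L ⊕ d.aux A L) ⊕ Fin n) × Bool → Fin N × Bool
  | (.inl x, t) => (d.label A L x, t)
  | (.inr e, t) => (g (e, t), d.sideIn A (g (e, t)))

theorem regionEnd_mem (hL : L ⊆ d.inside A) (hg : d.IsPairing A g)
    (z : ((L ⊕ d.aux A L) ⊕ Fin n) × Bool) : (d.ends (d.regionEnd A L g z)).1 ∈ A := by
  obtain ⟨x | e, t⟩ := z
  · exact d.mem_inside.1 (d.label_mem hL x) t
  · have := d.endIn_mem (hg.mem_crossing (e, t))
    rwa [endIn_eq] at this

/-- The modes of the region, arranged by the qubits that they form. -/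
def regionMode (hL : L ⊆ d.inside A) (hg : d.IsPairing A g)
    (z : ((L ⊕ d.aux A L) ⊕ Fin n) × Bool) : A × Bool :=
  (⟨(d.ends (d.regionEnd A L g z)).1, d.regionEnd_mem hL hg z⟩, (d.ends (d.regionEnd A L g z)).2)

theorem not_mem_crossing {k : Fin N} (h : k ∈ d.inside A) : k ∉ d.crossing A := by
  rw [mem_inside] at h
  simp [mem_crossing, h]

theorem regionEnd_injective (hL : L ⊆ d.inside A) (hg : d.IsPairing A g) :
    Function.Injective (d.regionEnd A L g) := by
  rintro ⟨x | e, t⟩ ⟨x' | e', t'⟩ h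
  · obtain ⟨h1, rfl⟩ := Prod.mk.inj h
    rw [d.label_injective h1]
  · have h1 := (Prod.mk.inj h).1
    exact absurd (h1 ▸ hg.mem_crossing (e', t')) (d.not_mem_crossing (d.label_mem hL x))
  · have h1 := (Prod.mk.inj h).1
    exact absurd (h1 ▸ hg.mem_crossing (e, t)) (d.not_mem_crossing (d.label_mem hL x'))
  · have h1 := hg.1 (Prod.mk.inj h).1
    obtain ⟨rfl, rfl⟩ := Prod.mk.inj h1
    rfl

/-- Each mode of the region is an end of an inner dimer or the unique end in the region of a
crossing dimer. Hence the parities of `regionSystem` are complete. -/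
theorem regionMode_bijective (hL : L ⊆ d.inside A) (hg : d.IsPairing A g) :
    Function.Bijective (d.regionMode hL hg) := by
  constructor
  · intro z z' h
    refine d.regionEnd_injective hL hg (d.ends.injective ?_)
    obtain ⟨h1, h2⟩ := Prod.mk.inj h
    exact Prod.ext (congrArg Subtype.val h1) h2
  · rintro ⟨⟨j, hj⟩, t⟩
    obtain ⟨⟨k, t'⟩, hk⟩ := d.ends.surjective (j, t)
    have hkA : (d.ends (k, t')).1 ∈ A := by rw [hk]; exact hj
    have key : ∀ z, d.regionEnd A L g z = (k, t') → d.regionMode hL hg z = (⟨j, hj⟩, t) := by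
      intro z hz
      refine Prod.ext (Subtype.ext ?_) ?_
      · simp [regionMode, hz, hk]
      · simp [regionMode, hz, hk]
    by_cases hc : k ∈ d.crossing A
    · obtain ⟨⟨e, t''⟩, rfl⟩ : k ∈ Set.range g := by rw [hg.2]; exact hc
      exact ⟨(.inr e, t''), key _ (by rw [regionEnd, d.sideIn_eq hc hkA])⟩
    · have hi : k ∈ d.inside A := by
        rw [mem_crossing, not_not] at hc
        rw [mem_inside]
        intro t
        cases t <;> cases t' <;> tauto
      obtain ⟨x, hx⟩ := d.exists_label (L := L) hi
      exact ⟨(.inl x, t'), key _ (by rw [regionEnd, hx])⟩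

/-- The parities of the qubits of the region. -/
def regionSystem (hL : L ⊆ d.inside A) (hg : d.IsPairing A g) :
    ParitySystem ((L ⊕ d.aux A L) ⊕ Fin n) (A → Bool) :=
  jwSystem (d.regionMode hL hg) (d.regionMode_bijective hL hg)

end DimerDiagram

/-! ### Entanglement of Majorana dimer states -/

section HasDimer

variable {N : ℕ} {ψ : (Fin N → Bool) → ℂ} {μ ν : Mode N} {b : Bool}

theorem majorana_mulVec_majorana (μ : Mode N) (ψ : (Fin N → Bool) → ℂ) :
    majorana μ *ᵥ (majorana μ *ᵥ ψ) = ψ := by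
  have h : majorana μ * majorana μ = 1 := by
    rw [majorana_eq_jwOp]
    convert jwOp_mul_self μ
  rw [Matrix.mulVec_mulVec, h, Matrix.one_mulVec]

theorem majorana_mulVec_comm {μ ν : Mode N} (h : μ ≠ ν) (ψ : (Fin N → Bool) → ℂ) :
    majorana μ *ᵥ (majorana ν *ᵥ ψ) = -(majorana ν *ᵥ (majorana μ *ᵥ ψ)) := by
  rw [Matrix.mulVec_mulVec, Matrix.mulVec_mulVec, majorana_eq_jwOp, majorana_eq_jwOp,
    ← Matrix.neg_mulVec]
  congr 1
  convert jwOp_anticomm h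

theorem HasDimer.left_eq (h : HasDimer ψ μ ν b) :
    majorana μ *ᵥ ψ = (Complex.I * sgn (!b)) • (majorana ν *ᵥ ψ) := by
  rw [HasDimer, Matrix.add_mulVec, Matrix.smul_mulVec] at h
  rw [eq_neg_of_add_eq_zero_left h, sgn_not, mul_neg, neg_smul]

theorem HasDimer.right_eq (h : HasDimer ψ μ ν b) :
    majorana ν *ᵥ ψ = (Complex.I * sgn b) • (majorana μ *ᵥ ψ) := by
  rw [h.left_eq, smul_smul, sgn_not, mul_neg, mul_neg, mul_mul_mul_comm, sgn_mul_self,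
    Complex.I_mul_I]
  simp

theorem HasDimer.pairParity_mulVec (h : HasDimer ψ μ ν b) : pairParity μ ν *ᵥ ψ = sgn b • ψ := by
  rw [pairParity, Matrix.smul_mulVec, ← Matrix.mulVec_mulVec, h.right_eq, Matrix.mulVec_smul,
    majorana_mulVec_majorana, smul_smul, ← mul_assoc, neg_mul, Complex.I_mul_I]
  simp

end HasDimer

/-- A crossing dimer equates `J` on the left with `Z ⊗ F` up to a phase. Taking `M` to be that phase
times `J * Z` makes `M` undo the action of `F`. -/
theorem exists_cross {α β : Type*} [Fintype α] [DecidableEq α] [Fintype β]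
    {J Z : Matrix α α ℂ} {Ψ : Matrix α β ℂ} {F : Matrix β β ℂ} {b : Bool} (hJ : J * J = 1)
    (hJ' : Jᴴ = J) (hZ : Z * Z = 1) (hZ' : Zᴴ = Z)
    (h : J * Ψ = (Complex.I * sgn b) • (Z * Ψ * Fᵀ)) :
    ∃ M : Matrix α α ℂ, Mᴴ * M = 1 ∧ M * Ψ * Fᵀ = Ψ := by
  refine ⟨(Complex.I * sgn b) • (J * Z), ?_, ?_⟩
  · rw [Matrix.conjTranspose_smul, Matrix.conjTranspose_mul, hJ', hZ', smul_mul_smul_comm,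
      Matrix.mul_assoc, ← Matrix.mul_assoc J, hJ, Matrix.one_mul, hZ, star_mul', star_sgn,
      mul_mul_mul_comm, sgn_mul_self]
    simp
  · rw [Matrix.smul_mul, Matrix.smul_mul, Matrix.mul_assoc, Matrix.mul_assoc, ← Matrix.mul_assoc Z,
      ← Matrix.mul_smul, ← h, ← Matrix.mul_assoc, hJ, Matrix.one_mul]

/-! ### Entanglement of a dimer state between a region and its complement. -/

namespace DimerDiagram

variable {N : ℕ} {B : Type*} (d : DimerDiagram N B) {A L L' : Finset (Fin N)} {n : ℕ}
  {g : Fin n × Bool → Fin N}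

theorem stateMatrix_parityOp (hA : ∀ j ∈ A, ∀ k ∉ A, j < k) (hL : L ⊆ d.inside A)
    (hg : d.IsPairing A g) (x : L ⊕ d.aux A L) (ψ : (Fin N → Bool) → ℂ) :
    stateMatrix A (d.parityOp (d.label A L x) *ᵥ ψ) =
      (d.regionSystem hL hg).P (.inl x) * stateMatrix A ψ :=
  stateMatrix_pairParity hA (d.regionEnd_mem hL hg (.inl x, false))
    (d.regionEnd_mem hL hg (.inl x, true)) ψ

theorem stateMatrix_parityOp_compl (hA : ∀ j ∈ A, ∀ k ∉ A, j < k) (hL : L' ⊆ d.inside Aᶜ)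
    (hg : d.IsPairing Aᶜ g) (x : L' ⊕ d.aux Aᶜ L') (ψ : (Fin N → Bool) → ℂ) :
    stateMatrix A (d.parityOp (d.label Aᶜ L' x) *ᵥ ψ) =
      stateMatrix A ψ * ((d.regionSystem hL hg).P (.inl x))ᵀ :=
  stateMatrix_pairParity_compl hA (d.regionEnd_mem hL hg (.inl x, false))
    (d.regionEnd_mem hL hg (.inl x, true)) ψ

theorem stateMatrix_endIn (hA : ∀ j ∈ A, ∀ k ∉ A, j < k) (hL : L ⊆ d.inside A)
    (hg : d.IsPairing A g) (e : Fin n) (ψ : (Fin N → Bool) → ℂ) :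
    stateMatrix A (pairParity (d.endIn A (g (e, false))) (d.endIn A (g (e, true))) *ᵥ ψ) =
      (d.regionSystem hL hg).P (.inr e) * stateMatrix A ψ := by
  rw [endIn_eq, endIn_eq]
  exact stateMatrix_pairParity hA (d.regionEnd_mem hL hg (.inr e, false))
    (d.regionEnd_mem hL hg (.inr e, true)) ψ

theorem stateMatrix_endIn_compl (hA : ∀ j ∈ A, ∀ k ∉ A, j < k) (hL : L' ⊆ d.inside Aᶜ)
    (hg : d.IsPairing Aᶜ g) (e : Fin n) (ψ : (Fin N → Bool) → ℂ) :
    stateMatrix A (pairParity (d.endIn Aᶜ (g (e, false))) (d.endIn Aᶜ (g (e, true))) *ᵥ ψ) =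
      stateMatrix A ψ * ((d.regionSystem hL hg).P (.inr e))ᵀ := by
  rw [endIn_eq, endIn_eq]
  exact stateMatrix_pairParity_compl hA (d.regionEnd_mem hL hg (.inr e, false))
    (d.regionEnd_mem hL hg (.inr e, true)) ψ

theorem majorana_endIn {ψ : (Fin N → Bool) → ℂ} {pb : Fin N → Bool}
    (hd : ∀ k, HasDimer ψ (d.ends (k, false)) (d.ends (k, true)) (pb k)) (k : Fin N) :
    ∃ β, majorana (d.endIn A k) *ᵥ ψ = (Complex.I * sgn β) • (majorana (d.endIn Aᶜ k) *ᵥ ψ) := by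
  rw [endIn_eq, endIn_eq, sideIn_compl]
  cases d.sideIn A k
  · exact ⟨_, (hd k).left_eq⟩
  · exact ⟨_, (hd k).right_eq⟩

theorem endIn_ne (hg : d.IsPairing A g) (e : Fin n) (A' A'' : Finset (Fin N)) :
    d.endIn A' (g (e, false)) ≠ d.endIn A'' (g (e, true)) := by
  rw [endIn_eq, endIn_eq]
  intro h
  have h1 := hg.1 (Prod.mk.inj (d.ends.injective h)).1
  simp at h1

/-- Inner dimers give the fixed parities. Two crossing dimers together carry the parity of their
ends in `A` over to the parity of their other ends, and a single one flips that parity. -/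
theorem isEntangled (hA : ∀ j ∈ A, ∀ k ∉ A, j < k) (hL : L ⊆ d.inside A) (hL' : L' ⊆ d.inside Aᶜ)
    (hg : d.IsPairing A g) {ψ : (Fin N → Bool) → ℂ} {pb : Fin N → Bool}
    (hd : ∀ k, HasDimer ψ (d.ends (k, false)) (d.ends (k, true)) (pb k))
    (hn : ∑ x, star (ψ x) * ψ x = 1) :
    ∃ κ, IsEntangled (d.regionSystem hL hg) (d.regionSystem hL' hg.compl) (stateMatrix A ψ)
      (fun x => pb (d.label A L x)) (fun x => pb (d.label Aᶜ L' x)) κ := by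
  choose β hβ using d.majorana_endIn (A := A) hd
  -- The negation comes from `i² = -1` for the two dimers; the two anticommutations needed to
  -- reorder the modes cancel.
  refine ⟨fun e => !(xor (β (g (e, false))) (β (g (e, true)))), ?_, ?_, ?_, ?_, ?_⟩
  · intro x
    rw [← d.stateMatrix_parityOp hA, parityOp, (hd _).pairParity_mulVec, stateMatrix_smul]
  · intro x
    rw [← d.stateMatrix_parityOp_compl hA, parityOp, (hd _).pairParity_mulVec, stateMatrix_smul]
  · intro e
    rw [← d.stateMatrix_endIn hA, ← d.stateMatrix_endIn_compl hA, ← stateMatrix_smul]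
    congr 1
    simp only [pairParity, Matrix.smul_mulVec, ← Matrix.mulVec_mulVec]
    rw [hβ (g (e, true)), Matrix.mulVec_smul, majorana_mulVec_comm (d.endIn_ne hg e A Aᶜ),
      hβ (g (e, false)), Matrix.mulVec_smul, majorana_mulVec_comm (d.endIn_ne hg e Aᶜ Aᶜ)]
    simp only [smul_neg, smul_smul, sgn_not, sgn_xor]
    rw [← neg_smul, ← neg_smul]
    congr 1
    linear_combination (Complex.I * sgn (β (g (e, true))) * sgn (β (g (e, false)))) * Complex.I_mul_I
  · intro e
    have hu := d.endIn_mem (hg.mem_crossing (e, false))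
    have hv := d.endIn_mem (hg.compl.mem_crossing (e, false))
    have h1 := congrArg (stateMatrix A) (hβ (g (e, false)))
    rw [stateMatrix_smul, stateMatrix_majorana hA hu, stateMatrix_majorana_compl hA hv] at h1
    have hf : (d.regionSystem hL' hg.compl).flip (.inr e) =
        jwOp (⟨(d.endIn Aᶜ (g (e, false))).1, hv⟩, (d.endIn Aᶜ (g (e, false))).2) := by
      simp only [endIn_eq]
      rfl
    rw [hf]
    refine exists_cross ?_ (jwOp_conjTranspose _) zString_mul_self zString_conjTranspose h1
    convert jwOp_mul_self _
  · rw [← hn, sum_split (A := A)]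
    rfl

end DimerDiagram

/-! ### Choosing logical dimers -/

section Logical

variable {B : Type*}

/-- A configuration of bits as a vector over the field with two elements. -/
def bitVec (b : B → Bool) : B → ZMod 2 := fun t => if b t then 1 else 0

theorem bitVec_apply_eq_iff (b b' : B → Bool) (t : B) : bitVec b t = bitVec b' t ↔ b t = b' t := by
  cases h : b t <;> cases h' : b' t <;> simp [bitVec, h, h']

/-- The element of the field with two elements that is given by a bit. -/
def bitVal (x : Bool) : ZMod 2 := if x then 1 else 0

theorem bitVal_xor (x y : Bool) : bitVal (xor x y) = bitVal x + bitVal y := by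
  revert x y; decide

theorem bitVal_eq_one (x : Bool) : decide (bitVal x = 1) = x := by
  cases x <;> simp [bitVal]

theorem bitVal_decide (x : ZMod 2) : bitVal (decide (x = 1)) = x := by
  have : ∀ x : ZMod 2, (if x = 1 then (1 : ZMod 2) else 0) = x := by decide
  conv_rhs => rw [← this x]
  by_cases h : x = 1 <;> simp [bitVal, h]

theorem bitVec_surjective : Function.Surjective (bitVec : (B → Bool) → B → ZMod 2) := by
  intro v
  exact ⟨fun t => decide (v t = 1), funext fun t => bitVal_decide (v t)⟩

/-- Subtracting the value at 0 leaves an additive map, and additive maps over the field with two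
elements are linear. -/
theorem AffineBit.exists_linear {f : (B → Bool) → Bool} (hf : AffineBit f) :
    ∃ (l : (B → ZMod 2) →ₗ[ZMod 2] ZMod 2) (c : ZMod 2), ∀ b, bitVal (f b) = l (bitVec b) + c := by
  let F : (B → ZMod 2) → ZMod 2 := fun v => bitVal (f fun t => decide (v t = 1))
  have hF : ∀ b, F (bitVec b) = bitVal (f b) := fun b =>
    congrArg (fun b => bitVal (f b)) (funext fun t => bitVal_eq_one (b t))
  have hadd : ∀ v w, F (v + w) = F v + F w + F 0 := by
    intro v w
    obtain ⟨b, rfl⟩ := bitVec_surjective v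
    obtain ⟨b', rfl⟩ := bitVec_surjective w
    have h1 : bitVec b + bitVec b' = bitVec fun t => b t ^^ b' t :=
      funext fun t => (bitVal_xor _ _).symm
    have h0 : (0 : B → ZMod 2) = bitVec fun _ => false := rfl
    rw [h1, h0, hF, hF, hF, hF, hf, bitVal_xor, bitVal_xor]
  have h2 : F 0 + F 0 = 0 := CharTwo.add_self_eq_zero _
  let G : (B → ZMod 2) →+ ZMod 2 :=
    { toFun := fun v => F v + F 0
      map_zero' := h2
      map_add' := fun v w => by linear_combination hadd v w }
  refine ⟨G.toZModLinearMap 2, F 0, fun b => ?_⟩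
  change _ = F _ + F 0 + F 0
  rw [add_assoc, h2, add_zero, hF]

theorem AffineBit.exists_linear_eq_iff {f : (B → Bool) → Bool} (hf : AffineBit f) :
    ∃ l : (B → ZMod 2) →ₗ[ZMod 2] ZMod 2, ∀ b b', f b = f b' ↔ l (bitVec b - bitVec b') = 0 := by
  obtain ⟨l, c, h⟩ := hf.exists_linear
  refine ⟨l, fun b b' => ?_⟩
  have h1 : f b = f b' ↔ bitVal (f b) = bitVal (f b') := by
    cases f b <;> cases f b' <;> simp [bitVal]
  rw [h1, h, h, add_left_inj, map_sub, sub_eq_zero]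

/-- Differences of the bits `f b k` are linear functionals that see only the coordinates in `a`. A
basis among those with `k ∈ T` separates as much as all of them, and it has exactly as many members
as `a` has elements. -/
theorem exists_separating_subset {K : Type*} {T : Finset K} {f : (B → Bool) → K → Bool}
    (hf : ∀ k, AffineBit fun b => f b k) {a : Finset B}
    (h : ∀ b b', (∀ t ∈ a, b t = b' t) ↔ ∀ k ∈ T, f b k = f b' k) :
    ∃ L ⊆ T, (∃ lam : L → a, Function.Bijective lam) ∧
      ∀ b b', (∀ t ∈ a, b t = b' t) ↔ ∀ k ∈ L, f b k = f b' k := by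
  choose l hl using fun k => (hf k).exists_linear_eq_iff
  let E : (a → ZMod 2) →ₗ[ZMod 2] (B → ZMod 2) :=
    { toFun := fun v t => if ht : t ∈ a then v ⟨t, ht⟩ else 0
      map_add' := fun v w => by funext t; by_cases ht : t ∈ a <;> simp [ht]
      map_smul' := fun c v => by funext t; by_cases ht : t ∈ a <;> simp [ht] }
  -- A vector and its truncation to `a` agree on `a`, so the hypothesis makes all functionals from
  -- `T` agree on them.
  have hE : ∀ k ∈ T, ∀ v : B → ZMod 2, l k (E fun t => v t) = l k v := by
    intro k hk v
    obtain ⟨b, rfl⟩ := bitVec_surjective v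
    obtain ⟨b', hb'⟩ := bitVec_surjective (E fun t => bitVec b t)
    rw [← hb', ← sub_eq_zero, ← map_sub, ← hl]
    refine (h b' b).1 (fun t ht => ?_) k hk
    rw [← bitVec_apply_eq_iff, hb']
    simp [E, ht]
  let m : K → Module.Dual (ZMod 2) (a → ZMod 2) := fun k => (l k).comp E
  obtain ⟨L, hLT, -, hspan, hli⟩ := exists_linearIndepOn_extension (K := ZMod 2) (v := m)
    (linearIndepOn_empty _ _) (Set.empty_subset (T : Set K))
  have hfin : L.Finite := T.finite_toSet.subset hLT
  obtain ⟨L, rfl⟩ := hfin.exists_finset_coe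
  have hLT : L ⊆ T := Finset.coe_subset.1 hLT
  have hiff : ∀ b b', (∀ t ∈ a, b t = b' t) ↔ ∀ k ∈ L, f b k = f b' k := by
    intro b b'
    refine ⟨fun hb k hk => (h b b').1 hb k (hLT hk), fun hb => (h b b').2 fun k hk => ?_⟩
    rw [hl, ← hE k hk]
    -- The functionals that vanish on `v` form a subspace. It contains those from `L`, hence their
    -- span, hence those from `T`.
    let v : a → ZMod 2 := fun t => (bitVec b - bitVec b') t
    have hsub : Submodule.span (ZMod 2) (m '' (L : Set K)) ≤
        LinearMap.ker (Module.Dual.eval (ZMod 2) _ v) := by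
      rw [Submodule.span_le]
      rintro _ ⟨k', hk', rfl⟩
      have h1 := (hl k' b b').1 (hb k' hk')
      rw [← hE k' (hLT hk')] at h1
      exact h1
    exact hsub (hspan ⟨k, hk, rfl⟩)
  refine ⟨L, hLT, ?_, hiff⟩
  have h1 : Fintype.card L ≤ Fintype.card a := by
    have := LinearIndependent.fintype_card_le_finrank (R := ZMod 2) hli
    rw [Subspace.dual_finrank_eq, Module.finrank_fintype_fun_eq_card] at this
    simpa using this
  have h2 : Fintype.card a ≤ Fintype.card L := by
    -- The `2 ^ |a|` configurations on `a` are told apart by `|L|` bits.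
    have hinj : Function.Injective fun (i : a → Bool) (k : L) =>
        f (fun t => if ht : t ∈ a then i ⟨t, ht⟩ else false) k := by
      intro i i' hi
      have := (hiff _ _).2 fun k hk => congrFun hi ⟨k, hk⟩
      funext t
      simpa using this t t.2
    have := Fintype.card_le_of_injective _ hinj
    simp only [Fintype.card_fun, Fintype.card_bool] at this
    exact (Nat.pow_le_pow_iff_right (by norm_num)).1 this
  exact ⟨_, (Fintype.equivOfCardEq (le_antisymm h1 h2)).bijective⟩

end Logical

/-! ### Pairing the RT dimers. -/

namespace DimerDiagram

variable {N : ℕ} {B : Type*} (d : DimerDiagram N B) (A : Finset (Fin N))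

/-- The modes in `A` are counted in two ways: two for each qubit of `A`, and two for each inner
dimer plus one for each crossing dimer. -/
theorem even_card_crossing : Even (d.crossing A).card := by
  let f : Mode N → ℕ := fun μ => if μ.1 ∈ A then 1 else 0
  have h1 : ∑ z, f (d.ends z) = ∑ μ, f μ := Equiv.sum_comp d.ends f
  rw [Fintype.sum_prod_type, Fintype.sum_prod_type] at h1
  have h2 : ∀ k, ∑ t, f (d.ends (k, t)) =
      2 * (if k ∈ d.inside A then 1 else 0) + if k ∈ d.crossing A then 1 else 0 := by
    intro k
    simp only [f, Fintype.sum_bool, inside, crossing, Finset.mem_filter, Finset.mem_univ, true_and]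
    by_cases h : (d.ends (k, false)).1 ∈ A <;> by_cases h' : (d.ends (k, true)).1 ∈ A <;>
      simp [h, h']
  have h3 : ∀ k : Fin N, ∑ t, f (k, t) = 2 * if k ∈ A then 1 else 0 := by
    intro k
    simp only [f, Fintype.sum_bool, two_mul]
  simp only [h2, h3, Finset.sum_add_distrib, ← Finset.mul_sum] at h1
  rw [Finset.sum_ite_mem, Finset.univ_inter, Finset.sum_const, smul_eq_mul, mul_one] at h1
  rw [Nat.even_iff]
  simp only [Finset.sum_boole, Nat.cast_id] at h1
  have h4 : (Finset.univ.filter fun k => k ∈ d.crossing A) = d.crossing A := by ext; simp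
  rw [h4] at h1
  omega

theorem exists_pairing : ∃ (n : ℕ) (g : Fin n × Bool → Fin N), d.IsPairing A g := by
  obtain ⟨n, hn⟩ := (d.even_card_crossing A).two_dvd
  have hc : Fintype.card (Fin n × Bool) = Fintype.card (d.crossing A) := by
    rw [Fintype.card_prod, Fintype.card_fin, Fintype.card_bool, Fintype.card_coe, hn, mul_comm]
  let e := Fintype.equivOfCardEq hc
  refine ⟨n, fun z => e z, Subtype.val_injective.comp e.injective, ?_⟩
  ext k
  constructor
  · rintro ⟨z, rfl⟩
    exact (e z).2
  · intro hk
    exact ⟨e.symm ⟨k, hk⟩, by simp⟩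

end DimerDiagram

/-! ### Operator algebras of registers -/

section Algebra

theorem tensorOp_single {ι : Type*} [Fintype ι] [DecidableEq (ι → Bool)] (s t : ι → Bool) :
    tensorOp (fun q => Matrix.single (s q) (t q) 1) = Matrix.single s t (1 : ℂ) := by
  ext s' t'
  simp only [tensorOp, Matrix.of_apply, Matrix.single_apply]
  rw [Finset.prod_boole]
  congr 1
  simp only [Finset.mem_univ, true_implies, funext_iff, ← forall_and]

/-- Matrix units are product operators. -/
theorem span_tensorOp (ι : Type*) [Fintype ι] :
    Submodule.span ℂ (Set.range (tensorOp (ι := ι))) = ⊤ := by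
  rw [eq_top_iff]
  intro M _
  rw [Matrix.matrix_eq_sum_single M]
  refine Submodule.sum_mem _ fun s _ => Submodule.sum_mem _ fun t _ => ?_
  rw [← mul_one (M s t), ← smul_eq_mul, ← Matrix.smul_single]
  exact Submodule.smul_mem _ _ (Submodule.subset_span ⟨_, tensorOp_single s t⟩)

theorem span_kronecker {P Q T D : Type*} [Fintype P] [Fintype Q] [Fintype T] [DecidableEq D] :
    (Submodule.span ℂ {M | ∃ (X : Matrix P P ℂ) (Y : Matrix Q Q ℂ) (Z : Matrix T T ℂ),
      M = (X ⊗ₖ (Y ⊗ₖ Z)) ⊗ₖ (1 : Matrix D D ℂ)} : Set (Matrix _ _ ℂ)) =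
      Set.range fun M : Matrix (P × Q × T) (P × Q × T) ℂ => M ⊗ₖ (1 : Matrix D D ℂ) := by
  let K : Matrix (P × Q × T) (P × Q × T) ℂ →ₗ[ℂ] Matrix ((P × Q × T) × D) ((P × Q × T) × D) ℂ :=
    { toFun := fun M => M ⊗ₖ 1
      map_add' := fun M M' => Matrix.add_kronecker _ _ _
      map_smul' := fun c M => Matrix.smul_kronecker _ _ _ }
  refine Eq.trans ?_ (LinearMap.coe_range K)
  rw [SetLike.coe_set_eq]
  refine le_antisymm (Submodule.span_le.2 ?_) ?_
  · rintro _ ⟨X, Y, Z, rfl⟩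
    exact ⟨_, rfl⟩
  · rintro _ ⟨M, rfl⟩
    rw [Matrix.matrix_eq_sum_single M, map_sum]
    refine Submodule.sum_mem _ fun s _ => ?_
    rw [map_sum]
    refine Submodule.sum_mem _ fun t _ => Submodule.subset_span
      ⟨Matrix.single s.1 t.1 (M s t), Matrix.single s.2.1 t.2.1 1, Matrix.single s.2.2 t.2.2 1, ?_⟩
    rw [Matrix.single_kronecker_single, Matrix.single_kronecker_single, mul_one, mul_one]
    rfl

theorem isUnitary_conj_surjective {P Q : Type*} [Fintype P] [Fintype Q] {U : Matrix Q P ℂ}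
    (hU : IsUnitary U) (M : Matrix Q Q ℂ) : ∃ X : Matrix P P ℂ, U * X * Uᴴ = M := by
  refine ⟨Uᴴ * M * U, ?_⟩
  have h := hU.1
  calc U * (Uᴴ * M * U) * Uᴴ = (U * Uᴴ) * M * (U * Uᴴ) := by simp only [Matrix.mul_assoc]
    _ = M := by rw [h, Matrix.one_mul, Matrix.mul_one]

end Algebra

/-! ### Conjugation by a product of local unitaries. -/

section LocalProduct

variable {N : ℕ} {Q Q' : Type*} [Fintype Q] [Fintype Q'] {A : Finset (Fin N)}
  {U : Matrix Q (A → Bool) ℂ} {U' : Matrix Q' ((Aᶜ : Finset (Fin N)) → Bool) ℂ}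

theorem localProduct_eq_submatrix :
    localProduct A U U' = (U ⊗ₖ U').submatrix id (splitEquiv A) := rfl

theorem extendOp_eq_submatrix [DecidableEq ((Aᶜ : Finset (Fin N)) → Bool)]
    (X : Matrix (A → Bool) (A → Bool) ℂ) :
    extendOp A X = (X ⊗ₖ (1 : Matrix ((Aᶜ : Finset (Fin N)) → Bool) _ ℂ)).submatrix
      (splitEquiv A) (splitEquiv A) := by
  ext x y
  have h : (∀ q, q ∉ A → x q = y q) ↔ (splitEquiv A x).2 = (splitEquiv A y).2 := by
    rw [funext_iff]
    simp [splitEquiv]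
  simp only [extendOp, Matrix.of_apply, Matrix.submatrix_apply, Matrix.kroneckerMap_apply,
    Matrix.one_apply, mul_ite, mul_one, mul_zero]
  by_cases hc : ∀ q, q ∉ A → x q = y q
  · rw [if_pos hc, if_pos (h.1 hc)]
    rfl
  · rw [if_neg hc, if_neg (mt h.2 hc)]

theorem localProduct_conj (hU' : IsUnitary U') [DecidableEq Q']
    (X : Matrix (A → Bool) (A → Bool) ℂ) :
    localProduct A U U' * extendOp A X * (localProduct A U U')ᴴ =
      (U * X * Uᴴ) ⊗ₖ (1 : Matrix Q' Q' ℂ) := by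
  have h : U' * U'ᴴ = 1 := by convert hU'.1
  rw [extendOp_eq_submatrix, localProduct_eq_submatrix, Matrix.conjTranspose_submatrix,
    Matrix.submatrix_mul_equiv, Matrix.submatrix_mul_equiv, Matrix.submatrix_id_id,
    Matrix.conjTranspose_kronecker, ← Matrix.mul_kronecker_mul, ← Matrix.mul_kronecker_mul,
    Matrix.mul_one, h]

theorem range_localProduct_conj (hU : IsUnitary U) (hU' : IsUnitary U') [DecidableEq Q'] :
    Set.range (fun X : Matrix (A → Bool) (A → Bool) ℂ =>
      localProduct A U U' * extendOp A X * (localProduct A U U')ᴴ) =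
      Set.range fun M : Matrix Q Q ℂ => M ⊗ₖ (1 : Matrix Q' Q' ℂ) := by
  simp only [localProduct_conj hU']
  ext M
  constructor
  · rintro ⟨X, rfl⟩
    exact ⟨_, rfl⟩
  · rintro ⟨M, rfl⟩
    obtain ⟨X, hX⟩ := isUnitary_conj_surjective hU M
    exact ⟨X, by simp only [hX]⟩

theorem localProduct_mulVec_injective (hU : IsUnitary U) (hU' : IsUnitary U')
    {ψ φ : (Fin N → Bool) → ℂ} (h : localProduct A U U' *ᵥ ψ = localProduct A U U' *ᵥ φ) :
    ψ = φ := by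
  apply stateMatrix_injective (A := A)
  have h1 : U * stateMatrix A ψ * U'ᵀ = U * stateMatrix A φ * U'ᵀ := by
    ext q q'
    have := congrFun h (q, q')
    rwa [localProduct_mulVec, localProduct_mulVec] at this
  have h2 : U'ᵀ * (U'ᴴ)ᵀ = 1 := by
    rw [← Matrix.transpose_mul]
    have h : U'ᴴ * U' = 1 := by convert hU'.2
    rw [h, Matrix.transpose_one]
  have h3 : Uᴴ * U = 1 := by convert hU.2
  have h4 := congrArg (fun M => Uᴴ * M * (U'ᴴ)ᵀ) h1
  simp only [Matrix.mul_assoc] at h4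
  rw [h2, Matrix.mul_one, Matrix.mul_one, ← Matrix.mul_assoc, ← Matrix.mul_assoc, h3, Matrix.one_mul,
    Matrix.one_mul] at h4
  exact h4

end LocalProduct

/-! ### Complementary recovery -/

section Recovery

variable {N : ℕ} {B : Type*} [Fintype B]

/-- The boundary operators `O i i'` represent the bulk operators `|i⟩⟨i'|` on `a`. -/
structure Recovers (V : Matrix (Fin N → Bool) (B → Bool) ℂ) (A : Finset (Fin N)) (a : Finset B)
    (O : (a → Bool) → (a → Bool) → Matrix (A → Bool) (A → Bool) ℂ) : Prop where
  conj_mul : ∀ i i', (O i i')ᴴ * O i i' = O i' i'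
  mulVec : ∀ b b' : B → Bool, (∀ t ∉ a, b t = b' t) →
    extendOp A (O (fun t => b t) fun t => b' t) *ᵥ (fun x => V x b') = fun x => V x b
  mulVec_eq_zero : ∀ i i' (b' : B → Bool), (fun t : a => b' t) ≠ i' →
    extendOp A (O i i') *ᵥ (fun x => V x b') = 0

/-- The operators are the images of the matrix units `|i⟩⟨i'|`. The homomorphism turns the relations
among matrix units into the required ones. -/
theorem Recoverable.exists_recovers {V : Matrix (Fin N → Bool) (B → Bool) ℂ} {A : Finset (Fin N)}
    {a : Finset B} (h : Recoverable V A a) : ∃ O, Recovers V A a O := by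
  obtain ⟨ι, -, hι⟩ := h
  have hcol : ∀ i i' (b' : B → Bool) x,
      (extendOp A (ι (Matrix.single i i' 1)) *ᵥ fun x => V x b') x =
        ∑ c, V x c * extendOp a (Matrix.single i i' 1) c b' := by
    intro i i' b' x
    exact congrFun (congrFun (hι (Matrix.single i i' 1)) x) b'
  refine ⟨fun i i' => ι (Matrix.single i i' 1), ?_, ?_, ?_⟩
  · intro i i'
    have h1 : (ι (Matrix.single i i' 1))ᴴ = ι (Matrix.single i' i 1) := by
      rw [← Matrix.star_eq_conjTranspose, ← map_star, Matrix.star_eq_conjTranspose,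
        Matrix.conjTranspose_single, star_one]
    rw [h1, ← map_mul, Matrix.single_mul_single_same, mul_one]
  · intro b b' hb
    funext x
    rw [hcol, Finset.sum_eq_single b]
    · rw [extendOp, Matrix.of_apply, if_pos hb, Matrix.single_apply_same, mul_one]
    · intro c _ hc
      rw [extendOp, Matrix.of_apply]
      split_ifs with hcb
      · rw [Matrix.single_apply_of_row_ne, mul_zero]
        intro heq
        apply hc
        funext t
        by_cases ht : t ∈ a
        · exact (congrFun heq ⟨t, ht⟩).symm
        · rw [hcb t ht, hb t ht]
      · rw [mul_zero]
    · simp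
  · intro i i' b' hb
    funext x
    rw [hcol]
    refine Finset.sum_eq_zero fun c _ => ?_
    rw [extendOp, Matrix.of_apply, Matrix.single_apply_of_col_ne _ _ (Ne.symm hb)]
    simp

variable {V : Matrix (Fin N → Bool) (B → Bool) ℂ} {A : Finset (Fin N)} {a a' : Finset B}
  {O : (a → Bool) → (a → Bool) → Matrix (A → Bool) (A → Bool) ℂ}
  {O' : (a' → Bool) → (a' → Bool) → Matrix ((Aᶜ : Finset (Fin N)) → Bool) _ ℂ}

theorem Recovers.mul_stateMatrix (hO : Recovers V A a O) {b b' : B → Bool}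
    (h : ∀ t ∉ a, b t = b' t) :
    O (fun t => b t) (fun t => b' t) * stateMatrix A (fun x => V x b') =
      stateMatrix A fun x => V x b := by
  rw [← stateMatrix_extendOp, hO.mulVec b b' h]

theorem Recovers.stateMatrix_mul (hO : Recovers V Aᶜ a' O') {b b' : B → Bool}
    (h : ∀ t ∉ a', b t = b' t) :
    stateMatrix A (fun x => V x b') * (O' (fun t => b t) fun t => b' t)ᵀ =
      stateMatrix A fun x => V x b := by
  rw [← stateMatrix_extendOp_compl, hO.mulVec b b' h]

theorem Recovers.mul_stateMatrix_eq_zero (hO : Recovers V A a O) {i i' : a → Bool} {b' : B → Bool}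
    (h : (fun t : a => b' t) ≠ i') : O i i' * stateMatrix A (fun x => V x b') = 0 := by
  rw [← stateMatrix_extendOp, hO.mulVec_eq_zero i i' b' h]
  rfl

theorem Recovers.stateMatrix_mul_eq_zero (hO : Recovers V Aᶜ a' O') {i i' : a' → Bool}
    {b' : B → Bool} (h : (fun t : a' => b' t) ≠ i') :
    stateMatrix A (fun x => V x b') * (O' i i')ᵀ = 0 := by
  rw [← stateMatrix_extendOp_compl, hO.mulVec_eq_zero i i' b' h]
  rfl

end Recovery

/-! ### Indistinguishability on the complementary side. -/

section NotDistinguishable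

variable {α β : Type*} [Fintype α] [DecidableEq α] [Fintype β] [DecidableEq β]
  {X X' : Type*} [Fintype X] [DecidableEq X] [Fintype X'] [DecidableEq X'] {n : ℕ}
  {S : ParitySystem (X ⊕ Fin n) α} {S' : ParitySystem (X' ⊕ Fin n) β}

/-- On this side the sign patterns do not involve `κ`, so vectors with the same label already lie on
a common line. -/
theorem IsEntangled.not_distinguishable_right [Nonempty β] {Ψ Ψ₂ : Matrix α β ℂ}
    {p p₂ : X → Bool} {p' : X' → Bool} {κ κ₂ : Fin n → Bool} (h : IsEntangled S S' Ψ p p' κ)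
    (h₂ : IsEntangled S S' Ψ₂ p₂ p' κ₂) {O : Matrix β β ℂ} (hO : Ψ * Oᵀ = Ψ) (hO₂ : Ψ₂ * Oᵀ = 0) :
    False := by
  obtain ⟨g, f, hg, hf, -, hfe, hΨ⟩ := h.schmidt
  obtain ⟨g₂, f₂, hg₂, hf₂, -, hfe₂, hΨ₂⟩ := h₂.schmidt
  obtain ⟨v, hv, ho⟩ := S'.exists_basis
  let s : Fin n → Bool := fun _ => false
  have h1 : O *ᵥ f s = f s := schmidt_mul hg hΨ O (by rw [hO]; exact hΨ) s
  have hz : ∀ x : α → ℂ, Matrix.vecMulVec x (0 : β → ℂ) = 0 := fun x => by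
    ext
    simp [Matrix.vecMulVec_apply]
  have h2 : O *ᵥ f₂ s = 0 :=
    schmidt_mul hg₂ hΨ₂ O (f' := fun _ => 0) (by simp [hO₂, hz]) s
  have h3 := (hfe s).eq_smul hv ho
  have h4 := (hfe₂ s).eq_smul hv ho
  set c := star (v (Sum.elim p' s)) ⬝ᵥ f s
  set c₂ := star (v (Sum.elim p' s)) ⬝ᵥ f₂ s
  have hc : c₂ ≠ 0 := by
    intro hc
    have := hf₂ s s
    rw [h4, hc] at this
    simp at this
  rw [h4, Matrix.mulVec_smul] at h2
  have h5 := (smul_eq_zero.1 h2).resolve_left hc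
  rw [h3, Matrix.mulVec_smul, h5, smul_zero] at h1
  have := hf s s
  rw [h3, ← h1] at this
  simp at this

end NotDistinguishable

/-! ### Inner parities and the bulk bits of the wedge. -/

namespace DimerDiagram

variable {N : ℕ} {B : Type*} [Fintype B] {d : DimerDiagram N B}
  {V : Matrix (Fin N → Bool) (B → Bool) ℂ} {A : Finset (Fin N)} {a a' : Finset B}
  {O : (a → Bool) → (a → Bool) → Matrix (A → Bool) (A → Bool) ℂ}
  {O' : (a' → Bool) → (a' → Bool) → Matrix ((Aᶜ : Finset (Fin N)) → Bool) _ ℂ}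

theorem stateMatrix_ne_zero {ψ : (Fin N → Bool) → ℂ} (hn : ∑ x, star (ψ x) * ψ x = 1) :
    stateMatrix A ψ ≠ 0 := by
  intro h
  have h0 : ψ = 0 := stateMatrix_injective (A := A) h
  rw [h0] at hn
  simp at hn

/-- The bits in `a'` are changed by an operator on the complement of `A`, which commutes with parity
operators inside `A` and so preserves their values. -/
theorem parity_eq_of_eqOn (hd : d.Describes V) (hn : ∀ b, ∑ x, star (V x b) * V x b = 1)
    (hA : ∀ j ∈ A, ∀ k ∉ A, j < k) (hO' : Recovers V Aᶜ a' O') {b b' : B → Bool}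
    (h : ∀ t ∉ a', b t = b' t) {k : Fin N} (hk : k ∈ d.inside A) : d.parity b k = d.parity b' k := by
  rw [mem_inside] at hk
  have h1 : ∀ b, jwPair ((⟨_, hk false⟩, (d.ends (k, false)).2) : A × Bool)
      (⟨_, hk true⟩, (d.ends (k, true)).2) * stateMatrix A (fun x => V x b) =
        sgn (d.parity b k) • stateMatrix A fun x => V x b := by
    intro b
    rw [← stateMatrix_pairParity hA, (hd b k).pairParity_mulVec, stateMatrix_smul]
  have h2 := h1 b
  rw [← hO'.stateMatrix_mul h, ← Matrix.mul_assoc, h1 b', Matrix.smul_mul, ← sub_eq_zero,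
    ← sub_smul, hO'.stateMatrix_mul h] at h2
  have h3 := (smul_eq_zero.1 h2).resolve_right (stateMatrix_ne_zero (hn b))
  exact (sgn_injective (sub_eq_zero.1 h3)).symm

theorem parity_eq_of_eqOn_compl (hd : d.Describes V) (hn : ∀ b, ∑ x, star (V x b) * V x b = 1)
    (hA : ∀ j ∈ A, ∀ k ∉ A, j < k) (hO : Recovers V A a O) {b b' : B → Bool}
    (h : ∀ t ∉ a, b t = b' t) {k : Fin N} (hk : k ∈ d.inside Aᶜ) :
    d.parity b k = d.parity b' k := by
  rw [mem_inside] at hk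
  have h1 : ∀ b, stateMatrix A (fun x => V x b) *
      (jwPair ((⟨_, hk false⟩, (d.ends (k, false)).2) : (Aᶜ : Finset (Fin N)) × Bool)
      (⟨_, hk true⟩, (d.ends (k, true)).2))ᵀ =
        sgn (d.parity b k) • stateMatrix A fun x => V x b := by
    intro b
    rw [← stateMatrix_pairParity_compl hA, (hd b k).pairParity_mulVec, stateMatrix_smul]
  have h2 := h1 b
  rw [← hO.mul_stateMatrix h, Matrix.mul_assoc, h1 b', Matrix.mul_smul, ← sub_eq_zero,
    ← sub_smul, hO.mul_stateMatrix h] at h2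
  have h3 := (smul_eq_zero.1 h2).resolve_right (stateMatrix_ne_zero (hn b))
  exact (sgn_injective (sub_eq_zero.1 h3)).symm

/-- If the bits in `a` differed, the recovered projector on one of the two bulk configurations would
fix one code state and annihilate the other, although equal parities inside `A` make their supports
on `A` meet. -/
theorem eqOn_of_parity_eq (hd : d.Describes V) (hn : ∀ b, ∑ x, star (V x b) * V x b = 1)
    (hA : ∀ j ∈ A, ∀ k ∉ A, j < k) (hO : Recovers V A a O) {b b' : B → Bool}
    (h : ∀ k ∈ d.inside A, d.parity b k = d.parity b' k) : ∀ t ∈ a, b t = b' t := by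
  by_contra hne
  obtain ⟨n, g, hg⟩ := d.exists_pairing A
  -- With no logical dimers selected, all inner dimers count as auxiliary and enter on the same
  -- footing.
  obtain ⟨κ, h1⟩ := d.isEntangled hA (Finset.empty_subset _) (Finset.empty_subset _) hg (hd b) (hn b)
  obtain ⟨κ', h2⟩ := d.isEntangled hA (Finset.empty_subset _) (Finset.empty_subset _) hg (hd b')
    (hn b')
  have hp : (fun x => d.parity b' (d.label A ∅ x)) = fun x => d.parity b (d.label A ∅ x) := by
    funext x
    exact (h _ (d.label_mem (Finset.empty_subset _) x)).symm
  rw [hp] at h2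
  refine h1.not_distinguishable h2 (hO.mul_stateMatrix fun _ _ => rfl)
    (hO.mul_stateMatrix_eq_zero fun heq => hne fun t ht => (congrFun heq ⟨t, ht⟩).symm)

theorem eqOn_of_parity_eq_compl (hd : d.Describes V) (hn : ∀ b, ∑ x, star (V x b) * V x b = 1)
    (hA : ∀ j ∈ A, ∀ k ∉ A, j < k) (hO' : Recovers V Aᶜ a' O') {b b' : B → Bool}
    (h : ∀ k ∈ d.inside Aᶜ, d.parity b k = d.parity b' k) : ∀ t ∈ a', b t = b' t := by
  by_contra hne
  obtain ⟨n, g, hg⟩ := d.exists_pairing A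
  obtain ⟨κ, h1⟩ := d.isEntangled hA (Finset.empty_subset _) (Finset.empty_subset _) hg (hd b) (hn b)
  obtain ⟨κ', h2⟩ := d.isEntangled hA (Finset.empty_subset _) (Finset.empty_subset _) hg (hd b')
    (hn b')
  have hp : (fun x => d.parity b' (d.label Aᶜ ∅ x)) = fun x => d.parity b (d.label Aᶜ ∅ x) := by
    funext x
    exact (h _ (d.label_mem (Finset.empty_subset _) x)).symm
  rw [hp] at h2
  refine h1.not_distinguishable_right h2 (hO'.stateMatrix_mul fun _ _ => rfl)
    (hO'.stateMatrix_mul_eq_zero fun heq => hne fun t ht => (congrFun heq ⟨t, ht⟩).symm)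

theorem exists_isLogical (hp : ∀ k, AffineBit fun b => d.parity b k)
    (h : ∀ b b', (∀ t ∈ a, b t = b' t) ↔ ∀ k ∈ d.inside A, d.parity b k = d.parity b' k) :
    ∃ L lam, d.IsLogical A a L lam := by
  obtain ⟨L, hL, ⟨lam, hlam⟩, hiff⟩ := exists_separating_subset hp h
  exact ⟨L, lam, hL, hlam, hiff⟩

end DimerDiagram

/-! ### Entanglement of code states in adapted bases -/

section Frames

variable {α β Q Q' : Type*} [Fintype α] [DecidableEq α] [Fintype β] [DecidableEq β]
  {w : Q → α → ℂ} {w' : Q' → β → ℂ} {J J' : Type*} [Fintype J] [Fintype J']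
  {S : ParitySystem J α} {S' : ParitySystem J' β}

theorem frame_mul_frame (w : Q → α → ℂ) (w' : Q' → β → ℂ) (Ψ : Matrix α β ℂ) (q : Q) (q' : Q') :
    (frame w * Ψ * (frame w')ᵀ) q q' = star (w q) ⬝ᵥ (Ψ *ᵥ star (w' q')) := by
  rw [Matrix.mul_assoc, Matrix.mul_apply]
  rfl

theorem frame_left {σ : J → Bool} {q : Q} (h : S.IsEigen σ (w q)) (j : J) (Ψ : Matrix α β ℂ)
    (q' : Q') :
    (frame w * (S.P j * Ψ) * (frame w')ᵀ) q q' =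
      sgn (σ j) * (frame w * Ψ * (frame w')ᵀ) q q' := by
  rw [frame_mul_frame, frame_mul_frame, ← Matrix.mulVec_mulVec, h.dotProduct_P]

theorem frame_right {σ : J' → Bool} {q' : Q'} (h : S'.IsEigen σ (w' q')) (j : J')
    (Ψ : Matrix α β ℂ) (q : Q) :
    (frame w * (Ψ * (S'.P j)ᵀ) * (frame w')ᵀ) q q' =
      sgn (σ j) * (frame w * Ψ * (frame w')ᵀ) q q' := by
  rw [frame_mul_frame, frame_mul_frame, ← Matrix.mulVec_mulVec,
    transpose_mulVec_star (S'.P_herm j), h j, star_smul, star_sgn, Matrix.mulVec_smul,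
    dotProduct_smul, smul_eq_mul]

theorem prod_bell {n : ℕ} (s t : Fin n → Bool) :
    ∏ e, bell (s e) (t e) = if s = t then bellAmp ^ n else 0 := by
  simp only [bell]
  split_ifs with h
  · subst h
    simp [bellAmp]
  · obtain ⟨e, he⟩ := Function.ne_iff.1 h
    exact Finset.prod_eq_zero (Finset.mem_univ e) (if_neg he)

variable {L X L' X' : Type*} [Fintype L] [Fintype X] [Fintype L'] [Fintype X'] {n : ℕ}

/-- The common label `s` on the two sides is a product of perfectly correlated bits, which is the
product of the Bell pairs. -/
theorem frame_code_state [DecidableEq L] [DecidableEq X] [DecidableEq L'] [DecidableEq X']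
    {w : (L → Bool) × (X → Bool) × (Fin n → Bool) → α → ℂ}
    {w' : (L' → Bool) × (X' → Bool) × (Fin n → Bool) → β → ℂ} (hw : IsOrtho w) (hw' : IsOrtho w')
    {Ψ : Matrix α β ℂ} {i : L → Bool} {k : L' → Bool}
    (h : Ψ = bellAmp ^ n • ∑ s, Matrix.vecMulVec (w (i, (fun _ => false), s))
      (w' (k, (fun _ => false), s)))
    (q : (L → Bool) × (X → Bool) × (Fin n → Bool))
    (q' : (L' → Bool) × (X' → Bool) × (Fin n → Bool)) :
    (frame w * Ψ * (frame w')ᵀ) q q' =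
      basisKet i q.1 * basisKet (fun _ => false) q.2.1 *
        (basisKet k q'.1 * basisKet (fun _ => false) q'.2.1) *
          ∏ e, bell (q.2.2 e) (q'.2.2 e) := by
  obtain ⟨i₁, χ, s⟩ := q
  obtain ⟨k₁, χ', t⟩ := q'
  rw [frame_mul_frame, h, Matrix.smul_mulVec, Matrix.sum_mulVec, dotProduct_smul, dotProduct_sum,
    prod_bell]
  have h1 : ∀ r : Fin n → Bool, star (w (i₁, χ, s)) ⬝ᵥ
      (Matrix.vecMulVec (w (i, (fun _ => false), r)) (w' (k, (fun _ => false), r)) *ᵥ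
        star (w' (k₁, χ', t))) =
      (if (k₁, χ', t) = (k, (fun _ => false), r) then 1 else 0) *
        if (i₁, χ, s) = (i, (fun _ => false), r) then 1 else 0 := by
    intro r
    rw [Matrix.vecMulVec_mulVec, op_smul_eq_smul, dotProduct_smul, dotProduct_comm (w' _), hw', hw,
      smul_eq_mul]
  simp only [h1]
  rw [Finset.sum_eq_single s]
  · simp only [Prod.mk.injEq, basisKet, and_true, smul_eq_mul, eq_comm (a := t)]
    by_cases h2 : i₁ = i <;> by_cases h3 : χ = (fun _ => false) <;> by_cases h4 : k₁ = k <;>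
      by_cases h5 : χ' = (fun _ => false) <;> by_cases h6 : s = t <;>
      simp [h2, h3, h4, h5, h6]
  · intro r _ hr
    rw [if_neg (c := (i₁, χ, s) = _), mul_zero]
    intro heq
    simp only [Prod.mk.injEq] at heq
    exact hr heq.2.2.symm
  · simp

end Frames

namespace DimerDiagram

variable {N : ℕ} {B : Type*} {d : DimerDiagram N B} {A L : Finset (Fin N)} {a : Finset B}
  {lam : L → a} {n : ℕ} {g : Fin n × Bool → Fin N}

/-- In the new basis the parity operators are diagonal with the signs of `regPattern`. Fixed logical
parities pin the logical qubits by `hp`; for a fixed logical state the other signs differ from those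
of `Z` by constants. The form with `W` and `pr` serves both sides of the cut. -/
theorem formedFrom {Q : Type*} {W : Matrix Q (Fin N → Bool) ℂ} {pr : Q → d.Reg A L n}
    {p : L ⊕ d.aux A L → (L → Bool) → Bool} {ε : (L → Bool) → Fin n → Bool}
    (hW : ∀ v v' : (Fin N → Bool) → ℂ, W *ᵥ v = W *ᵥ v' → v = v')
    (hdiag : ∀ x v q, (W *ᵥ (d.parityOp (d.label A L x) *ᵥ v)) q =
      sgn (regPattern p ε (pr q) (.inl x)) * (W *ᵥ v) q)
    (hpair : ∀ e v q, (W *ᵥ (pairParity (d.endIn A (g (e, false))) (d.endIn A (g (e, true))) *ᵥ v)) q =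
      sgn (regPattern p ε (pr q) (.inr e)) * (W *ᵥ v) q)
    (hp : ∀ i i', (∀ l, p (.inl l) i = p (.inl l) i') → i = i')
    (hb : ∀ b x, d.parity b (d.label A L x) = p x fun l => b (lam l)) :
    d.FormedFrom A a L lam g W pr := by
  intro b
  have hmem : ∀ v : (Fin N → Bool) → ℂ, (∀ k ∈ L, d.parityOp k *ᵥ v = sgn (d.parity b k) • v) →
      ∀ q, (W *ᵥ v) q ≠ 0 → (pr q).1 = fun k => b (lam k) := by
    intro v hv q hq
    refine hp _ _ fun l => ?_
    have h1 := hdiag (.inl l) v q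
    have h2 : d.parityOp (d.label A L (.inl l)) *ᵥ v = sgn (d.parity b (d.label A L (.inl l))) • v :=
      hv l l.2
    rw [h2, Matrix.mulVec_smul, Pi.smul_apply, smul_eq_mul, hb] at h1
    exact (sgn_injective (mul_right_cancel₀ hq h1)).symm
  refine ⟨fun v => ⟨hmem v, fun h k hk => hW _ _ ?_⟩, ε fun k => b (lam k), fun v hv => ⟨?_, ?_⟩⟩
  · funext q
    have h1 := hdiag (.inl ⟨k, hk⟩) v q
    have h2 := hb b (.inl ⟨k, hk⟩)
    change (W *ᵥ (d.parityOp k *ᵥ v)) q = _ at h1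
    change d.parity b k = _ at h2
    rw [h1, Matrix.mulVec_smul, Pi.smul_apply, smul_eq_mul]
    by_cases hq : (W *ᵥ v) q = 0
    · rw [hq, mul_zero, mul_zero]
    · rw [h2, ← h q hq]
      rfl
  · intro k q
    have h1 := hdiag (.inr k) v q
    have h2 := hb b (.inr k)
    change (W *ᵥ (d.parityOp k *ᵥ v)) q = _ at h1
    change d.parity b k = _ at h2
    by_cases hq : (W *ᵥ v) q = 0
    · rw [h1, hq, mul_zero, mul_zero, mul_zero]
    · rw [h1, h2, ← hmem v hv q hq]
      simp only [regPattern, Sum.elim_inl, Sum.elim_inr, sgn_xor]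
      rw [← mul_assoc, ← mul_assoc, sgn_mul_self, one_mul]
  · intro e q
    rw [hpair]
    by_cases hq : (W *ᵥ v) q = 0
    · rw [hq, mul_zero, mul_zero, mul_zero]
    · rw [← hmem v hv q hq]
      simp only [regPattern, Sum.elim_inr, sgn_xor]
      rw [← mul_assoc, ← mul_assoc, sgn_mul_self, one_mul]

end DimerDiagram

/-! ### Factorization of the code -/

/-- The bulk configuration with given values on a region and its complement, both numbered by other
index types. -/
def glue {B L L' : Type*} {a a' : Finset B} (haa : ∀ t, t ∈ a' ↔ t ∉ a) (e : L ≃ a) (e' : L' ≃ a')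
    (i : L → Bool) (k : L' → Bool) (t : B) : Bool :=
  if h : t ∈ a then i (e.symm ⟨t, h⟩) else k (e'.symm ⟨t, (haa t).2 h⟩)

section Glue

variable {B L L' : Type*} {a a' : Finset B} (haa : ∀ t, t ∈ a' ↔ t ∉ a) (e : L ≃ a) (e' : L' ≃ a')

theorem glue_left (i : L → Bool) (k : L' → Bool) (t : a) : glue haa e e' i k t = i (e.symm t) := by
  simp [glue]

theorem glue_right (i : L → Bool) (k : L' → Bool) (t : a') :
    glue haa e e' i k t = k (e'.symm t) := by
  have := (haa t).1 t.2
  simp [glue, this]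

theorem glue_eta (b : B → Bool) : glue haa e e' (fun l => b (e l)) (fun l => b (e' l)) = b := by
  funext t
  by_cases h : t ∈ a
  · rw [glue_left haa e e' _ _ ⟨t, h⟩, Equiv.apply_symm_apply]
  · rw [glue_right haa e e' _ _ ⟨t, (haa t).2 h⟩, Equiv.apply_symm_apply]

end Glue

namespace DimerDiagram

variable {N : ℕ} {B : Type*} [Fintype B] {d : DimerDiagram N B}
  {V : Matrix (Fin N → Bool) (B → Bool) ℂ} {A L L' : Finset (Fin N)} {a a' : Finset B}
  {O : (a → Bool) → (a → Bool) → Matrix (A → Bool) (A → Bool) ℂ}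
  {O' : (a' → Bool) → (a' → Bool) → Matrix ((Aᶜ : Finset (Fin N)) → Bool) _ ℂ}
  {lam : L → a} {lam' : L' → a'} {n : ℕ} {g : Fin n × Bool → Fin N}

/-- The bulk bits are indexed by the logical dimers of the two sides, so code states become a family
in two independent arguments to which `exists_code_vectors` applies. -/
theorem exists_frames (hd : d.Describes V) (hn : ∀ b, ∑ x, star (V x b) * V x b = 1)
    (hA : ∀ j ∈ A, ∀ k ∉ A, j < k) (haa : ∀ t, t ∈ a' ↔ t ∉ a) (hO : Recovers V A a O)
    (hO' : Recovers V Aᶜ a' O') (hL : d.IsLogical A a L lam) (hL' : d.IsLogical Aᶜ a' L' lam')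
    (hg : d.IsPairing A g) :
    ∃ (w : d.Reg A L n → (A → Bool) → ℂ)
      (w' : d.Reg Aᶜ L' n → ((Aᶜ : Finset (Fin N)) → Bool) → ℂ),
      IsUnitary (frame w) ∧ IsUnitary (frame w') ∧
      d.FormedFrom A a L lam g (localProduct A (frame w) (frame w')) Prod.fst ∧
      d.FormedFrom Aᶜ a' L' lam' g (localProduct A (frame w) (frame w')) Prod.snd ∧
      ∀ b q, (localProduct A (frame w) (frame w') *ᵥ fun x => V x b) q =
        basisKet (fun k => b (lam k)) q.1.1 * basisKet (fun _ => false) q.1.2.1 *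
          (basisKet (fun k => b (lam' k)) q.2.1 * basisKet (fun _ => false) q.2.2.1) *
          ∏ e, bell (q.1.2.2 e) (q.2.2.2 e) := by
  let e : L ≃ a := Equiv.ofBijective lam hL.2.1
  let e' : L' ≃ a' := Equiv.ofBijective lam' hL'.2.1
  let β := glue haa e e'
  have hβ : ∀ b, β (fun l => b (lam l)) (fun l => b (lam' l)) = b := glue_eta haa e e'
  have hβl : ∀ i k (t : a), β i k t = i (e.symm t) := glue_left haa e e'
  have hβr : ∀ i k (t : a'), β i k t = k (e'.symm t) := glue_right haa e e'
  let S := d.regionSystem hL.1 hg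
  let S' := d.regionSystem hL'.1 hg.compl
  -- The bits on `a'` are set to `false` here; by `hb` the choice is immaterial.
  let p : L ⊕ d.aux A L → (L → Bool) → Bool := fun x i =>
    d.parity (β i fun _ => false) (d.label A L x)
  let p' : L' ⊕ d.aux Aᶜ L' → (L' → Bool) → Bool := fun x k =>
    d.parity (β (fun _ => false) k) (d.label Aᶜ L' x)
  have hb : ∀ b x, d.parity b (d.label A L x) = p x fun l => b (lam l) := by
    intro b x
    refine parity_eq_of_eqOn hd hn hA hO' (fun t ht => ?_) (d.label_mem hL.1 x)
    rw [haa, not_not] at ht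
    rw [hβl _ _ ⟨t, ht⟩]
    exact congrArg (fun t : a => b t) (e.apply_symm_apply ⟨t, ht⟩).symm
  have hb' : ∀ b x, d.parity b (d.label Aᶜ L' x) = p' x fun l => b (lam' l) := by
    intro b x
    refine parity_eq_of_eqOn_compl hd hn hA hO (fun t ht => ?_) (d.label_mem hL'.1 x)
    rw [← haa] at ht
    rw [hβr _ _ ⟨t, ht⟩]
    exact congrArg (fun t : a' => b t) (e'.apply_symm_apply ⟨t, ht⟩).symm
  have hp : ∀ i i', (∀ l, p (.inl l) i = p (.inl l) i') → i = i' := by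
    intro i i' h
    have h1 := (hL.2.2 _ _).2 fun k hk => h ⟨k, hk⟩
    funext l
    have h2 := h1 (e l) (e l).2
    rwa [hβl, hβl, Equiv.symm_apply_apply] at h2
  have hp' : ∀ i i', (∀ l, p' (.inl l) i = p' (.inl l) i') → i = i' := by
    intro i i' h
    have h1 := (hL'.2.2 _ _).2 fun k hk => h ⟨k, hk⟩
    funext l
    have h2 := h1 (e' l) (e' l).2
    rwa [hβr, hβr, Equiv.symm_apply_apply] at h2
  have hpβ : ∀ i k x, d.parity (β i k) (d.label A L x) = p x i := by
    intro i k x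
    rw [hb]
    congr 1
    funext l
    exact (hβl i k (e l)).trans (congrArg i (e.symm_apply_apply l))
  have hpβ' : ∀ i k x, d.parity (β i k) (d.label Aᶜ L' x) = p' x k := by
    intro i k x
    rw [hb']
    congr 1
    funext l
    exact (hβr i k (e' l)).trans (congrArg k (e'.symm_apply_apply l))
  have hent : ∀ i k, ∃ κ, IsEntangled S S' (stateMatrix A fun x => V x (β i k))
      (fun x => p x i) (fun x => p' x k) κ := by
    intro i k
    obtain ⟨κ, h⟩ := d.isEntangled hA hL.1 hL'.1 hg (hd (β i k)) (hn (β i k))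
    simp only [hpβ, hpβ'] at h
    exact ⟨κ, h⟩
  choose κ hκ using hent
  -- The recovery operators, indexed by logical states, connect code states that differ on one side
  -- only.
  obtain ⟨u, u', ε, ε', hu, hun, hu', hun', hΨ⟩ := exists_code_vectors hκ
    (O := fun i i' => O (fun t => i (e.symm t)) fun t => i' (e.symm t))
    (O' := fun k k' => O' (fun t => k (e'.symm t)) fun t => k' (e'.symm t))
    (fun i i' k => by
      have := hO.mul_stateMatrix (b := β i k) (b' := β i' k) fun t ht => by
        rw [hβr _ _ ⟨t, (haa t).2 ht⟩, hβr _ _ ⟨t, (haa t).2 ht⟩]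
      simpa only [hβl] using this)
    (fun i k k' => by
      have := hO'.stateMatrix_mul (b := β i k) (b' := β i k') fun t ht => by
        rw [haa, not_not] at ht
        rw [hβl _ _ ⟨t, ht⟩, hβl _ _ ⟨t, ht⟩]
      simpa only [hβr] using this)
    (fun i i' => hO.conj_mul _ _) (fun k k' => hO'.conj_mul _ _) (fun _ => false) (fun _ => false)
  obtain ⟨w, hw, hwe, hwu⟩ := exists_frame S hp hu hun
  obtain ⟨w', hw', hwe', hwu'⟩ := exists_frame S' hp' hu' hun'
  have hU : IsUnitary (frame w) := hw.isUnitary (card_reg S)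
  have hU' : IsUnitary (frame w') := hw'.isUnitary (card_reg S')
  refine ⟨w, w', hU, hU', ?_, ?_, ?_⟩
  · refine formedFrom (p := p) (ε := ε) (fun v v' h => localProduct_mulVec_injective hU hU' h)
      (fun x v q => ?_) (fun x v q => ?_) hp hb
    · rw [localProduct_mulVec, localProduct_mulVec, d.stateMatrix_parityOp hA hL.1 hg]
      exact frame_left (hwe q.1) _ _ _
    · rw [localProduct_mulVec, localProduct_mulVec, d.stateMatrix_endIn hA hL.1 hg]
      exact frame_left (hwe q.1) _ _ _
  · refine formedFrom (p := p') (ε := ε') (fun v v' h => localProduct_mulVec_injective hU hU' h)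
      (fun x v q => ?_) (fun x v q => ?_) hp' hb'
    · rw [localProduct_mulVec, localProduct_mulVec, d.stateMatrix_parityOp_compl hA hL'.1 hg.compl]
      exact frame_right (hwe' q.2) _ _ _
    · rw [localProduct_mulVec, localProduct_mulVec, d.stateMatrix_endIn_compl hA hL'.1 hg.compl]
      exact frame_right (hwe' q.2) _ _ _
  · intro b q
    rw [localProduct_mulVec]
    refine frame_code_state hw hw' ?_ _ _
    have h1 := hΨ (fun l => b (lam l)) fun l => b (lam' l)
    rw [hβ] at h1
    rw [h1]
    simp only [hwu, hwu']

end DimerDiagram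

end Happy

end

/-! ### The factorization theorem. -/

theorem mainTheorem6
    (R : Finset Happy.Tile) (hR : Happy.IsPatch R)
    (N : ℕ) (leg : Fin N ≃ {l : Happy.Leg R // l.IsOpen})
    (hleg : ∀ k, Happy.NextOnBoundary R (leg k).1.dart (leg (finRotate N k)).1.dart)
    (m : ℕ) (A : Finset (Fin N)) (hA : A = Finset.univ.filter fun k : Fin N => (k : ℕ) < m)
    (a : Finset R) (ha : Happy.IsEntanglementWedge (Happy.network R leg) A a) :
    ∃ d : Happy.DimerDiagram N R,
      d.Describes (Happy.network R leg) ∧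
      (∃ L lam, d.IsLogical A a L lam) ∧
      (∃ L' lam', d.IsLogical Aᶜ aᶜ L' lam') ∧
      (∃ (n : ℕ) (g : Fin n × Bool → Fin N), d.IsPairing A g) ∧
      ∀ (L : Finset (Fin N)) (lam : L → a), d.IsLogical A a L lam →
      ∀ (L' : Finset (Fin N)) (lam' : L' → (aᶜ : Finset R)), d.IsLogical Aᶜ aᶜ L' lam' →
      ∀ (n : ℕ) (g : Fin n × Bool → Fin N), d.IsPairing A g →
      ∃ (U : Matrix (d.Reg A L n) (A → Bool) ℂ)
        (U' : Matrix (d.Reg Aᶜ L' n) ((Aᶜ : Finset (Fin N)) → Bool) ℂ)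
        (W : Matrix (d.Reg A L n × d.Reg Aᶜ L' n) (Fin N → Bool) ℂ),
        Happy.IsUnitary U ∧ Happy.IsUnitary U' ∧ W = Happy.localProduct A U U' ∧
        -- the boundary algebra is mapped to B(H_a) ⊗ B(H_χ) ⊗ B(H_γ) ⊗ 1
        Set.range (fun X : Matrix (A → Bool) (A → Bool) ℂ => W * Happy.extendOp A X * Wᴴ) =
          (Submodule.span ℂ {M | ∃ (X : Matrix (L → Bool) (L → Bool) ℂ)
            (Y : Matrix (d.aux A L → Bool) (d.aux A L → Bool) ℂ)
            (Z : Matrix (Fin n → Bool) (Fin n → Bool) ℂ),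
            M = (X ⊗ₖ (Y ⊗ₖ Z)) ⊗ₖ
              (1 : Matrix (d.Reg Aᶜ L' n) (d.Reg Aᶜ L' n) ℂ)} : Set (Matrix _ _ ℂ)) ∧
        -- each factor is the tensor product of its qubit algebras
        Submodule.span ℂ (Set.range (Happy.tensorOp (ι := L))) = ⊤ ∧
        Submodule.span ℂ (Set.range (Happy.tensorOp (ι := d.aux A L))) = ⊤ ∧
        Submodule.span ℂ (Set.range (Happy.tensorOp (ι := Fin n))) = ⊤ ∧
        -- the qubits are formed from the logical, the auxiliary and the RT dimers
        d.FormedFrom A a L lam g W Prod.fst ∧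
        d.FormedFrom Aᶜ aᶜ L' lam' g W Prod.snd ∧
        -- code states become |i⟩ |j⟩ |0⟩ |0⟩ and a fixed Bell pair for each pair of RT dimers
        ∀ b q, (W *ᵥ fun x => Happy.network R leg x b) q =
          Happy.basisKet (fun k => b (lam k)) q.1.1 * Happy.basisKet (fun _ => false) q.1.2.1 *
          (Happy.basisKet (fun k => b (lam' k)) q.2.1 *
            Happy.basisKet (fun _ => false) q.2.2.1) *
          ∏ e, Happy.bell (q.1.2.2 e) (q.2.2.2 e) := by

  obtain ⟨d, hd, hp, hn⟩ := Happy.exists_dimerDiagram leg hR hleg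
  have hA' : ∀ j ∈ A, ∀ k ∉ A, j < k := by
    intro j hj k hk
    simp only [hA, Finset.mem_filter, Finset.mem_univ, true_and] at hj hk
    exact Fin.lt_def.2 (by omega)
  have hrec' : Happy.Recoverable (Happy.network R leg) Aᶜ aᶜ := by convert ha.2
  obtain ⟨O, hO⟩ := ha.1.exists_recovers
  obtain ⟨O', hO'⟩ := hrec'.exists_recovers
  have haa : ∀ t, t ∈ aᶜ ↔ t ∉ a := fun t => Finset.mem_compl
  refine ⟨d, hd, ?_, ?_, d.exists_pairing A, ?_⟩
  · refine Happy.DimerDiagram.exists_isLogical hp fun b b' =>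
      ⟨fun h k hk => Happy.DimerDiagram.parity_eq_of_eqOn hd hn hA' hO' (fun t ht => h t ?_) hk,
        Happy.DimerDiagram.eqOn_of_parity_eq hd hn hA' hO⟩
    rwa [haa, not_not] at ht
  · refine Happy.DimerDiagram.exists_isLogical hp fun b b' =>
      ⟨fun h k hk => Happy.DimerDiagram.parity_eq_of_eqOn_compl hd hn hA' hO
        (fun t ht => h t ((haa t).2 ht)) hk,
        Happy.DimerDiagram.eqOn_of_parity_eq_compl hd hn hA' hO'⟩
  · intro L lam hL L' lam' hL' n g hg
    obtain ⟨w, w', hU, hU', hf, hf', hc⟩ :=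
      Happy.DimerDiagram.exists_frames hd hn hA' haa hO hO' hL hL' hg
    refine ⟨Happy.frame w, Happy.frame w', _, hU, hU', rfl, ?_, Happy.span_tensorOp _,
      Happy.span_tensorOp _, Happy.span_tensorOp _, hf, hf', hc⟩
    -- The products span all operators of the form `M ⊗ 1`, and conjugation by a unitary reaches
    -- every `M`.
    rw [Happy.span_kronecker]
    exact Happy.range_localProduct_conj hU hU'
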